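/- **Setting.** For $x\in\mathbb K^\nu$ put $|x|=\max_i|x_i|$, and let $\Delta_\nu(\rho)=\{|x|<\rho\}$. A *local generic submanifold* $M\subset\mathbb C^n$ of CR dimension $m\ge1$ and codimension $d=n-m\ge1$ with central point $p_0$ is given, in coordinates $t=(z,w)=(x+iy,u+iv)\in\mathbb C^m\times\mathbb C^d$ vanishing at $p_0$, as a graph $M=\{t\in\Delta_n(\rho_1): v=\varphi(x,y,u)\}$, with $\varphi$ real analytic on $\Delta_{2m+d}(2\rho_1)\subset\mathbb R^{2m+d}$ and $|\varphi(x,y,u)|<\rho$ whenever $|(x,y,u)|<\rho\le2\rho_1$. It is also given as $M=\{t\in\Delta_n(\rho_1):\bar w_j=\Theta_j(\bar z,z,w),\ 1\le j\le d\}$, with $\Theta_j$ holomorphic in $\Delta_{2m+d}(2\rho_1)\subset\mathbb C^{2m+d}$. Put $r_j(t,\bar\tau)=\bar\omega_j-\Theta_j(\bar\zeta,z,w)$ for $t=(z,w)$ and $\tau=(\zeta,\omega)$, let $\overline L_k=\frac{\partial}{\partial\bar z_k}+\sum_j\frac{\partial\Theta_j}{\partial\bar z_k}(\bar z,z,w)\frac{\partial}{\partial\bar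 w_j}$ $(1\le k\le m)$ be the standard basis of $(0,1)$ vector fields tangent to $M$, and put $\overline L^\beta=\overline L_1^{\beta_1}\cdots\overline L_m^{\beta_m}$ for $\beta\in\mathbb N^m$. Let $M'\subset\mathbb C^{n'}$ be a local generic submanifold with data $p_0',m',d',\rho_1',\Theta',r'$. A *local $\mathcal C^\infty$-smooth CR mapping* $h:M\to M'$ is a $\mathcal C^\infty$ map on $M$ with values in $\mathbb C^{n'}$ whose components are annihilated by $\overline L_1,\dots,\overline L_m$, with $h(p_0)=p_0'$ and $h(M\cap\Delta_n(\rho_2))\subset M'\cap\Delta_{n'}(\rho_2')$ for some $0<\rho_2<\rho_1$, $0<\rho_2'<\rho_1'$. It is *essentially finite at $p_0$* if the complex analytic set $$\mathbb V_0'=\bigl\{t'\in\Delta_{n'}(\rho_2'):\ \bigl[\overline L^\beta\, r'_{j'}(t',\overline{h(t)})\bigr]\big|_{t=p_0}=0\ \text{ for all } 1\le j'\le d',\ \beta\in\mathbb N^m\bigr\}$$ has dimension $0$ at $p_0'$. The submanifold $M'$ is *essentially finite at $p_0'$* if this holds for its identity map (with $\rho_1'$ in place of $\rho_2'$). A real analytic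 CR submanifold of $\mathbb C^{n'}$ which need not be generic is essentially finite at a point if it is so as a generic submanifold of its intrinsic complexification, that is, if near the point it is the image, under a germ of holomorphic embedding, of a local generic submanifold that is essentially finite at its central point. The *CR orbit* $\mathcal O_{CR}(M,p_0)$ is the set of endpoints of piecewise $\mathcal C^1$ curves in $M$ issued from $p_0$ with velocity in $T^cM=TM\cap iTM$. Its manifold structure near $p_0$ is that of an embedded real analytic submanifold $N\ni p_0$ with $N\subset\mathcal O_{CR}(M,p_0)$ and $T^c_qM\subset T_qN$ for all $q\in N$. The germ of such an $N$ at $p_0$ is unique, and its dimension is the dimension of the orbit. Finally, $M$ is *minimal at $p_0$* if for every neighbourhood $U$ of $p_0$ the CR orbit of $p_0$ in $M\cap U$ contains a neighbourhood of $p_0$ in $M$. **Lemma.** (1) Let $M'$ be a local generic submanifold of $\mathbb C^{n'}$ with central point $p_0'$ which is essentially finite at $p_0'$. Then near $p_0'$ the CR orbit $\mathcal O_{CR}(M',p_0')$ has the structure of an embedded real analytic submanifold $N$ as above, and every such $N$ satisfies $\dim_{\mathbb R}N\ge 2m'+1=2\,\mathrm{CRdim}\,M'+1$ and is essentially finite at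 $p_0'$. (2) Let $h:M\to M'$ be a local $\mathcal C^\infty$-smooth CR mapping between local generic submanifolds, where $M$ is a hypersurface ($d=1$). If $h$ is essentially finite at $p_0$, then $M$ is minimal at $p_0$. -/

import Mathlib

open Filter Topology
open scoped ComplexConjugate ContDiff

noncomputable section

namespace CRGeom

/-- `ℂᵐ × ℂᵈ`, with coordinates `(z, w)` and the maximum norm, so that `Metric.ball 0 ρ` is the
polydisc of radius `ρ`. -/
abbrev CSpace (m d : ℕ) : Type := (Fin m → ℂ) × (Fin d → ℂ)

/-- `ℝᵐ × ℝᵐ × ℝᵈ`, with coordinates `(x, y, u)` and the maximum norm. -/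
abbrev RSpace (m d : ℕ) : Type := (Fin m → ℝ) × (Fin m → ℝ) × (Fin d → ℝ)

/-- `ℂᵐ × ℂᵐ × ℂᵈ`, with coordinates `(ζ, z, w)`, where `ζ` stands for the complexification
of `conj z`, and the maximum norm. -/
abbrev TSpace (m d : ℕ) : Type := (Fin m → ℂ) × (Fin m → ℂ) × (Fin d → ℂ)

/-- The coordinates `(x, y, u)` of a point `(z, w) = (x + iy, u + iv)`. -/
def realCoords {m d : ℕ} (t : CSpace m d) : RSpace m d :=
  (fun k => (t.1 k).re, fun k => (t.1 k).im, fun j => (t.2 j).re)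

/-! ### Local generic submanifolds -/

/-- A real analytic local generic submanifold of `ℂᵐ⁺ᵈ`, of CR dimension `m ≥ 1` and of
codimension `d ≥ 1`, in coordinates `(z, w)` centred at its central point: the real graph
`v = φ(x, y, u)` over a polydisc, together with its complex defining functions
`conj w = Θ(conj z, z, w)`, which cut out the same set. -/
structure LocalGeneric (m d : ℕ) where
  m_pos : 0 < m
  d_pos : 0 < d
  ρ₁ : ℝ
  ρ₁_pos : 0 < ρ₁
  /-- the graphing function -/
  φ : RSpace m d → (Fin d → ℝ)
  φ_analytic : AnalyticOnNhd ℝ φ (Metric.ball 0 (2 * ρ₁))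
  φ_lt : ∀ ρ : ℝ, 0 ≤ ρ → ρ ≤ 2 * ρ₁ → ∀ s : RSpace m d, ‖s‖ < ρ → ‖φ s‖ < ρ
  /-- the complex defining function -/
  Θ : TSpace m d → (Fin d → ℂ)
  Θ_analytic : AnalyticOnNhd ℂ Θ (Metric.ball 0 (2 * ρ₁))
  graph_iff : ∀ t : CSpace m d, t ∈ Metric.ball 0 ρ₁ →
    ((∀ j, (t.2 j).im = φ (realCoords t) j) ↔
      ∀ j, conj (t.2 j) = Θ (fun k => conj (t.1 k), t.1, t.2) j)

namespace LocalGeneric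

variable {m d : ℕ}

/-- The set of points of the submanifold. -/
def carrier (M : LocalGeneric m d) : Set (CSpace m d) :=
  {t | t ∈ Metric.ball 0 M.ρ₁ ∧ ∀ j, (t.2 j).im = M.φ (realCoords t) j}

/-- The graph parametrization `(x, y, u) ↦ (x + iy, u + iφ(x, y, u))`. -/
def param (M : LocalGeneric m d) (s : RSpace m d) : CSpace m d :=
  (fun k => (s.1 k : ℂ) + Complex.I * (s.2.1 k : ℂ),
   fun j => (s.2.2 j : ℂ) + Complex.I * (M.φ s j : ℂ))

/-- The open set of parameters `(x, y, u)` of the points of the submanifold. -/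
def paramDomain (M : LocalGeneric m d) : Set (RSpace m d) :=
  {s | s ∈ Metric.ball 0 (2 * M.ρ₁) ∧ M.param s ∈ Metric.ball 0 M.ρ₁}

/-- The coefficient `∂Θⱼ/∂(conj zₖ)` at `(conj z, z, w)`. -/
def coeff (M : LocalGeneric m d) (k : Fin m) (j : Fin d) (t : CSpace m d) : ℂ :=
  fderiv ℂ M.Θ (fun l => conj (t.1 l), t.1, t.2) (Pi.single k 1, 0, 0) j

/-- The `(0,1)` vector field
`L̄ₖ = ∂/∂(conj zₖ) + ∑ⱼ ∂Θⱼ/∂(conj zₖ)(conj z, z, w) ∂/∂(conj wⱼ)`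
tangent to `M`, acting on functions on `M` written in the coordinates `(x, y, u)` of `M`.
Since `L̄ₖ zₗ = L̄ₖ wⱼ = 0`, `L̄ₖ (conj zₗ) = δₖₗ` and `L̄ₖ (conj wⱼ) = ∂Θⱼ/∂(conj zₖ)`, one has
`L̄ₖ xₗ = δₖₗ/2`, `L̄ₖ yₗ = i δₖₗ/2` and `L̄ₖ uⱼ = (1/2) ∂Θⱼ/∂(conj zₖ)`. -/
def Lbar (M : LocalGeneric m d) (k : Fin m) (F : RSpace m d → ℂ) : RSpace m d → ℂ := fun s =>
  (1 / 2 : ℂ) * (fderiv ℝ F s (Pi.single k 1, 0, 0)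
      + Complex.I * fderiv ℝ F s (0, Pi.single k 1, 0))
    + ∑ j, (1 / 2 : ℂ) * M.coeff k j (M.param s) * fderiv ℝ F s (0, 0, Pi.single j 1)

/-- The derivation `L̄^β = L̄₁^β₁ ⋯ L̄ₘ^βₘ`. -/
def LbarPow (M : LocalGeneric m d) (β : Fin m → ℕ) (F : RSpace m d → ℂ) : RSpace m d → ℂ :=
  (List.finRange m).foldr (fun k G => (M.Lbar k)^[β k] G) F

/-- The complexified defining function `r(t, conj τ) = conj ω - Θ(conj ζ, z, w)`, for points
`t = (z, w)` and `τ = (ζ, ω)`. -/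
def r (M : LocalGeneric m d) (j : Fin d) (t τ : CSpace m d) : ℂ :=
  conj (τ.2 j) - M.Θ (fun k => conj (τ.1 k), t.1, t.2) j

end LocalGeneric

/-! ### Characteristic variety and essential finiteness -/

/-- The first characteristic variety at the origin of a map `h` from `M` to `M'`: the set of
points `t'` of the polydisc of radius `ρ` such that, for all `β` and `j'`, the function
`t ↦ L̄^β [r'_{j'}(t', conj h(t))]` on `M` vanishes at the origin. -/
def charVariety {m d m' d' : ℕ} (M : LocalGeneric m d) (M' : LocalGeneric m' d')
    (h : CSpace m d → CSpace m' d') (ρ : ℝ) : Set (CSpace m' d') :=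
  {t' | t' ∈ Metric.ball 0 ρ ∧
    ∀ (j' : Fin d') (β : Fin m → ℕ), M.LbarPow β (fun s => M'.r j' t' (h (M.param s))) 0 = 0}

/-- The dimension at a point `p` of a complex analytic set `V`: the least number `k` of
holomorphic functions vanishing at `p` whose common zeros in `V` have `p` as an isolated point. -/
def complexDimAt {m d : ℕ} (V : Set (CSpace m d)) (p : CSpace m d) : ℕ∞ :=
  ⨅ (k : ℕ) (_ : ∃ f : CSpace m d → (Fin k → ℂ), AnalyticAt ℂ f p ∧ f p = 0 ∧
    ∀ᶠ q in 𝓝[≠] p, ¬ (q ∈ V ∧ f q = 0)), (k : ℕ∞)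

/-- Essential finiteness of a local generic submanifold at its central point: the
characteristic variety of its identity map is zero-dimensional there. -/
def LocalGeneric.EssFinite {m d : ℕ} (M : LocalGeneric m d) : Prop :=
  complexDimAt (charVariety M M id M.ρ₁) 0 = 0

/-- A local smooth CR mapping from `M` to `M'`, sending central point to central point. -/
structure LocalCRMap {m d m' d' : ℕ} (M : LocalGeneric m d) (M' : LocalGeneric m' d') where
  h : CSpace m d → CSpace m' d'
  map_zero : h 0 = 0
  smooth : ContDiffOn ℝ ∞ (fun s => h (M.param s)) M.paramDomain
  cr_fst : ∀ s ∈ M.paramDomain, ∀ (k : Fin m) (i : Fin m'),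
    M.Lbar k (fun s => (h (M.param s)).1 i) s = 0
  cr_snd : ∀ s ∈ M.paramDomain, ∀ (k : Fin m) (i : Fin d'),
    M.Lbar k (fun s => (h (M.param s)).2 i) s = 0
  ρ₂ : ℝ
  ρ₂' : ℝ
  ρ₂_pos : 0 < ρ₂
  ρ₂_lt : ρ₂ < M.ρ₁
  ρ₂'_pos : 0 < ρ₂'
  ρ₂'_lt : ρ₂' < M'.ρ₁
  mapsTo : Set.MapsTo h (M.carrier ∩ Metric.ball 0 ρ₂) (M'.carrier ∩ Metric.ball 0 ρ₂')

/-- Essential finiteness of a local CR mapping at the central point. -/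
def LocalCRMap.EssFinite {m d m' d' : ℕ} {M : LocalGeneric m d} {M' : LocalGeneric m' d'}
    (H : LocalCRMap M M') : Prop :=
  complexDimAt (charVariety M M' H.h H.ρ₂') 0 = 0

/-! ### CR orbits and minimality -/

/-- The tangent vectors of a set `S` at `q`: velocities at `q` of curves in `S`. -/
def tangentVectors {m d : ℕ} (S : Set (CSpace m d)) (q : CSpace m d) : Set (CSpace m d) :=
  {v | ∃ γ : ℝ → CSpace m d, γ 0 = q ∧ HasDerivAt γ v 0 ∧ ∀ᶠ s in 𝓝 0, γ s ∈ S}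

/-- The complex tangent vectors `T_q S ∩ i T_q S`. -/
def complexTangentVectors {m d : ℕ} (S : Set (CSpace m d)) (q : CSpace m d) :
    Set (CSpace m d) :=
  {v | v ∈ tangentVectors S q ∧ Complex.I • v ∈ tangentVectors S q}

/-- The points `a` and `b` are joined by a continuously differentiable curve in `S` whose
velocity is everywhere complex tangent to `S`. -/
def CRJoined {m d : ℕ} (S : Set (CSpace m d)) (a b : CSpace m d) : Prop :=
  ∃ γ γ' : ℝ → CSpace m d, γ 0 = a ∧ γ 1 = b ∧ ContinuousOn γ' (Set.Icc 0 1) ∧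
    ∀ s ∈ Set.Icc (0 : ℝ) 1, γ s ∈ S ∧ HasDerivWithinAt γ (γ' s) (Set.Icc 0 1) s ∧
      γ' s ∈ complexTangentVectors S (γ s)

/-- The CR orbit of `p` in `S`: the points that can be reached from `p` by a finite
concatenation of continuously differentiable curves in `S` with complex tangent velocity. -/
def CROrbit {m d : ℕ} (S : Set (CSpace m d)) (p : CSpace m d) : Set (CSpace m d) :=
  {q | Relation.ReflTransGen (CRJoined S) p q}

/-- Minimality of `S` at `p`: the local CR orbits of `p` are neighbourhoods of `p` in `S`. -/
def IsMinimalAt {m d : ℕ} (S : Set (CSpace m d)) (p : CSpace m d) : Prop :=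
  ∀ U ∈ 𝓝 p, CROrbit (S ∩ U) p ∈ 𝓝[S] p

/-- `N` is an embedded real analytic submanifold of real dimension `D`: near each of its points
it has an analytic immersive parametrization that is a homeomorphism onto a piece of `N`. -/
def IsAnalyticSubmanifold {m d : ℕ} (D : ℕ) (N : Set (CSpace m d)) : Prop :=
  ∀ q ∈ N, ∃ γ : (Fin D → ℝ) → CSpace m d, AnalyticAt ℝ γ 0 ∧ γ 0 = q ∧
    Function.Injective (fderiv ℝ γ 0) ∧ Filter.map γ (𝓝 0) = 𝓝[N] q

/-- `N` is a piece through `p` of the CR orbit of `p` in `S`, of real dimension `D`. The orbit is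
only an immersed submanifold, and `N` is a relatively open subset of it in its manifold topology:
`N` is an embedded submanifold contained in the orbit, and each of its tangent spaces contains the
complex tangent space of `S`. These conditions determine `D` and the germ of `N` at `p`. -/
structure IsCROrbitPiece {m d : ℕ} (S : Set (CSpace m d)) (p : CSpace m d) (D : ℕ)
    (N : Set (CSpace m d)) : Prop where
  mem : p ∈ N
  submanifold : IsAnalyticSubmanifold D N
  subset_orbit : N ⊆ CROrbit S p
  tangent : ∀ q ∈ N, complexTangentVectors S q ⊆ tangentVectors N q

/-- Essential finiteness at `p` of a real analytic CR submanifold `N` that need not be generic: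
`N` is essentially finite as a generic submanifold of its intrinsic complexification. That is, a
germ of holomorphic embedding `Ψ`, whose image is the intrinsic complexification of `N`, carries
a local generic submanifold `G` which is essentially finite at its central point onto `N` near
`p`. -/
def IsEssFiniteCRAt {m d : ℕ} (N : Set (CSpace m d)) (p : CSpace m d) : Prop :=
  ∃ (m₁ d₁ : ℕ) (G : LocalGeneric m₁ d₁) (Ψ : CSpace m₁ d₁ → CSpace m d),
    AnalyticAt ℂ Ψ 0 ∧ Ψ 0 = p ∧ Function.Injective (fderiv ℂ Ψ 0) ∧
    Filter.map Ψ (𝓝[G.carrier] 0) = 𝓝[N] p ∧ G.EssFinite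

end CRGeom

end

/-!
# CR orbits and essential finiteness

**Pieces of CR orbits.** In the coordinates `(x, y, u)` of `M`, the complex tangent vectors are the
values of a real analytic family of vector fields `X(c)`, linear in `c ∈ ℂᵐ`
(`LocalGeneric.dparam_X`). Its flow is analytic in the initial point and in `c`: it solves a Picard
equation in a Banach space of curves, in which superposition with an analytic function is an
analytic map, so the inverse function theorem applies (`exists_analytic_flow`). Among the finite
compositions of such flows and their inverses, one chooses one which has, arbitrarily close to the
origin, the maximal rank `D`; following it by the inverse composition gives an analytic disc of
dimension `D` through the origin. Since further composition does not increase the rank, the disc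
is tangent to all the vector fields `X(c)`; this is the construction of Sussmann's theorem
(`exists_orbit_disc`, `LocalGeneric.exists_orbitPiece`).

**Normal form.** Let `N ⊆ M` be a submanifold of dimension `2m + d₁` tangent to the complex
tangent spaces of `M`. Choose `d₁` complex linear combinations `w₁ = π(w)` of the coordinates `w`
such that `(z, Re w₁)` are coordinates on `N`. Expressed in the variables `(ζ, z, w₁)`, the
complexification of `w` restricted to `N` does not depend on `ζ`, which gives a holomorphic graph
`w = g(z, w₁)`, the intrinsic complexification of `N`, in which `N` is generic
(`LocalGeneric.exists_normalForm`).

**Essential finiteness.** On functions holomorphic in `(conj z, z, w)` the field `L̄ₖ` is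
differentiation in the variable `ζₖ = conj zₖ`. Hence `t` lies in the characteristic variety of
the identity map if and only if `Θ(·, t) = Θ(·, 0)` (`LocalGeneric.mem_charVariety_id_iff`). The
inclusion `N ⊆ M` gives `Θ(ζ, z, g(z, w₁)) = conj g (conj ζ, conj Θ₁(ζ, z, w₁))`, where `Θ₁` is the
complex defining function of `N`. So `(z, w₁) ↦ (z, g(z, w₁))` maps the characteristic variety of
`N` injectively into that of `M`, and `N` is essentially finite when `M` is
(`LocalGeneric.isEssFiniteCRAt_of_essFinite`).

**Dimension.** If `d₁ = 0`, then `N` is a complex submanifold. A CR mapping `h` restricts to a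
holomorphic mapping `f` of it into `M'`, and polarization of the equation `f(z) ∈ M'` shows that the
characteristic variety of `h` contains all the points `f(z)`, and all the zeros of `Θ'(0, ·)` if
`f = 0`. Hence it does not have dimension zero
(`LocalCRMap.not_essFinite_of_holomorphic_graph`). Thus `d₁ ≥ 1` as soon as `M` carries an
essentially finite CR mapping. With the identity map this is the bound on the dimension of the
orbit. If `M` is a hypersurface, it follows that the orbit pieces in arbitrarily small
neighbourhoods have the dimension of `M`, which is minimality.
-/

noncomputable section

/-! ### Analytic dependence of solutions of ordinary differential equations -/

namespace CRGeom

open unitInterval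

/-- The analytic inverse function theorem, as the existence of a local homeomorphism. -/
theorem exists_analytic_localInverse {𝕜 : Type*} [RCLike 𝕜] {E F : Type*}
    [NormedAddCommGroup E] [NormedSpace 𝕜 E] [CompleteSpace E]
    [NormedAddCommGroup F] [NormedSpace 𝕜 F] [CompleteSpace F]
    {f : E → F} {a : E} (hf : AnalyticAt 𝕜 f a) (i : E ≃L[𝕜] F)
    (hi : HasFDerivAt f (i : E →L[𝕜] F) a) :
    ∃ e : OpenPartialHomeomorph E F, a ∈ e.source ∧ (∀ x, e x = f x) ∧
      AnalyticAt 𝕜 e.symm (f a) ∧ ∀ x ∈ e.source, AnalyticAt 𝕜 f x := by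
  have hs : HasStrictFDerivAt f (i : E →L[𝕜] F) a := by
    rw [← hi.fderiv]; exact hf.hasStrictFDerivAt
  have hU : {x | AnalyticAt 𝕜 f x} ∈ 𝓝 a := hf.eventually_analyticAt
  have hopen : IsOpen {x | AnalyticAt 𝕜 f x} := isOpen_analyticAt 𝕜 f
  refine ⟨(hs.toOpenPartialHomeomorph f).restrOpen _ hopen, ?_, ?_, ?_, ?_⟩
  · exact ⟨hs.mem_toOpenPartialHomeomorph_source, mem_of_mem_nhds hU⟩
  · intro x; rfl
  · exact OpenPartialHomeomorph.analyticAt_symm' (hs.toOpenPartialHomeomorph f) (i := i)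
      hs.mem_toOpenPartialHomeomorph_source hf hi.fderiv
  · intro x hx; exact hx.2

section Superposition

variable {E F : Type*} [NormedAddCommGroup E] [NormedSpace ℝ E]
  [NormedAddCommGroup F] [NormedSpace ℝ F]

/-- A multilinear map acting pointwise on continuous curves. -/
def pointwiseMultilinear {n : ℕ} (p : ContinuousMultilinearMap ℝ (fun _ : Fin n => E) F) :
    ContinuousMultilinearMap ℝ (fun _ : Fin n => C(I, E)) C(I, F) :=
  MultilinearMap.mkContinuous
    { toFun := fun v => ⟨fun s => p fun k => v k s,
        p.cont.comp (continuous_pi fun k => (v k).continuous)⟩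
      map_update_add' := by
        intro _ v i x y
        ext s
        have h : ∀ z : C(I, E), (fun k => (Function.update v i z) k s)
            = Function.update (fun k => v k s) i (z s) := by
          intro z; ext k
          by_cases hk : k = i
          · subst hk; simp
          · simp [hk]
        have e : ∀ (a b : DecidableEq (Fin n)), a = b := fun a b => Subsingleton.elim _ _
        obtain rfl := e ‹_› (instDecidableEqFin n)
        simp [h]
      map_update_smul' := by
        intro _ v i c x
        ext s
        have h : ∀ z : C(I, E), (fun k => (Function.update v i z) k s)
            = Function.update (fun k => v k s) i (z s) := by
          intro z; ext k
          by_cases hk : k = i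
          · subst hk; simp
          · simp [hk]
        have e : ∀ (a b : DecidableEq (Fin n)), a = b := fun a b => Subsingleton.elim _ _
        obtain rfl := e ‹_› (instDecidableEqFin n)
        simp [h] }
    ‖p‖ (by
      intro v
      rw [ContinuousMap.norm_le _ (by positivity)]
      intro s
      refine (p.le_opNorm _).trans ?_
      gcongr with k
      exact (v k).norm_coe_le_norm s)

theorem norm_pointwiseMultilinear_le {n : ℕ}
    (p : ContinuousMultilinearMap ℝ (fun _ : Fin n => E) F) :
    ‖pointwiseMultilinear p‖ ≤ ‖p‖ :=
  MultilinearMap.mkContinuous_norm_le _ (norm_nonneg _) _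

/-- The superposition operator `γ ↦ f ∘ γ` on continuous curves is analytic at `0` if `f` is. Only
small curves matter, as `f` need not be continuous away from `0`. -/
theorem exists_superposition [CompleteSpace F] {f : E → F} (hf : AnalyticAt ℝ f 0) :
    ∃ S : C(I, E) → C(I, F), AnalyticAt ℝ S 0 ∧
      (∀ᶠ γ in 𝓝 (0 : C(I, E)), ∀ s, S γ s = f (γ s)) ∧
      ∀ γ s, fderiv ℝ S 0 γ s = fderiv ℝ f 0 (γ s) := by
  obtain ⟨p, r, hp⟩ := hf
  let q : FormalMultilinearSeries ℝ C(I, E) C(I, F) := fun n => pointwiseMultilinear (p n)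
  have hq : p.radius ≤ q.radius := by
    refine ENNReal.le_of_forall_nnreal_lt fun ρ hρ => ?_
    obtain ⟨C, -, hC⟩ := p.norm_mul_pow_le_of_lt_radius hρ
    refine q.le_radius_of_bound C fun n => le_trans ?_ (hC n)
    gcongr
    exact norm_pointwiseMultilinear_le _
  have hpos : 0 < q.radius := hp.r_pos.trans_le (hp.r_le.trans hq)
  have hS := q.hasFPowerSeriesOnBall hpos
  refine ⟨q.sum, hS.analyticAt, ?_, ?_⟩
  · have : Metric.eball (0 : C(I, E)) r ∈ 𝓝 0 := Metric.eball_mem_nhds _ hp.r_pos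
    filter_upwards [this] with γ hγ s
    have h1 := hS.hasSum (y := γ) (Metric.eball_subset_eball (hp.r_le.trans hq) hγ)
    have h2 := (ContinuousMap.evalCLM ℝ s : C(I, F) →L[ℝ] F).hasSum h1
    have h3 : γ s ∈ Metric.eball (0 : E) r := by
      simp only [Metric.mem_eball, edist_zero_right] at hγ ⊢
      refine lt_of_le_of_lt ?_ hγ
      rw [← ofReal_norm, ← ofReal_norm]
      exact ENNReal.ofReal_le_ofReal (γ.norm_coe_le_norm s)
    have h4 := hp.hasSum h3
    simp only [zero_add] at h2 h4
    exact HasSum.unique h2 h4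
  · intro γ s
    rw [hS.hasFPowerSeriesAt.hasFDerivAt.fderiv, hp.hasFPowerSeriesAt.hasFDerivAt.fderiv]
    rfl

end Superposition

section Flow

variable {E : Type*} [NormedAddCommGroup E] [NormedSpace ℝ E]

/-- The integration operator `γ ↦ (s ↦ ∫₀ˢ γ)` on continuous curves. -/
def curveIntegral : C(I, E) →L[ℝ] C(I, E) :=
  LinearMap.mkContinuous
    { toFun := fun γ => ⟨fun s => ∫ u in (0 : ℝ)..s, γ (Set.projIcc 0 1 zero_le_one u), by
        have hc : Continuous fun u : ℝ => γ (Set.projIcc 0 1 zero_le_one u) := by fun_prop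
        exact (intervalIntegral.continuous_primitive (fun _ _ => hc.intervalIntegrable _ _)
          0).comp continuous_subtype_val⟩
      map_add' := by
        intro γ δ
        ext s
        simp only [ContinuousMap.coe_mk, ContinuousMap.add_apply]
        refine intervalIntegral.integral_add (Continuous.intervalIntegrable ?_ _ _)
          (Continuous.intervalIntegrable ?_ _ _) <;> fun_prop
      map_smul' := by
        intro c γ
        ext s
        simp }
    1 (by
      intro γ
      rw [ContinuousMap.norm_le _ (by positivity)]
      intro s
      refine (intervalIntegral.norm_integral_le_of_norm_le_const (C := ‖γ‖)
        fun u _ => γ.norm_coe_le_norm _).trans ?_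
      have h1 : |(s : ℝ) - 0| ≤ 1 := by rw [sub_zero, abs_of_nonneg s.2.1]; exact s.2.2
      nlinarith [norm_nonneg γ])

theorem curveIntegral_apply (γ : C(I, E)) (s : I) :
    curveIntegral γ s = ∫ u in (0 : ℝ)..s, γ (Set.projIcc 0 1 zero_le_one u) := rfl

/-- The continuous linear map sending a vector to the constant curve. -/
def constCurve (F : Type*) [NormedAddCommGroup F] [NormedSpace ℝ F] : F →L[ℝ] C(I, F) :=
  LinearMap.mkContinuous
    { toFun := fun x => ContinuousMap.const I x
      map_add' := fun _ _ => rfl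
      map_smul' := fun _ _ => rfl } 1 (by
      intro x
      rw [ContinuousMap.norm_le _ (by positivity), one_mul]
      exact fun s => le_refl ‖x‖)

/-- Pairing of curves, as a continuous linear map. -/
def pairCurve (F G : Type*) [NormedAddCommGroup F] [NormedSpace ℝ F] [NormedAddCommGroup G]
    [NormedSpace ℝ G] : C(I, F) × C(I, G) →L[ℝ] C(I, F × G) :=
  LinearMap.mkContinuous
    { toFun := fun x => x.1.prodMk x.2
      map_add' := fun _ _ => rfl
      map_smul' := fun _ _ => rfl } 1 (by
      intro x
      rw [ContinuousMap.norm_le _ (by positivity)]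
      intro s
      change ‖(x.1 s, x.2 s)‖ ≤ 1 * ‖x‖
      rw [one_mul, Prod.norm_def, Prod.norm_def]
      exact max_le_max (x.1.norm_coe_le_norm s) (x.2.norm_coe_le_norm s))

variable {P : Type*} [NormedAddCommGroup P] [NormedSpace ℝ P]

/-- `γ` solves the integral form of `γ' = f(c, γ)`, `γ(0) = x` on the unit interval. -/
def IsSolution (f : P × E → E) (q : P × E) (γ : C(I, E)) : Prop :=
  ∀ s : I, γ s = q.2 + ∫ u in (0 : ℝ)..s, f (q.1, γ (Set.projIcc 0 1 zero_le_one u))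

/-- Analytic dependence of the solution of `γ' = f(c, γ)`, `γ(0) = x` on `(c, x)` and its
uniqueness among small curves. The solution curve is obtained from the analytic inverse function
theorem applied to the Picard operator on the Banach space of continuous curves. -/
theorem exists_analytic_solution [CompleteSpace E] [CompleteSpace P] {f : P × E → E}
    (hf : AnalyticAt ℝ f 0) (h0 : ∀ y, f (0, y) = 0) :
    ∃ Γ : P × E → C(I, E), AnalyticAt ℝ Γ 0 ∧ Γ 0 = 0 ∧ (∀ᶠ q in 𝓝 0, IsSolution f q (Γ q)) ∧
      ∀ᶠ x in 𝓝 (0 : (P × E) × C(I, E)), IsSolution f x.1 x.2 → x.2 = Γ x.1 := by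
  obtain ⟨S, hS, hSf, hS'⟩ := exists_superposition hf
  -- the substitution `(c, x, γ) ↦ (s ↦ f(c, γ(s)))`
  let A : (P × E) × C(I, E) →L[ℝ] C(I, P × E) :=
    (pairCurve P E).comp (((constCurve P).comp ((ContinuousLinearMap.fst ℝ P E).comp
      (ContinuousLinearMap.fst ℝ (P × E) C(I, E)))).prod
        (ContinuousLinearMap.snd ℝ (P × E) C(I, E)))
  have hA : ∀ q γ s, A (q, γ) s = (q.1, γ s) := fun _ _ _ => rfl
  let K : P × E →L[ℝ] C(I, E) := (constCurve E).comp (ContinuousLinearMap.snd ℝ P E)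
  have hK : ∀ q s, K q s = q.2 := fun _ _ => rfl
  let G : (P × E) × C(I, E) → (P × E) × C(I, E) := fun x =>
    (x.1, x.2 - K x.1 - curveIntegral (S (A x)))
  have hSA : AnalyticAt ℝ (fun x => S (A x)) 0 := by
    refine AnalyticAt.comp (g := S) (f := A) ?_ (A.analyticAt 0)
    rw [map_zero]; exact hS
  have hG : AnalyticAt ℝ G 0 := by
    refine analyticAt_fst.prod ((analyticAt_snd.sub ?_).sub ?_)
    · exact (K.analyticAt _).comp analyticAt_fst
    · exact (curveIntegral.analyticAt _).comp hSA
  have hS0 : S 0 = 0 := by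
    ext s
    have := hSf.self_of_nhds s
    rw [this]
    exact h0 0
  have hG0 : G 0 = 0 := by
    simp [G, hS0]
  have hfd : ∀ y : E, fderiv ℝ f 0 (0, y) = 0 := by
    intro y
    have h1 : HasFDerivAt (fun y : E => f (0, y))
        ((fderiv ℝ f 0).comp (ContinuousLinearMap.inr ℝ P E)) 0 := by
      have h2 : HasFDerivAt (fun y : E => ((0 : P), y)) (ContinuousLinearMap.inr ℝ P E) 0 :=
        (ContinuousLinearMap.inr ℝ P E).hasFDerivAt
      exact HasFDerivAt.comp (0 : E) (g := f) (f := fun y : E => ((0 : P), y))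
        (hf.differentiableAt.hasFDerivAt) h2
    have h2 : HasFDerivAt (fun y : E => f (0, y)) (0 : E →L[ℝ] E) 0 := by
      simp only [h0]; exact hasFDerivAt_const _ _
    have := congrArg (fun L => L y) (h1.unique h2)
    simpa using this
  let T : P × E →L[ℝ] C(I, E) := K + (curveIntegral.comp (fderiv ℝ S 0)).comp
    (A.comp (ContinuousLinearMap.inl ℝ (P × E) C(I, E)))
  let i₁ : (P × E) × C(I, E) →L[ℝ] (P × E) × C(I, E) :=
    (ContinuousLinearMap.fst ℝ (P × E) C(I, E)).prod
      (ContinuousLinearMap.snd ℝ (P × E) C(I, E) -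
        T.comp (ContinuousLinearMap.fst ℝ (P × E) C(I, E)))
  let i₂ : (P × E) × C(I, E) →L[ℝ] (P × E) × C(I, E) :=
    (ContinuousLinearMap.fst ℝ (P × E) C(I, E)).prod
      (ContinuousLinearMap.snd ℝ (P × E) C(I, E) +
        T.comp (ContinuousLinearMap.fst ℝ (P × E) C(I, E)))
  let i : ((P × E) × C(I, E)) ≃L[ℝ] (P × E) × C(I, E) :=
    ContinuousLinearEquiv.equivOfInverse i₁ i₂ (fun x => by simp [i₁, i₂])
      (fun x => by simp [i₁, i₂])
  have hi : HasFDerivAt G (i : (P × E) × C(I, E) →L[ℝ] (P × E) × C(I, E)) 0 := by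
    have h1 : HasFDerivAt (fun x => S (A x)) ((fderiv ℝ S 0).comp A) 0 := by
      have : HasFDerivAt S (fderiv ℝ S 0) (A 0) := by
        rw [map_zero]; exact hS.differentiableAt.hasFDerivAt
      exact this.comp 0 A.hasFDerivAt
    have h2 : HasFDerivAt G ((ContinuousLinearMap.fst ℝ (P × E) C(I, E)).prod
      (ContinuousLinearMap.snd ℝ (P × E) C(I, E) -
        K.comp (ContinuousLinearMap.fst ℝ (P × E) C(I, E)) -
          curveIntegral.comp ((fderiv ℝ S 0).comp A))) 0 := by
      refine HasFDerivAt.prodMk hasFDerivAt_fst ?_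
      refine HasFDerivAt.sub (HasFDerivAt.sub hasFDerivAt_snd ?_) ?_
      · exact (K.comp (ContinuousLinearMap.fst ℝ (P × E) C(I, E))).hasFDerivAt
      · exact curveIntegral.hasFDerivAt.comp 0 h1
    convert h2 using 1
    refine ContinuousLinearMap.ext fun x => ?_
    obtain ⟨q, γ⟩ := x
    have key : fderiv ℝ S 0 (A (q, γ)) = fderiv ℝ S 0 (A (q, 0)) := by
      ext s
      rw [hS', hS', hA, hA]
      have : (q.1, γ s) = (q.1, (0 : C(I, E)) s) + ((0 : P), γ s) := by simp
      rw [this, map_add, hfd, add_zero]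
    change (q, γ - (K q + curveIntegral (fderiv ℝ S 0 (A (q, 0)))))
      = (q, γ - K q - curveIntegral (fderiv ℝ S 0 (A (q, γ))))
    rw [key]; simp [sub_sub]
  obtain ⟨e, he0, he, hesymm, -⟩ := exists_analytic_localInverse hG i hi
  rw [hG0] at hesymm
  have hes0 : e.symm 0 = 0 := by
    have := e.left_inv he0
    rwa [he, hG0] at this
  let j : P × E →L[ℝ] (P × E) × C(I, E) := ContinuousLinearMap.inl ℝ (P × E) C(I, E)
  have hjt : Tendsto j (𝓝 0) (𝓝 0) := by
    have := j.continuous.tendsto 0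
    rwa [map_zero] at this
  have hsol : ∀ᶠ x in 𝓝 (0 : (P × E) × C(I, E)), (IsSolution f x.1 x.2 ↔ G x = (x.1, 0)) := by
    have hAt : Tendsto A (𝓝 0) (𝓝 0) := by
      have := A.continuous.tendsto 0
      rwa [map_zero] at this
    filter_upwards [hAt.eventually hSf] with x hx
    constructor
    · intro h
      refine Prod.ext rfl ?_
      ext s
      simp only [G, ContinuousMap.sub_apply, ContinuousMap.zero_apply, curveIntegral_apply, hx, hK]
      rw [h s]
      have : ∀ u, A x u = (x.1.1, x.2 u) := fun _ => rfl
      simp [this]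
    · intro h s
      have h2 := congrArg (fun z : (P × E) × C(I, E) => z.2 s) h
      simp only [G, ContinuousMap.sub_apply, ContinuousMap.zero_apply, curveIntegral_apply, hx, hK]
        at h2
      have : ∀ u, A x u = (x.1.1, x.2 u) := fun _ => rfl
      simp only [this] at h2
      rw [sub_sub, sub_eq_zero] at h2
      exact h2
  have hΓa : AnalyticAt ℝ (fun q => e.symm (j q)) 0 := by
    refine AnalyticAt.comp (g := e.symm) (f := j) ?_ (j.analyticAt 0)
    rw [map_zero]; exact hesymm
  have hΓt : Tendsto (fun q => e.symm (j q)) (𝓝 0) (𝓝 0) := by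
    have := hΓa.continuousAt.tendsto
    simpa [hes0] using this
  have ht0 : (0 : (P × E) × C(I, E)) ∈ e.target := by
    have := e.map_source he0
    rwa [he, hG0] at this
  have hfst : ∀ᶠ q in 𝓝 (0 : P × E), (e.symm (j q)).1 = q ∧ G (e.symm (j q)) = (q, 0) := by
    filter_upwards [hjt.eventually (e.open_target.mem_nhds ht0)] with q hq
    have h1 := e.right_inv hq
    rw [he] at h1
    exact ⟨congrArg Prod.fst h1, h1⟩
  refine ⟨fun q => (e.symm (j q)).2, analyticAt_snd.comp hΓa, by simp [hes0], ?_, ?_⟩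
  · filter_upwards [hfst, hΓt.eventually hsol] with q hq1 hq2
    have h3 := hq2.2 (by rw [hq1.2, hq1.1])
    rwa [hq1.1] at h3
  · filter_upwards [hsol, e.open_source.mem_nhds he0] with x hx hxs hsx
    have h1 := hx.1 hsx
    have h2 := e.left_inv hxs
    rw [he, h1] at h2
    exact (congrArg Prod.snd h2).symm

end Flow

open unitInterval

theorem analyticAt_clm_apply {𝕜 E F G : Type*} [NontriviallyNormedField 𝕜]
    [NormedAddCommGroup E] [NormedSpace 𝕜 E] [NormedAddCommGroup F] [NormedSpace 𝕜 F]
    [NormedAddCommGroup G] [NormedSpace 𝕜 G] {L : E → F →L[𝕜] G} {v : E → F} {x : E}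
    (hL : AnalyticAt 𝕜 L x) (hv : AnalyticAt 𝕜 v x) : AnalyticAt 𝕜 (fun y => L y (v y)) x :=
  AnalyticAt.comp (g := fun p : (F →L[𝕜] G) × F => p.1 p.2) (f := fun y => (L y, v y))
    ((ContinuousLinearMap.id 𝕜 (F →L[𝕜] G)).analyticAt_bilinear (L x, v x)) (hL.prod hv)

section EndpointMap

variable {E P : Type*} [NormedAddCommGroup E] [NormedSpace ℝ E]
  [NormedAddCommGroup P] [NormedSpace ℝ P]

/-- The points `a` and `b` are joined inside `O` by an integral curve, run for unit time, of one of
the vector fields `x ↦ X(x)c`, `c ∈ P`. -/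
def CurveJoined (X : E → P →L[ℝ] E) (O : Set E) (a b : E) : Prop :=
  ∃ (c : P) (β : ℝ → E), β 0 = a ∧ β 1 = b ∧ ∀ s ∈ Set.Icc (0 : ℝ) 1,
    β s ∈ O ∧ HasDerivWithinAt β (X (β s) c) (Set.Icc 0 1) s

variable [CompleteSpace E] [CompleteSpace P]

/-- The time-one maps `Φ(c, ·)` of the vector fields `x ↦ X(x)c` form an analytic family. -/
theorem exists_analytic_flow {X : E → P →L[ℝ] E} (hX : AnalyticAt ℝ X 0) :
    ∃ Φ : P × E → E, AnalyticAt ℝ Φ 0 ∧ Φ 0 = 0 ∧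
      (∀ᶠ x in 𝓝 (0 : E), Φ (0, x) = x) ∧
      (∀ᶠ q in 𝓝 (0 : P × E), Φ (-q.1, Φ q) = q.2) ∧
      (∀ O ∈ 𝓝 (0 : E), ∀ᶠ q in 𝓝 (0 : P × E), CurveJoined X O q.2 (Φ q)) ∧
      ∀ᶠ x in 𝓝 (0 : E), HasFDerivAt (fun c => Φ (c, x)) (X x) 0 := by
  let f : P × E → E := fun q => X q.2 q.1
  have hf : AnalyticAt ℝ f 0 :=
    analyticAt_clm_apply (AnalyticAt.comp (g := X) (f := Prod.snd) hX analyticAt_snd)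
      analyticAt_fst
  obtain ⟨Γ, hΓ, hΓ0, hsol, huniq⟩ := exists_analytic_solution hf (fun y => by simp [f])
  have hΓt : Tendsto Γ (𝓝 0) (𝓝 0) := by simpa [hΓ0] using hΓ.continuousAt.tendsto
  -- small curves stay in prescribed neighbourhoods
  have hsmall : ∀ O ∈ 𝓝 (0 : E), ∀ᶠ q in 𝓝 (0 : P × E), ∀ s, Γ q s ∈ O := by
    intro O hO
    obtain ⟨ε, hε, hεO⟩ := Metric.mem_nhds_iff.1 hO
    filter_upwards [hΓt.eventually (Metric.ball_mem_nhds 0 hε)] with q hq s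
    apply hεO
    rw [dist_zero_right] at hq
    rw [mem_ball_zero_iff]
    exact ((Γ q).norm_coe_le_norm s).trans_lt hq
  have hXc : {x | ContinuousAt X x} ∈ 𝓝 (0 : E) :=
    hX.eventually_analyticAt.mono fun x hx => hx.continuousAt
  have hcont : ∀ᶠ q in 𝓝 (0 : P × E), ∀ c : P,
      Continuous fun u : ℝ => f (c, Γ q (Set.projIcc 0 1 zero_le_one u)) := by
    filter_upwards [hsmall _ hXc] with q hq c
    have h1 : Continuous fun u : ℝ => Γ q (Set.projIcc 0 1 zero_le_one u) := by fun_prop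
    have h2 : Continuous fun u : ℝ => X (Γ q (Set.projIcc 0 1 zero_le_one u)) :=
      continuous_iff_continuousAt.2 fun u =>
        ContinuousAt.comp (g := X) (hq _) h1.continuousAt
    exact h2.clm_apply continuous_const
  let ev : C(I, E) →L[ℝ] E := ContinuousMap.evalCLM ℝ (1 : I)
  have hev : ∀ γ, ev γ = γ 1 := fun _ => rfl
  have hΦa : AnalyticAt ℝ (fun q => Γ q 1) 0 := (ev.analyticAt _).comp hΓ
  have hconst : ∀ᶠ x in 𝓝 (0 : E), ∀ s, Γ (0, x) s = x := by
    have ht : Tendsto (fun x : E => ((0 : P), x)) (𝓝 0) (𝓝 0) :=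
      (Continuous.prodMk_right (0 : P)).tendsto 0
    filter_upwards [ht.eventually hsol] with x hx s
    rw [hx s]; simp [f]
  refine ⟨fun q => Γ q 1, hΦa, by simp [hΓ0], ?_, ?_, ?_, ?_⟩
  · filter_upwards [hconst] with x hx
    exact hx 1
  · -- the reversed curve solves the reversed equation
    let R : C(I, E) →L[ℝ] C(I, E) :=
      { toFun := fun γ => γ.comp ⟨σ, unitInterval.continuous_symm⟩
        map_add' := fun _ _ => rfl
        map_smul' := fun _ _ => rfl
        cont := ContinuousMap.continuous_precomp _ }
    have hR : ∀ γ s, R γ s = γ (σ s) := fun _ _ => rfl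
    have ht : Tendsto (fun q : P × E => ((-q.1, Γ q 1), R (Γ q))) (𝓝 0) (𝓝 0) := by
      have h1 : ContinuousAt (fun q : P × E => ((-q.1, Γ q 1), R (Γ q))) 0 :=
        (continuousAt_fst.neg.prodMk hΦa.continuousAt).prodMk
          (R.continuous.continuousAt.comp hΓ.continuousAt)
      have h2 := h1.tendsto
      simp only [hΓ0, map_zero, Prod.fst_zero, neg_zero] at h2
      exact h2
    filter_upwards [ht.eventually huniq, hsol, hcont] with q hq hs hc
    have key : IsSolution f (-q.1, Γ q 1) (R (Γ q)) := by
      intro s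
      have hci : ∀ a b, IntervalIntegrable
          (fun u : ℝ => f (q.1, Γ q (Set.projIcc 0 1 zero_le_one u))) MeasureTheory.volume a b :=
        fun a b => (hc q.1).intervalIntegrable a b
      have e1 : ∀ u ∈ Set.uIcc (0 : ℝ) s, f (-q.1, R (Γ q) (Set.projIcc 0 1 zero_le_one u))
          = - f (q.1, Γ q (Set.projIcc 0 1 zero_le_one (1 - u))) := by
        intro u hu
        rw [Set.uIcc_of_le s.2.1] at hu
        have hu' : u ∈ Set.Icc (0 : ℝ) 1 := ⟨hu.1, hu.2.trans s.2.2⟩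
        have hu'' : 1 - u ∈ Set.Icc (0 : ℝ) 1 := ⟨by linarith [hu'.2], by linarith [hu'.1]⟩
        rw [hR, Set.projIcc_of_mem _ hu', Set.projIcc_of_mem _ hu'']
        simp only [f, map_neg]
        rfl
      change (R (Γ q)) s = Γ q 1 + _
      rw [hR, hs, hs 1, intervalIntegral.integral_congr e1, intervalIntegral.integral_neg,
        intervalIntegral.integral_comp_sub_left
          (fun u : ℝ => f (q.1, Γ q (Set.projIcc 0 1 zero_le_one u))) 1]
      simp only [sub_zero, unitInterval.coe_symm_eq, Set.Icc.coe_one]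
      rw [← intervalIntegral.integral_add_adjacent_intervals (hci 0 (1 - s)) (hci (1 - s) 1)]
      abel
    have h2 := hq key
    have h3 := congrArg (fun γ : C(I, E) => γ 1) h2
    simp only [hR, unitInterval.symm_one] at h3
    rw [← h3, hs 0]
    simp
  · intro O hO
    filter_upwards [hsol, hcont, hsmall O hO] with q hs hc hO
    refine ⟨q.1, fun u => Γ q (Set.projIcc 0 1 zero_le_one u), ?_, ?_, ?_⟩
    · change Γ q (Set.projIcc 0 1 zero_le_one 0) = _
      rw [Set.projIcc_left]
      change Γ q 0 = _
      rw [hs 0]; simp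
    · change Γ q (Set.projIcc 0 1 zero_le_one 1) = _
      rw [Set.projIcc_right]
      rfl
    · intro s hs01
      refine ⟨hO _, ?_⟩
      have h1 : HasDerivAt (fun v : ℝ => q.2 + ∫ u in (0 : ℝ)..v,
          f (q.1, Γ q (Set.projIcc 0 1 zero_le_one u)))
          (f (q.1, Γ q (Set.projIcc 0 1 zero_le_one s))) s :=
        (((hc q.1).integral_hasStrictDerivAt 0 s).hasDerivAt).const_add _
      refine h1.hasDerivWithinAt.congr ?_ ?_
      · intro v hv
        rw [hs, Set.projIcc_of_mem _ hv]
      · rw [hs, Set.projIcc_of_mem _ hs01]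
  · have ht : Tendsto (fun x : E => ((0 : P), x)) (𝓝 0) (𝓝 0) :=
      (Continuous.prodMk_right (0 : P)).tendsto 0
    have hgood : ∀ᶠ q in 𝓝 (0 : P × E), IsSolution f q (Γ q) ∧ ∀ c : P,
      Continuous fun u : ℝ => f (c, Γ q (Set.projIcc 0 1 zero_le_one u)) := hsol.and hcont
    filter_upwards [hconst, ht.eventually hgood.eventually_nhds,
      ht.eventually hΓ.eventually_analyticAt, hXc] with x hx hg ha hXx
    have htc : Tendsto (fun c : P => (c, x)) (𝓝 0) (𝓝 (0, x)) :=
      (Continuous.prodMk_left x).tendsto 0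
    rw [hasFDerivAt_iff_isLittleO_nhds_zero, Asymptotics.isLittleO_iff]
    intro ε hε
    obtain ⟨δ, hδ, hδX⟩ := Metric.continuousAt_iff.1 hXx ε hε
    have hΓc : ∀ᶠ c in 𝓝 (0 : P), ‖Γ (c, x) - Γ (0, x)‖ < δ := by
      have h1 := (ha.continuousAt.tendsto.comp htc).eventually (Metric.ball_mem_nhds _ hδ)
      filter_upwards [h1] with c hc
      rwa [← dist_eq_norm]
    filter_upwards [hΓc, htc.eventually hg] with c hc ⟨hs, hcc⟩
    rw [zero_add, hx 1, hs 1]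
    have e1 : (∫ u in (0 : ℝ)..(1 : I), f ((c, x).1, Γ (c, x) (Set.projIcc 0 1 zero_le_one u)))
        - X x c = ∫ u in (0 : ℝ)..1,
          (f (c, Γ (c, x) (Set.projIcc 0 1 zero_le_one u)) - X x c) := by
      rw [intervalIntegral.integral_sub ((hcc c).intervalIntegrable _ _)
        intervalIntegrable_const]
      simp
    rw [add_sub_cancel_left, e1]
    refine (intervalIntegral.norm_integral_le_of_norm_le_const (C := ε * ‖c‖) fun u _ => ?_).trans
      (by simp)
    have h2 : ‖X (Γ (c, x) (Set.projIcc 0 1 zero_le_one u)) - X x‖ ≤ ε := by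
      rw [← dist_eq_norm]
      refine (hδX ?_).le
      rw [dist_eq_norm]
      refine lt_of_le_of_lt ?_ hc
      have h3 := (Γ (c, x) - Γ (0, x)).norm_coe_le_norm (Set.projIcc 0 1 zero_le_one u)
      rwa [ContinuousMap.sub_apply, hx] at h3
    have h4 : f (c, Γ (c, x) (Set.projIcc 0 1 zero_le_one u)) - X x c
        = (X (Γ (c, x) (Set.projIcc 0 1 zero_le_one u)) - X x) c := rfl
    rw [h4]
    exact ContinuousLinearMap.le_of_opNorm_le _ h2 c

end EndpointMap

end CRGeom

/-! ### Orbits of analytic families of vector fields -/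

namespace CRGeom

open Module

/-- The rank of a continuous linear map. -/
def clmRank {E F : Type*} [NormedAddCommGroup E] [NormedSpace ℝ E] [NormedAddCommGroup F]
    [NormedSpace ℝ F] (L : E →L[ℝ] F) : ℕ := finrank ℝ (LinearMap.range L.toLinearMap)

section Orbit

variable {E P : Type} [NormedAddCommGroup E] [NormedSpace ℝ E]
  [NormedAddCommGroup P] [NormedSpace ℝ P]

/-- `b` can be reached from `a` inside `O` by finitely many integral curves of the fields
`x ↦ X(x)c`. -/
def Reach (X : E → P →L[ℝ] E) (O : Set E) (a b : E) : Prop :=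
  Relation.ReflTransGen (CurveJoined X O) a b

/-- A family `F(q, ·)` of local transformations near `0`, with inverses `G(q, ·)`, both analytic
and moving each point within its orbit. -/
structure ReachFamily (X : E → P →L[ℝ] E) {Q : Type} [NormedAddCommGroup Q] [NormedSpace ℝ Q]
    (F G : Q × E → E) : Prop where
  analytic : AnalyticAt ℝ F 0
  map_zero : F 0 = 0
  reach : ∀ O ∈ 𝓝 (0 : E), ∀ᶠ p in 𝓝 (0 : Q × E), Reach X O p.2 (F p)
  left_inv : ∀ᶠ p in 𝓝 (0 : Q × E), G (p.1, F p) = p.2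
  analytic' : AnalyticAt ℝ G 0
  map_zero' : G 0 = 0
  reach' : ∀ O ∈ 𝓝 (0 : E), ∀ᶠ p in 𝓝 (0 : Q × E), Reach X O p.2 (G p)
  right_inv : ∀ᶠ p in 𝓝 (0 : Q × E), F (p.1, G p) = p.2

namespace ReachFamily

variable {X : E → P →L[ℝ] E} {Q R : Type} [NormedAddCommGroup Q] [NormedSpace ℝ Q]
  [NormedAddCommGroup R] [NormedSpace ℝ R] {F G : Q × E → E} {F' G' : R × E → E}

theorem symm (h : ReachFamily X F G) : ReachFamily X G F :=
  ⟨h.analytic', h.map_zero', h.reach', h.right_inv, h.analytic, h.map_zero, h.reach, h.left_inv⟩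

theorem tendsto (h : ReachFamily X F G) : Tendsto F (𝓝 0) (𝓝 0) := by
  simpa [h.map_zero] using h.analytic.continuousAt.tendsto

/-- The composition of two families: first `F`, then `F'`. -/
theorem comp (h : ReachFamily X F G) (h' : ReachFamily X F' G') :
    ReachFamily X (Q := Q × R) (fun p => F' (p.1.2, F (p.1.1, p.2)))
      (fun p => G (p.1.1, G' (p.1.2, p.2))) := by
  have aux : ∀ {Q R : Type} [NormedAddCommGroup Q] [NormedSpace ℝ Q] [NormedAddCommGroup R]
      [NormedSpace ℝ R] {S : Type} [NormedAddCommGroup S] [NormedSpace ℝ S]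
      {F G : Q × E → E} {F' G' : R × E → E}
      (_ : ReachFamily X F G) (_ : ReachFamily X F' G') (a : S →L[ℝ] Q) (b : S →L[ℝ] R),
      AnalyticAt ℝ (fun p : S × E => F' (b p.1, F (a p.1, p.2))) 0 ∧
      (∀ O ∈ 𝓝 (0 : E), ∀ᶠ p in 𝓝 (0 : S × E),
        Reach X O p.2 (F' (b p.1, F (a p.1, p.2)))) ∧
      (∀ᶠ p in 𝓝 (0 : S × E), G (a p.1, G' (b p.1, F' (b p.1, F (a p.1, p.2)))) = p.2) := by
    intro Q R _ _ _ _ S _ _ F G F' G' h h' a b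
    have e0 : (a (0 : S × E).1, (0 : S × E).2) = (0 : Q × E) := by simp
    have h1 : AnalyticAt ℝ (fun p : S × E => (a p.1, p.2)) 0 :=
      ((a.analyticAt _).comp analyticAt_fst).prod analyticAt_snd
    have h2 : AnalyticAt ℝ (fun p : S × E => F (a p.1, p.2)) 0 := by
      refine AnalyticAt.comp (g := F) ?_ h1
      rw [e0]; exact h.analytic
    have h3 : AnalyticAt ℝ (fun p : S × E => (b p.1, F (a p.1, p.2))) 0 :=
      ((b.analyticAt _).comp analyticAt_fst).prod h2
    have e1 : (b (0 : S × E).1, F (a (0 : S × E).1, (0 : S × E).2)) = (0 : R × E) := by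
      rw [e0, h.map_zero]; simp
    have t1 : Tendsto (fun p : S × E => (a p.1, p.2)) (𝓝 0) (𝓝 0) := by
      have := h1.continuousAt.tendsto
      rwa [e0] at this
    have t3 : Tendsto (fun p : S × E => (b p.1, F (a p.1, p.2))) (𝓝 0) (𝓝 0) := by
      have := h3.continuousAt.tendsto
      rwa [e1] at this
    refine ⟨?_, ?_, ?_⟩
    · refine AnalyticAt.comp (g := F') ?_ h3
      rw [e1]; exact h'.analytic
    · intro O hO
      filter_upwards [t1.eventually (h.reach O hO), t3.eventually (h'.reach O hO)] with p hp hp'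
      exact hp.trans hp'
    · filter_upwards [t1.eventually h.left_inv, t3.eventually h'.left_inv] with p hp hp'
      rw [hp', hp]
  obtain ⟨a1, a2, a3⟩ := aux (S := Q × R) h h' (ContinuousLinearMap.fst ℝ Q R)
    (ContinuousLinearMap.snd ℝ Q R)
  obtain ⟨b1, b2, b3⟩ := aux (S := Q × R) h'.symm h.symm (ContinuousLinearMap.snd ℝ Q R)
    (ContinuousLinearMap.fst ℝ Q R)
  refine ⟨a1, ?_, a2, a3, b1, ?_, b2, b3⟩
  · change F' (0, F 0) = 0
    rw [h.map_zero]; exact h'.map_zero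
  · change G (0, G' 0) = 0
    rw [h'.map_zero']; exact h.map_zero'

end ReachFamily

/-- A linear map of rank at least `D` is injective on some `D`-dimensional slice of its domain. -/
theorem exists_injective_slice {Q : Type*} [NormedAddCommGroup Q] [NormedSpace ℝ Q]
    (L : Q →L[ℝ] E) {D : ℕ} (hD : D ≤ clmRank L) :
    ∃ ι : (Fin D → ℝ) →L[ℝ] Q, Function.Injective (L.comp ι) := by
  obtain ⟨v, hv⟩ := exists_linearIndependent_of_le_finrank hD
  choose w hw using fun i => (v i).2
  refine ⟨LinearMap.toContinuousLinearMap (Fintype.linearCombination ℝ w), ?_⟩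
  have h1 : LinearIndependent ℝ fun i => ((v i : LinearMap.range L.toLinearMap) : E) :=
    hv.map' (Submodule.subtype _) (Submodule.ker_subtype _)
  have h2 := h1.fintypeLinearCombination_injective
  intro x y hxy
  apply h2
  have h3 : ∀ z : Fin D → ℝ, L (Fintype.linearCombination ℝ w z) = Fintype.linearCombination ℝ
      (fun i => ((v i : LinearMap.range L.toLinearMap) : E)) z := by
    intro z
    simp only [Fintype.linearCombination_apply, map_sum, map_smul]
    refine Finset.sum_congr rfl fun i _ => ?_
    rw [← hw i]; rfl
  rw [← h3, ← h3]
  exact hxy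

variable [FiniteDimensional ℝ E] [FiniteDimensional ℝ P]

/-- There is a family of local transformations of generic rank `D` near the origin. -/
def HasFamilyOfRank (X : E → P →L[ℝ] E) (D : ℕ) : Prop :=
  ∃ (Q : Type) (_ : NormedAddCommGroup Q) (_ : NormedSpace ℝ Q) (F G : Q × E → E),
    ReachFamily X F G ∧ ∃ᶠ q in 𝓝 (0 : Q), D ≤ clmRank (fderiv ℝ (fun q => F (q, 0)) q)

/-- The orbit theorem for analytic families of vector fields: inside any neighbourhood `O` of the
origin there is an analytic immersed disc through the origin, contained in the orbit of the origin
in `O` and tangent to all the vector fields. Among all compositions of flows one takes a family of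
maximal generic rank and transports its image back to the origin; if one of the fields were not
tangent to the image, following its flow would increase the rank. -/
theorem exists_orbit_disc {X : E → P →L[ℝ] E} (hX : AnalyticAt ℝ X 0) {O : Set E}
    (hO : O ∈ 𝓝 (0 : E)) :
    ∃ (D : ℕ) (γ : (Fin D → ℝ) → E), AnalyticAt ℝ γ 0 ∧ γ 0 = 0 ∧
      Function.Injective (fderiv ℝ γ 0) ∧ (∀ᶠ t in 𝓝 0, Reach X O 0 (γ t)) ∧
      ∀ᶠ t in 𝓝 0, ∀ c, X (γ t) c ∈ LinearMap.range (fderiv ℝ γ t).toLinearMap := by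
  have : CompleteSpace E := FiniteDimensional.complete ℝ E
  have : CompleteSpace P := FiniteDimensional.complete ℝ P
  obtain ⟨Φ, hΦ, hΦ0, hΦid, hΦinv, hΦr, hΦd⟩ := exists_analytic_flow hX
  have tneg : Tendsto (fun q : P × E => (-q.1, q.2)) (𝓝 0) (𝓝 0) := by
    have : Continuous (fun q : P × E => (-q.1, q.2)) := by fun_prop
    simpa [Prod.mk_zero_zero] using this.tendsto 0
  have hflow : ReachFamily X Φ (fun q => Φ (-q.1, q.2)) := by
    refine ⟨hΦ, hΦ0, fun O hO => (hΦr O hO).mono fun p hp => .single hp, hΦinv, ?_, ?_, ?_, ?_⟩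
    · refine AnalyticAt.comp (g := Φ) (f := fun q : P × E => (-q.1, q.2)) ?_
        (analyticAt_fst.neg.prod analyticAt_snd)
      simpa [Prod.mk_zero_zero] using hΦ
    · simpa [Prod.mk_zero_zero] using hΦ0
    · exact fun O hO => (tneg.eventually (hΦr O hO)).mono fun p hp => .single hp
    · filter_upwards [tneg.eventually hΦinv] with p hp
      simpa using hp
  have hzero : HasFamilyOfRank X 0 :=
    ⟨P, inferInstance, inferInstance, _, _, hflow, Eventually.frequently (.of_forall fun _ =>
      Nat.zero_le _)⟩
  have hbound : ∃ n, ¬ HasFamilyOfRank X n := by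
    refine ⟨finrank ℝ E + 1, ?_⟩
    rintro ⟨Q, _, _, F, G, -, h⟩
    obtain ⟨q, hq⟩ := h.exists
    have : clmRank (fderiv ℝ (fun q => F (q, 0)) q) ≤ finrank ℝ E := Submodule.finrank_le _
    omega
  obtain ⟨D, hD, hD'⟩ : ∃ D, HasFamilyOfRank X D ∧ ¬ HasFamilyOfRank X (D + 1) := by
    classical
    have h1 := Nat.find_spec hbound
    have h2 : Nat.find hbound ≠ 0 := fun h => (h ▸ h1) hzero
    obtain ⟨k, hk⟩ := Nat.exists_eq_succ_of_ne_zero h2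
    refine ⟨k, not_not.1 (Nat.find_min hbound (by omega)), ?_⟩
    rwa [hk] at h1
  obtain ⟨Q, _, _, F, G, hF, hfreq⟩ := hD
  -- the family `Φ(c, G(q', F(q, ·)))`, whose rank is at most `D`
  have hK := (hF.comp hF.symm).comp hflow
  have hrank : ∀ᶠ w in 𝓝 (0 : (Q × Q) × P),
      clmRank (fderiv ℝ (fun w => Φ (w.2, G (w.1.2, F (w.1.1, 0)))) w) ≤ D := by
    by_contra hcon
    refine hD' ⟨(Q × Q) × P, inferInstance, inferInstance, _, _, hK, ?_⟩
    exact (not_eventually.1 hcon).mono fun w hw => by push Not at hw; exact hw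
  have hKa : ∀ᶠ w in 𝓝 (0 : (Q × Q) × P),
      AnalyticAt ℝ (fun w : (Q × Q) × P => Φ (w.2, G (w.1.2, F (w.1.1, 0)))) w := by
    have h1 : AnalyticAt ℝ (fun w : (Q × Q) × P => (w, (0 : E))) 0 :=
      analyticAt_id.prod analyticAt_const
    have h2 := AnalyticAt.comp (f := fun w : (Q × Q) × P => (w, (0 : E))) (x := 0) hK.analytic h1
    exact h2.eventually_analyticAt
  -- pull all generic conditions back to a single parameter `q₀`
  have tq : Tendsto (fun q : Q => (q, (0 : E))) (𝓝 0) (𝓝 0) :=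
    (Continuous.prodMk_left (0 : E)).tendsto 0
  have cq : ∀ q₀, Tendsto (fun q : Q => (q, (0 : E))) (𝓝 q₀) (𝓝 (q₀, 0)) := fun q₀ =>
    (Continuous.prodMk_left (0 : E)).tendsto q₀
  have tF : Tendsto (fun q : Q => (q, F (q, 0))) (𝓝 0) (𝓝 0) :=
    tendsto_id.prodMk_nhds (hF.tendsto.comp tq)
  have tw : Tendsto (fun q : Q => (((q, q), (0 : P)) : (Q × Q) × P)) (𝓝 0) (𝓝 0) := by
    have : Continuous (fun q : Q => (((q, q), (0 : P)) : (Q × Q) × P)) := by fun_prop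
    exact this.tendsto 0
  obtain ⟨q₀, hq₀, hFa, hGa, hrank₀, hKa₀, hreach, hreach', hinv, hinv₀⟩ :=
    (hfreq.and_eventually ((tq.eventually hF.analytic.eventually_analyticAt).and
    ((tF.eventually hF.analytic'.eventually_analyticAt).and
    ((tw.eventually hrank.eventually_nhds).and
    ((tw.eventually hKa.eventually_nhds).and
    ((tq.eventually (hF.reach O hO).eventually_nhds).and
    ((tF.eventually (hF.reach' O hO).eventually_nhds).and
    ((tF.eventually hF.right_inv.eventually_nhds).and
    (tq.eventually hF.left_inv))))))))).exists
  have hpair : AnalyticAt ℝ (fun q : Q => (q, (0 : E))) q₀ := analyticAt_id.prod analyticAt_const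
  have hF0a : AnalyticAt ℝ (fun q : Q => F (q, 0)) q₀ :=
    AnalyticAt.comp (g := F) (f := fun q : Q => (q, (0 : E))) hFa hpair
  let f : Q → E := fun q => G (q₀, F (q, 0))
  have hpair' : AnalyticAt ℝ (fun q : Q => (q₀, F (q, 0))) q₀ := analyticAt_const.prod hF0a
  have hfa : AnalyticAt ℝ f q₀ :=
    AnalyticAt.comp (g := G) (f := fun q : Q => (q₀, F (q, 0))) hGa hpair'
  have hf0 : f q₀ = 0 := hinv₀
  have tG : Tendsto (fun q : Q => (q₀, F (q, 0))) (𝓝 q₀) (𝓝 (q₀, F (q₀, 0))) :=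
    hpair'.continuousAt.tendsto
  -- `f` has rank at least `D` at `q₀`, because `F(q, 0) = F(q₀, f(q))`
  have hfrank : D ≤ clmRank (fderiv ℝ f q₀) := by
    refine hq₀.trans ?_
    have h1 : (fun q => F (q₀, f q)) =ᶠ[𝓝 q₀] fun q => F (q, 0) := tG.eventually hinv
    have h2 : HasFDerivAt (fun y : E => F (q₀, y)) (fderiv ℝ (fun y : E => F (q₀, y)) (f q₀))
        (f q₀) := by
      refine DifferentiableAt.hasFDerivAt ?_
      rw [hf0]
      have : AnalyticAt ℝ (fun y : E => F (q₀, y)) 0 :=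
        AnalyticAt.comp (g := F) (f := fun y : E => (q₀, y)) hFa
          (analyticAt_const.prod analyticAt_id)
      exact this.differentiableAt
    have h3 := (h2.comp q₀ hfa.differentiableAt.hasFDerivAt).congr_of_eventuallyEq h1.symm
    unfold clmRank
    rw [h3.fderiv]
    have : LinearMap.range ((fderiv ℝ (fun y : E => F (q₀, y)) (f q₀)).comp
        (fderiv ℝ f q₀)).toLinearMap = (LinearMap.range (fderiv ℝ f q₀).toLinearMap).map
          (fderiv ℝ (fun y : E => F (q₀, y)) (f q₀)).toLinearMap :=
      LinearMap.range_comp _ _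
    rw [this]
    exact Submodule.finrank_map_le _ _
  obtain ⟨ι, hι⟩ := exists_injective_slice _ hfrank
  let a : (Fin D → ℝ) → Q := fun t => q₀ + ι t
  have ha0 : a 0 = q₀ := by simp [a]
  have haa : ∀ t, AnalyticAt ℝ a t := fun t => analyticAt_const.add (ι.analyticAt t)
  have had : ∀ t, HasFDerivAt a ι t := fun t => ι.hasFDerivAt.const_add q₀
  have hat : Tendsto a (𝓝 0) (𝓝 q₀) := by
    have := (haa 0).continuousAt.tendsto
    rwa [ha0] at this
  have hγa : AnalyticAt ℝ (fun t => f (a t)) 0 := by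
    refine AnalyticAt.comp (g := f) ?_ (haa 0)
    rwa [ha0]
  have hγd : ∀ᶠ t in 𝓝 0, HasFDerivAt (fun t => f (a t)) ((fderiv ℝ f (a t)).comp ι) t := by
    filter_upwards [hat.eventually hfa.eventually_analyticAt] with t ht
    exact ht.differentiableAt.hasFDerivAt.comp t (had t)
  have hγinj : Function.Injective (fderiv ℝ (fun t => f (a t)) 0) := by
    rw [hγd.self_of_nhds.fderiv, ha0]; exact hι
  have hinj : ∀ᶠ t in 𝓝 0, Function.Injective (fderiv ℝ (fun t => f (a t)) t) :=
    hγa.fderiv.continuousAt.eventually (ContinuousLinearMap.isOpen_injective.mem_nhds hγinj)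
  refine ⟨D, fun t => f (a t), hγa, by simp only [ha0, hf0], hγinj, ?_, ?_⟩
  · have h1 := (hat.eventually ((cq q₀).eventually hreach))
    have h2 := (hat.eventually (tG.eventually hreach'))
    filter_upwards [h1, h2] with t h1 h2
    exact Relation.ReflTransGen.trans h1 h2
  · have tw' : Tendsto (fun q : Q => (((q, q₀), (0 : P)) : (Q × Q) × P)) (𝓝 q₀)
        (𝓝 ((q₀, q₀), 0)) := by
      have : Continuous (fun q : Q => (((q, q₀), (0 : P)) : (Q × Q) × P)) := by fun_prop
      exact this.tendsto q₀
    have hft : Tendsto f (𝓝 q₀) (𝓝 0) := by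
      have := hfa.continuousAt.tendsto
      rwa [hf0] at this
    have key : ∀ᶠ q in 𝓝 q₀, ∃ W : Submodule ℝ E, finrank ℝ W ≤ D ∧
        LinearMap.range (fderiv ℝ f q).toLinearMap ≤ W ∧ ∀ c, X (f q) c ∈ W := by
      filter_upwards [tw'.eventually hrank₀, tw'.eventually hKa₀,
        (hft.eventually hΦid).eventually_nhds, hft.eventually hΦd, hfa.eventually_analyticAt]
        with q hr hk hid hd hfq
      refine ⟨_, hr, ?_, ?_⟩
      · rintro _ ⟨v, rfl⟩
        have h1 : HasFDerivAt (fun q : Q => (((q, q₀), (0 : P)) : (Q × Q) × P))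
            ((ContinuousLinearMap.inl ℝ (Q × Q) P).comp (ContinuousLinearMap.inl ℝ Q Q)) q :=
          (((hasFDerivAt_id q).prodMk (hasFDerivAt_const q₀ q)).prodMk
            (hasFDerivAt_const (0 : P) q)).congr_fderiv (ContinuousLinearMap.ext fun v => rfl)
        have h2 := hk.differentiableAt.hasFDerivAt.comp q h1
        have h3 := h2.congr_of_eventuallyEq (f₁ := f) (hid.mono fun q hq => hq.symm)
        exact ⟨((v, 0), 0), by rw [h3.fderiv]; rfl⟩
      · intro c
        have h1 : HasFDerivAt (fun c : P => (((q, q₀), c) : (Q × Q) × P))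
            (ContinuousLinearMap.inr ℝ (Q × Q) P) 0 :=
          ((hasFDerivAt_const (q, q₀) (0 : P)).prodMk (hasFDerivAt_id (0 : P))).congr_fderiv
            (ContinuousLinearMap.ext fun v => rfl)
        have h2 := HasFDerivAt.comp (0 : P) (f := fun c : P => (((q, q₀), c) : (Q × Q) × P))
          hk.differentiableAt.hasFDerivAt h1
        have h3 := h2.unique hd
        exact ⟨(0, c), by rw [← h3]; rfl⟩
    filter_upwards [hat.eventually key, hinj, hγd] with t ⟨W, hW, hfW, hXW⟩ hi hd c
    have h1 : LinearMap.range (fderiv ℝ (fun t => f (a t)) t).toLinearMap ≤ W := by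
      rw [hd.fderiv]
      rintro _ ⟨v, rfl⟩
      exact hfW ⟨ι v, rfl⟩
    have h2 : finrank ℝ (LinearMap.range (fderiv ℝ (fun t => f (a t)) t).toLinearMap) = D := by
      rw [LinearMap.finrank_range_of_inj hi]; simp
    rw [Submodule.eq_of_le_of_finrank_le h1 (hW.trans h2.ge)]
    exact hXW c

end Orbit

/-! ### Immersed discs -/

section Immersion

variable {V E : Type*} [NormedAddCommGroup V] [NormedSpace ℝ V]
  [NormedAddCommGroup E] [NormedSpace ℝ E]

/-- An analytic immersion has a linear left inverse up to a local homeomorphism. -/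
theorem exists_retraction [FiniteDimensional ℝ V] [FiniteDimensional ℝ E] {γ : V → E} {t : V}
    (hγ : AnalyticAt ℝ γ t)
    (hinj : Function.Injective (fderiv ℝ γ t)) :
    ∃ (A : E →L[ℝ] V) (e : OpenPartialHomeomorph V V), t ∈ e.source ∧ (∀ x, e x = A (γ x)) ∧
      AnalyticAt ℝ e.symm (A (γ t)) := by
  have : CompleteSpace V := FiniteDimensional.complete ℝ V
  obtain ⟨A', hA'⟩ := LinearMap.exists_leftInverse_of_injective (fderiv ℝ γ t).toLinearMap
    (LinearMap.ker_eq_bot.2 hinj)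
  let A : E →L[ℝ] V := LinearMap.toContinuousLinearMap A'
  have hA : ∀ v, A (fderiv ℝ γ t v) = v := fun v => LinearMap.congr_fun hA' v
  obtain ⟨e, h1, h2, h3, -⟩ := exists_analytic_localInverse (𝕜 := ℝ) (f := fun x => A (γ x))
    ((A.analyticAt _).comp hγ) (ContinuousLinearEquiv.refl ℝ V) (by
      have := A.hasFDerivAt.comp t hγ.differentiableAt.hasFDerivAt
      exact this.congr_fderiv (ContinuousLinearMap.ext fun v => hA v))
  exact ⟨A, e, h1, h2, h3⟩

/-- A small piece of an immersion is a homeomorphism onto its image. -/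
theorem map_nhds_of_retraction {γ : V → E} {A : E →L[ℝ] V} {e : OpenPartialHomeomorph V V}
    (he : ∀ x, e x = A (γ x)) {B : Set V} (hB : IsOpen B) (hBe : B ⊆ e.source) {t : V}
    (ht : t ∈ B) (hc : ContinuousAt γ t) : Filter.map γ (𝓝 t) = 𝓝[γ '' B] (γ t) := by
  apply le_antisymm
  · refine tendsto_nhdsWithin_iff.2 ⟨hc, ?_⟩
    filter_upwards [hB.mem_nhds ht] with x hx using ⟨x, hx, rfl⟩
  · intro S hS
    rw [mem_map] at hS
    have h1 : Tendsto (fun y => e.symm (A y)) (𝓝 (γ t)) (𝓝 t) := by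
      have h2 := e.continuousAt_symm (e.map_source (hBe ht))
      have h3 : Tendsto A (𝓝 (γ t)) (𝓝 (e t)) := by
        rw [he]; exact A.continuous.tendsto _
      have h4 := h2.tendsto.comp h3
      rwa [e.left_inv (hBe ht)] at h4
    rw [mem_nhdsWithin_iff_eventually]
    filter_upwards [h1 hS] with y hy hyB
    obtain ⟨x, hx, rfl⟩ := hyB
    rw [Set.mem_preimage, ← he, e.left_inv (hBe hx)] at hy
    exact hy

end Immersion

section Tangent

variable {m d : ℕ} {V : Type*} [NormedAddCommGroup V] [NormedSpace ℝ V]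

theorem range_subset_tangentVectors {N : Set (CSpace m d)} {γ : V → CSpace m d} {t : V}
    {L : V →L[ℝ] CSpace m d} (hγ : HasFDerivAt γ L t) (hN : ∀ᶠ x in 𝓝 t, γ x ∈ N) (v : V) :
    L v ∈ tangentVectors N (γ t) := by
  refine ⟨fun s => γ (t + s • v), by simp, ?_, ?_⟩
  · have h1 : HasDerivAt (fun s : ℝ => t + s • v) v 0 := by
      simpa using ((hasDerivAt_id (0 : ℝ)).smul_const v).const_add t
    have h2 : HasFDerivAt γ L (t + (0 : ℝ) • v) := by simpa using hγ
    exact h2.comp_hasDerivAt (0 : ℝ) h1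
  · have h1 : Tendsto (fun s : ℝ => t + s • v) (𝓝 0) (𝓝 t) := by
      have : Continuous fun s : ℝ => t + s • v := by fun_prop
      simpa using this.tendsto 0
    exact h1.eventually hN

theorem tangentVectors_subset_range [FiniteDimensional ℝ V] {N : Set (CSpace m d)}
    {γ : V → CSpace m d} {t : V} (hγ : AnalyticAt ℝ γ t)
    (hinj : Function.Injective (fderiv ℝ γ t)) (hN : Filter.map γ (𝓝 t) = 𝓝[N] (γ t))
    {v : CSpace m d} (hv : v ∈ tangentVectors N (γ t)) :
    v ∈ LinearMap.range (fderiv ℝ γ t).toLinearMap := by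
  obtain ⟨A, e, het, he, hes⟩ := exists_retraction hγ hinj
  obtain ⟨c, hc0, hcd, hcN⟩ := hv
  have hct : Tendsto c (𝓝 0) (𝓝[N] (γ t)) :=
    tendsto_nhdsWithin_iff.2 ⟨by rw [← hc0]; exact hcd.continuousAt.tendsto, hcN⟩
  have hS : γ '' e.source ∈ 𝓝[N] (γ t) := by
    rw [← hN]
    exact image_mem_map (e.open_source.mem_nhds het)
  have heq : c =ᶠ[𝓝 0] fun s => γ (e.symm (A (c s))) := by
    filter_upwards [hct.eventually_mem hS] with s ⟨x, hx, hxs⟩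
    rw [← hxs, ← he, e.left_inv hx]
  have h1 : HasDerivAt (fun s => A (c s)) (A v) 0 := A.hasFDerivAt.comp_hasDerivAt (0 : ℝ) hcd
  have h2 : HasFDerivAt e.symm (fderiv ℝ e.symm (A (c 0))) (A (c 0)) := by
    rw [hc0]; exact hes.differentiableAt.hasFDerivAt
  have h3 := h2.comp_hasDerivAt (0 : ℝ) h1
  have h4 : e.symm (A (c 0)) = t := by rw [hc0, ← he, e.left_inv het]
  have h5 : HasFDerivAt γ (fderiv ℝ γ t) (e.symm (A (c 0))) := by
    rw [h4]; exact hγ.differentiableAt.hasFDerivAt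
  have h6 := (h5.comp_hasDerivAt (0 : ℝ) h3).congr_of_eventuallyEq heq
  exact ⟨_, h6.unique hcd⟩

end Tangent

/-! ### Real and complex coordinates -/

section Coordinates

/-- Componentwise complex conjugation, as a real linear map. -/
def conjL (n : ℕ) : (Fin n → ℂ) →L[ℝ] (Fin n → ℂ) :=
  ContinuousLinearMap.pi fun i =>
    (Complex.conjCLE : ℂ →L[ℝ] ℂ).comp (ContinuousLinearMap.proj i)

/-- Componentwise real part. -/
def reL (n : ℕ) : (Fin n → ℂ) →L[ℝ] (Fin n → ℝ) :=
  ContinuousLinearMap.pi fun i => Complex.reCLM.comp (ContinuousLinearMap.proj i)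

/-- Componentwise imaginary part. -/
def imL (n : ℕ) : (Fin n → ℂ) →L[ℝ] (Fin n → ℝ) :=
  ContinuousLinearMap.pi fun i => Complex.imCLM.comp (ContinuousLinearMap.proj i)

/-- The inclusion of real vectors into complex vectors. -/
def ofRealL (n : ℕ) : (Fin n → ℝ) →L[ℝ] (Fin n → ℂ) :=
  ContinuousLinearMap.pi fun i => Complex.ofRealCLM.comp (ContinuousLinearMap.proj i)

variable {n m d : ℕ}

@[simp] theorem conjL_apply (v : Fin n → ℂ) (i : Fin n) : conjL n v i = conj (v i) := rfl
@[simp] theorem reL_apply (v : Fin n → ℂ) (i : Fin n) : reL n v i = (v i).re := rfl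
@[simp] theorem imL_apply (v : Fin n → ℂ) (i : Fin n) : imL n v i = (v i).im := rfl
@[simp] theorem ofRealL_apply (v : Fin n → ℝ) (i : Fin n) : ofRealL n v i = (v i : ℂ) := rfl

@[simp] theorem conjL_conjL (v : Fin n → ℂ) : conjL n (conjL n v) = v := by ext i; simp
@[simp] theorem conjL_I_smul (v : Fin n → ℂ) :
    conjL n (Complex.I • v) = -(Complex.I • conjL n v) := by ext i; simp
@[simp] theorem conjL_ofRealL (v : Fin n → ℝ) : conjL n (ofRealL n v) = ofRealL n v := by
  ext i; simp
@[simp] theorem reL_ofRealL (v : Fin n → ℝ) : reL n (ofRealL n v) = v := by ext i; simp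
@[simp] theorem imL_ofRealL (v : Fin n → ℝ) : imL n (ofRealL n v) = 0 := by ext i; simp

theorem ofRealL_reL_add (v : Fin n → ℂ) :
    ofRealL n (reL n v) + Complex.I • ofRealL n (imL n v) = v := by
  ext i
  simp only [Pi.add_apply, Pi.smul_apply, ofRealL_apply, reL_apply, imL_apply, smul_eq_mul]
  rw [mul_comm, Complex.re_add_im]

theorem add_conjL (v : Fin n → ℂ) : v + conjL n v = (2 : ℂ) • ofRealL n (reL n v) := by
  ext i
  simp [Complex.add_conj]

theorem norm_ofRealL (v : Fin n → ℝ) : ‖ofRealL n v‖ = ‖v‖ := by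
  simp only [Pi.norm_def, ofRealL_apply]
  congr 2
  ext i
  simp

/-- `(z, w) ↦ (conj z, z, w)`, where the complex defining function is evaluated. -/
def jetL (m d : ℕ) : CSpace m d →L[ℝ] TSpace m d :=
  ((conjL m).comp (ContinuousLinearMap.fst ℝ _ _)).prod (ContinuousLinearMap.id ℝ _)

@[simp] theorem jetL_apply (t : CSpace m d) : jetL m d t = (conjL m t.1, t.1, t.2) := rfl

theorem norm_jetL (t : CSpace m d) : ‖jetL m d t‖ = ‖t‖ := by
  have h : ‖conjL m t.1‖ = ‖t.1‖ := by
    simp only [Pi.norm_def, conjL_apply]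
    congr 2
    ext i
    simp
  change max ‖conjL m t.1‖ (max ‖t.1‖ ‖t.2‖) = max ‖t.1‖ ‖t.2‖
  rw [h, ← max_assoc, max_self]

/-- The linear map underlying `realCoords`. -/
def realCoordsL (m d : ℕ) : CSpace m d →L[ℝ] RSpace m d :=
  ((reL m).comp (ContinuousLinearMap.fst ℝ _ _)).prod
    (((imL m).comp (ContinuousLinearMap.fst ℝ _ _)).prod
      ((reL d).comp (ContinuousLinearMap.snd ℝ _ _)))

theorem realCoordsL_apply (t : CSpace m d) : realCoordsL m d t = realCoords t := rfl

/-- `(x, y, u) ↦ x + iy`. -/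
def zL (m d : ℕ) : RSpace m d →L[ℝ] (Fin m → ℂ) :=
  (ofRealL m).comp (ContinuousLinearMap.fst ℝ _ _) +
    (Complex.I • ofRealL m).comp
      ((ContinuousLinearMap.fst ℝ _ _).comp (ContinuousLinearMap.snd ℝ (Fin m → ℝ) _))

theorem zL_apply (s : RSpace m d) :
    zL m d s = ofRealL m s.1 + Complex.I • ofRealL m s.2.1 := rfl

/-- `(x, y, u) ↦ u`. -/
def uL (m d : ℕ) : RSpace m d →L[ℝ] (Fin d → ℝ) :=
  (ContinuousLinearMap.snd ℝ (Fin m → ℝ) (Fin d → ℝ)).comp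
    (ContinuousLinearMap.snd ℝ (Fin m → ℝ) ((Fin m → ℝ) × (Fin d → ℝ)))

/-- `(x, y, u) ↦ (x - iy, x + iy, u)`, the totally real set of the points `(conj z, z, u)`. -/
def totRealL (m d : ℕ) : RSpace m d →L[ℝ] TSpace m d :=
  ((conjL m).comp (zL m d)).prod ((zL m d).prod ((ofRealL d).comp (uL m d)))

theorem totRealL_apply (s : RSpace m d) :
    totRealL m d s = (conjL m (zL m d s), zL m d s, ofRealL d s.2.2) := rfl

theorem zL_reL_imL (c : Fin m → ℂ) (u : Fin d → ℝ) : zL m d (reL m c, imL m c, u) = c := by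
  rw [zL_apply]; exact ofRealL_reL_add c

theorem reL_zL (s : RSpace m d) : reL m (zL m d s) = s.1 := by
  ext i; simp [zL_apply]

theorem imL_zL (s : RSpace m d) : imL m (zL m d s) = s.2.1 := by
  ext i; simp [zL_apply]

end Coordinates

namespace LocalGeneric

variable {m d : ℕ} (M : LocalGeneric m d)

theorem param_eq (s : RSpace m d) :
    M.param s = (zL m d s, ofRealL d s.2.2 + Complex.I • ofRealL d (M.φ s)) := rfl

theorem realCoords_param (s : RSpace m d) : realCoords (M.param s) = s := by
  rw [← realCoordsL_apply, M.param_eq]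
  refine Prod.ext (reL_zL s) (Prod.ext (imL_zL s) ?_)
  change reL d (ofRealL d s.2.2 + Complex.I • ofRealL d (M.φ s)) = s.2.2
  ext j; simp

theorem param_realCoords {t : CSpace m d} (ht : ∀ j, (t.2 j).im = M.φ (realCoords t) j) :
    M.param (realCoords t) = t := by
  rw [M.param_eq]
  refine Prod.ext (zL_reL_imL t.1 (reL d t.2)) ?_
  have h : M.φ (realCoords t) = imL d t.2 := funext fun j => (ht j).symm
  rw [h]
  exact ofRealL_reL_add t.2

theorem φ_zero : M.φ 0 = 0 := by
  by_contra h
  have h1 : 0 < ‖M.φ 0‖ := norm_pos_iff.2 h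
  have h2 := M.φ_lt (min ‖M.φ 0‖ (2 * M.ρ₁)) (le_min h1.le (by linarith [M.ρ₁_pos]))
    (min_le_right _ _) 0 (by rw [norm_zero]; exact lt_min h1 (by linarith [M.ρ₁_pos]))
  exact absurd (h2.trans_le (min_le_left _ _)) (lt_irrefl _)

theorem param_zero : M.param 0 = 0 := by
  rw [M.param_eq, M.φ_zero]; simp

theorem norm_realCoords_le (t : CSpace m d) : ‖realCoords t‖ ≤ ‖t‖ := by
  rw [← realCoordsL_apply]
  have h1 : ∀ {n : ℕ} (v : Fin n → ℂ), ‖reL n v‖ ≤ ‖v‖ := fun v =>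
    (pi_norm_le_iff_of_nonneg (norm_nonneg _)).2 fun i =>
      (Complex.abs_re_le_norm _).trans (norm_le_pi_norm v i)
  have h2 : ∀ {n : ℕ} (v : Fin n → ℂ), ‖imL n v‖ ≤ ‖v‖ := fun v =>
    (pi_norm_le_iff_of_nonneg (norm_nonneg _)).2 fun i =>
      (Complex.abs_im_le_norm _).trans (norm_le_pi_norm v i)
  exact max_le ((h1 _).trans (norm_fst_le t)) (max_le ((h2 _).trans (norm_fst_le t))
    ((h1 _).trans (norm_snd_le t)))

theorem zero_mem_paramDomain : (0 : RSpace m d) ∈ M.paramDomain := by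
  refine ⟨Metric.mem_ball_self (by linarith [M.ρ₁_pos]), ?_⟩
  rw [M.param_zero]
  exact Metric.mem_ball_self M.ρ₁_pos

theorem realCoords_mem_paramDomain {t : CSpace m d} (ht : t ∈ M.carrier) :
    realCoords t ∈ M.paramDomain := by
  refine ⟨?_, by rw [M.param_realCoords ht.2]; exact ht.1⟩
  have := mem_ball_zero_iff.1 ht.1
  rw [mem_ball_zero_iff]
  linarith [norm_realCoords_le t, M.ρ₁_pos]

theorem param_mem_carrier {s : RSpace m d} (hs : s ∈ M.paramDomain) : M.param s ∈ M.carrier := by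
  refine ⟨hs.2, fun j => ?_⟩
  rw [M.realCoords_param, M.param_eq]
  simp

theorem param_analyticAt {s : RSpace m d} (hs : s ∈ Metric.ball 0 (2 * M.ρ₁)) :
    AnalyticAt ℝ M.param s := by
  have h1 : AnalyticAt ℝ (fun s : RSpace m d => s.2.2) s := analyticAt_snd.comp analyticAt_snd
  exact ((zL m d).analyticAt s).prod ((((ofRealL d).analyticAt _).comp h1).add
    (((Complex.I • ofRealL d : (Fin d → ℝ) →L[ℝ] (Fin d → ℂ)).analyticAt _).comp
      (M.φ_analytic s hs)))

theorem isOpen_paramDomain : IsOpen M.paramDomain := by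
  rw [isOpen_iff_mem_nhds]
  intro s hs
  filter_upwards [Metric.isOpen_ball.mem_nhds hs.1,
    (M.param_analyticAt hs.1).continuousAt.eventually (Metric.isOpen_ball.mem_nhds hs.2)]
    with x h1 h2
  exact ⟨h1, h2⟩

/-- The derivative of the graph parametrization. -/
def dparam (s : RSpace m d) : RSpace m d →L[ℝ] CSpace m d :=
  (zL m d).prod ((ofRealL d).comp (uL m d) +
      (Complex.I • ofRealL d).comp (fderiv ℝ M.φ s))

theorem dparam_apply (s V : RSpace m d) :
    M.dparam s V = (zL m d V, ofRealL d V.2.2 + Complex.I • ofRealL d (fderiv ℝ M.φ s V)) := rfl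

theorem hasFDerivAt_param {s : RSpace m d} (hs : s ∈ Metric.ball 0 (2 * M.ρ₁)) :
    HasFDerivAt M.param (M.dparam s) s := by
  refine HasFDerivAt.prodMk (zL m d).hasFDerivAt (HasFDerivAt.add ?_ ?_)
  · exact ((ofRealL d).comp (uL m d)).hasFDerivAt
  · exact (Complex.I • ofRealL d : (Fin d → ℝ) →L[ℝ] (Fin d → ℂ)).hasFDerivAt.comp s
      (M.φ_analytic s hs).differentiableAt.hasFDerivAt

theorem reL_dparam_snd (s V : RSpace m d) : reL d (M.dparam s V).2 = V.2.2 := by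
  rw [M.dparam_apply]; ext j; simp

theorem conj_snd_eq {t : CSpace m d} (ht : t ∈ M.carrier) : conjL d t.2 = M.Θ (jetL m d t) :=
  funext fun j => ((M.graph_iff t ht.1).1 ht.2) j

theorem jetL_mem_ball {t : CSpace m d} (ht : t ∈ Metric.ball 0 M.ρ₁) :
    jetL m d t ∈ Metric.ball 0 (2 * M.ρ₁) := by
  rw [mem_ball_zero_iff] at ht ⊢
  rw [norm_jetL]; linarith [M.ρ₁_pos]

/-- The complex derivative of `Θ` at the point `(conj z, z, w)`. -/
def dΘ (t : CSpace m d) : TSpace m d →L[ℂ] (Fin d → ℂ) := fderiv ℂ M.Θ (jetL m d t)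

theorem hasFDerivAt_Θ {t : CSpace m d} (ht : t ∈ Metric.ball 0 M.ρ₁) :
    HasFDerivAt M.Θ (M.dΘ t) (jetL m d t) :=
  (M.Θ_analytic _ (M.jetL_mem_ball ht)).differentiableAt.hasFDerivAt

/-- Vectors tangent to `M` satisfy the differentiated complex defining equation. -/
theorem conj_snd_of_tangent {S : Set (CSpace m d)} (hS : S ⊆ M.carrier) {q v : CSpace m d}
    (hq : q ∈ S) (hv : v ∈ tangentVectors S q) :
    conjL d v.2 = M.dΘ q (jetL m d v) := by
  obtain ⟨γ, h0, hd, hγ⟩ := hv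
  have h1 : HasDerivAt (fun s => conjL d (γ s).2) (conjL d v.2) 0 :=
    ((conjL d).comp
      (ContinuousLinearMap.snd ℝ (Fin m → ℂ) (Fin d → ℂ))).hasFDerivAt.comp_hasDerivAt (0 : ℝ) hd
  have h2 : HasDerivAt (fun s => jetL m d (γ s)) (jetL m d v) 0 :=
    (jetL m d).hasFDerivAt.comp_hasDerivAt (0 : ℝ) hd
  have h3 : HasFDerivAt M.Θ ((M.dΘ q).restrictScalars ℝ) (jetL m d (γ 0)) := by
    rw [h0]; exact (M.hasFDerivAt_Θ (hS hq).1).restrictScalars ℝ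
  have h4 := (h3.comp_hasDerivAt (0 : ℝ) h2).congr_of_eventuallyEq
    (f₁ := fun s => conjL d (γ s).2) (hγ.mono fun s hs => M.conj_snd_eq (hS hs))
  exact h1.unique h4

theorem dparam_mem_tangentVectors {O : Set (RSpace m d)} (hO : IsOpen O)
    (hOM : O ⊆ M.paramDomain) {S : Set (CSpace m d)} (hS : Set.MapsTo M.param O S)
    {s : RSpace m d} (hs : s ∈ O) (V : RSpace m d) :
    M.dparam s V ∈ tangentVectors S (M.param s) :=
  range_subset_tangentVectors (M.hasFDerivAt_param (hOM hs).1)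
    (by filter_upwards [hO.mem_nhds hs] with x hx using hS hx) V

theorem conj_dparam {s : RSpace m d} (hs : s ∈ M.paramDomain) (V : RSpace m d) :
    conjL d (M.dparam s V).2 = M.dΘ (M.param s) (jetL m d (M.dparam s V)) :=
  M.conj_snd_of_tangent subset_rfl (M.param_mem_carrier hs)
    (M.dparam_mem_tangentVectors M.isOpen_paramDomain subset_rfl
      (fun _ h => M.param_mem_carrier h) hs V)

/-- The partial derivative of `Θ` in `ζ`. -/
def Θζ (t : CSpace m d) : (Fin m → ℂ) →L[ℂ] (Fin d → ℂ) :=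
  (M.dΘ t).comp (ContinuousLinearMap.inl ℂ _ _)

/-- The partial derivative of `Θ` in `w`. -/
def Θw (t : CSpace m d) : (Fin d → ℂ) →L[ℂ] (Fin d → ℂ) :=
  (M.dΘ t).comp ((ContinuousLinearMap.inr ℂ (Fin m → ℂ) _).comp
    (ContinuousLinearMap.inr ℂ (Fin m → ℂ) _))

/-- The partial derivative of `Θ` in `z`. -/
def Θz (t : CSpace m d) : (Fin m → ℂ) →L[ℂ] (Fin d → ℂ) :=
  (M.dΘ t).comp ((ContinuousLinearMap.inr ℂ (Fin m → ℂ) _).comp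
    (ContinuousLinearMap.inl ℂ _ (Fin d → ℂ)))

theorem dΘ_apply (t : CSpace m d) (a b : Fin m → ℂ) (e : Fin d → ℂ) :
    M.dΘ t (a, b, e) = M.Θζ t a + M.Θz t b + M.Θw t e := by
  have : ((a, b, e) : TSpace m d) = (a, 0, 0) + (0, b, 0) + (0, 0, e) := by simp
  rw [this, map_add, map_add]; rfl

/-- The complexified real derivative of `u ↦ w` along the graph. -/
def dw (s : RSpace m d) (η : Fin d → ℂ) : Fin d → ℂ :=
  (M.dparam s (0, 0, reL d η)).2 + Complex.I • (M.dparam s (0, 0, imL d η)).2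

theorem Θw_dw {s : RSpace m d} (hs : s ∈ M.paramDomain) (η : Fin d → ℂ) :
    M.Θw (M.param s) (M.dw s η) = conjL d (M.dw s (conjL d η)) := by
  have h : ∀ e : Fin d → ℝ, M.Θw (M.param s) (M.dparam s (0, 0, e)).2
      = conjL d (M.dparam s (0, 0, e)).2 := by
    intro e
    rw [M.conj_dparam hs]
    have h1 : (M.dparam s (0, 0, e)).1 = 0 := by
      rw [M.dparam_apply, zL_apply]; simp
    rw [jetL_apply, M.dΘ_apply, h1]
    simp
  have e1 : reL d (conjL d η) = reL d η := by ext i; simp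
  have e2 : imL d (conjL d η) = -imL d η := by ext i; simp
  have e3 : M.dparam s (0, 0, -imL d η) = -M.dparam s (0, 0, imL d η) := by
    have : ((0, 0, -imL d η) : RSpace m d) = -(0, 0, imL d η) := by simp
    rw [this, map_neg]
  rw [dw, dw, e1, e2, e3, map_add, map_smul, h, h, map_add, conjL_I_smul]
  simp

theorem dw_add_Θw {s : RSpace m d} (hs : s ∈ M.paramDomain) (η : Fin d → ℂ) :
    M.dw s η + M.Θw (M.param s) (M.dw s η) = (2 : ℂ) • η := by
  rw [M.Θw_dw hs]
  have e1 : reL d (conjL d η) = reL d η := by ext i; simp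
  have e2 : imL d (conjL d η) = -imL d η := by ext i; simp
  have e3 : M.dparam s (0, 0, -imL d η) = -M.dparam s (0, 0, imL d η) := by
    have : ((0, 0, -imL d η) : RSpace m d) = -(0, 0, imL d η) := by simp
    rw [this, map_neg]
  have h : ∀ e : Fin d → ℝ, (M.dparam s (0, 0, e)).2 + conjL d (M.dparam s (0, 0, e)).2
      = (2 : ℂ) • ofRealL d e := by
    intro e
    rw [add_conjL, M.reL_dparam_snd]
  rw [dw, dw, e1, e2, e3, map_add, conjL_I_smul]
  calc _ = ((M.dparam s (0, 0, reL d η)).2 + conjL d (M.dparam s (0, 0, reL d η)).2)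
        + Complex.I • ((M.dparam s (0, 0, imL d η)).2
          + conjL d (M.dparam s (0, 0, imL d η)).2) := by
        simp only [Prod.snd_neg, map_neg, smul_neg, neg_neg, smul_add]; abel
    _ = (2 : ℂ) • (ofRealL d (reL d η) + Complex.I • ofRealL d (imL d η)) := by
        rw [h, h, smul_add, smul_comm]
    _ = _ := by rw [ofRealL_reL_add]

/-- `1 + ∂Θ/∂w` is invertible at the points of `M`: this is the genericity of `M`. -/
theorem eq_zero_of_add_Θw {s : RSpace m d} (hs : s ∈ M.paramDomain) {δ : Fin d → ℂ}
    (h : δ + M.Θw (M.param s) δ = 0) : δ = 0 := by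
  let T : (Fin d → ℂ) →ₗ[ℂ] (Fin d → ℂ) := LinearMap.id + (M.Θw (M.param s)).toLinearMap
  have hT : ∀ x, T x = x + M.Θw (M.param s) x := fun _ => rfl
  have hsurj : Function.Surjective T := by
    intro η
    refine ⟨M.dw s ((2 : ℂ)⁻¹ • η), ?_⟩
    rw [hT, M.dw_add_Θw hs, smul_smul]
    simp
  have hinj := LinearMap.injective_iff_surjective.2 hsurj
  exact hinj (by rw [hT, h, map_zero])

/-- `∂Θ/∂w` is invertible at the points of `M`. -/
theorem Θw_surjective {s : RSpace m d} (hs : s ∈ M.paramDomain) :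
    Function.Surjective (M.Θw (M.param s)) := by
  let W : (Fin d → ℂ) →ₗ[ℂ] (Fin d → ℂ) :=
    { toFun := M.dw s
      map_add' := by
        intro a b
        have : ∀ a b : Fin d → ℝ, M.dparam s (0, 0, a + b)
            = M.dparam s (0, 0, a) + M.dparam s (0, 0, b) := by
          intro a b; rw [← map_add]; simp
        simp only [dw, map_add, this, Prod.snd_add, smul_add]
        abel
      map_smul' := by
        intro c a
        have h1 : ∀ (r : ℝ) (a : Fin d → ℝ), (M.dparam s (0, 0, r • a)).2
            = (r : ℂ) • (M.dparam s (0, 0, a)).2 := by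
          intro r a
          have : ((0, 0, r • a) : RSpace m d) = r • (0, 0, a) := by simp
          rw [this, map_smul, Prod.smul_snd]
          ext j; simp
        have h2 : ∀ a b : Fin d → ℝ, (M.dparam s (0, 0, a + b)).2
            = (M.dparam s (0, 0, a)).2 + (M.dparam s (0, 0, b)).2 := by
          intro a b; rw [← Prod.snd_add, ← map_add]; simp
        have e1 : reL d (c • a) = c.re • reL d a + (-c.im) • imL d a := by
          ext i; simp; ring
        have e2 : imL d (c • a) = c.re • imL d a + c.im • reL d a := by
          ext i; simp
        simp only [dw, e1, e2, h2, h1, RingHom.id_apply]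
        ext j
        simp only [Pi.add_apply, Pi.smul_apply, smul_eq_mul, Complex.ofReal_neg]
        conv_rhs => rw [← Complex.re_add_im c]
        ring_nf
        simp only [Complex.I_sq]
        ring }
  have hW : Function.Injective W := by
    intro a b hab
    have h1 := M.dw_add_Θw hs a
    have h2 := M.dw_add_Θw hs b
    have h3 : M.dw s a = M.dw s b := hab
    rw [h3, h2] at h1
    exact (smul_right_injective _ (two_ne_zero' ℂ) h1).symm
  have hW' := LinearMap.injective_iff_surjective.1 hW
  intro η
  obtain ⟨ξ, hξ⟩ := hW' (conjL d η)
  refine ⟨M.dw s (conjL d ξ), ?_⟩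
  rw [M.Θw_dw hs, conjL_conjL]
  change conjL d (W ξ) = η
  rw [hξ, conjL_conjL]

/-- The `w`-component of the complex tangent vector over `c`: the complex tangent space of `M` is
`{(c, conj (Θ_ζ (conj c)))}`. -/
def Bc (t : CSpace m d) (c : Fin m → ℂ) : Fin d → ℂ := conjL d (M.Θζ t (conjL m c))

theorem Bc_I_smul (t : CSpace m d) (c : Fin m → ℂ) :
    M.Bc t (Complex.I • c) = Complex.I • M.Bc t c := by
  simp [Bc]

/-- The family `c ↦ X(c)` of vector fields which spans the complex tangent spaces, in the
coordinates `(x, y, u)`. -/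
def X (s : RSpace m d) : (Fin m → ℂ) →L[ℝ] RSpace m d :=
  (reL m).prod ((imL m).prod
    ((reL d).comp (((M.Θζ (M.param s)).restrictScalars ℝ).comp (conjL m))))

theorem X_apply (s : RSpace m d) (c : Fin m → ℂ) :
    M.X s c = (reL m c, imL m c, reL d (M.Θζ (M.param s) (conjL m c))) := rfl

/-- The vector fields `X(c)` correspond to the complex tangent vectors of `M`. The difference of
the two sides is purely imaginary, and depends `ℂ`-linearly on `c`. -/
theorem dparam_X {s : RSpace m d} (hs : s ∈ M.paramDomain) (c : Fin m → ℂ) :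
    M.dparam s (M.X s c) = (c, M.Bc (M.param s) c) := by
  set t := M.param s with ht
  have hfst : ∀ c, (M.dparam s (M.X s c)).1 = c := fun c => by
    rw [M.dparam_apply, M.X_apply]; exact zL_reL_imL _ _
  let δ : (Fin m → ℂ) → (Fin d → ℂ) := fun c => (M.dparam s (M.X s c)).2 - M.Bc t c
  have hδre : ∀ c j, (δ c j).re = 0 := by
    intro c j
    have h1 := congrFun (M.reL_dparam_snd s (M.X s c)) j
    rw [reL_apply] at h1
    have h2 : (M.Bc t c j).re = (M.X s c).2.2 j := by
      rw [M.X_apply, Bc]; simp [ht]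
    simp only [δ, Pi.sub_apply, Complex.sub_re, h1, h2, sub_self]
  have hδ : ∀ c, δ c + M.Θw t (δ c) = -(M.Θz t c + M.Θw t (M.Bc t c)) := by
    intro c
    have h1 := M.conj_dparam hs (M.X s c)
    rw [jetL_apply, M.dΘ_apply, hfst] at h1
    have h2 : M.Θζ t (conjL m c) = conjL d (M.Bc t c) := by rw [Bc, conjL_conjL]
    have h3 : conjL d (δ c) = - δ c := by
      ext j
      apply Complex.ext
      · simp [hδre]
      · simp
    have h4 : (M.dparam s (M.X s c)).2 = δ c + M.Bc t c := by simp [δ]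
    rw [← ht, h4, h2, map_add, map_add, h3] at h1
    have h5 : -δ c = M.Θz t c + (M.Θw t (δ c) + M.Θw t (M.Bc t c)) := by
      have := congrArg (fun x => x - conjL d (M.Bc t c)) h1
      simp only [add_sub_cancel_right] at this
      rw [this]; abel
    have h6 : δ c = -(M.Θz t c + (M.Θw t (δ c) + M.Θw t (M.Bc t c))) := by
      rw [← h5, neg_neg]
    nth_rewrite 1 [h6]
    abel
  have hδI : δ (Complex.I • c) = Complex.I • δ c := by
    rw [← sub_eq_zero]
    apply M.eq_zero_of_add_Θw hs
    rw [← ht, map_sub, map_smul]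
    have h1 := hδ (Complex.I • c)
    have h2 := congrArg (fun x => Complex.I • x) (hδ c)
    simp only [smul_add, smul_neg] at h2
    rw [M.Bc_I_smul, map_smul, map_smul, ← smul_add] at h1
    rw [← smul_add, ← smul_add] at h2
    rw [sub_add_sub_comm, h1, ← smul_add, h2, sub_self]
  have hδ0 : δ c = 0 := by
    ext j
    have h1 := congrArg Complex.re (congrFun hδI j)
    rw [hδre] at h1
    apply Complex.ext
    · simpa using hδre c j
    · simpa using h1.symm
  refine Prod.ext (hfst c) ?_
  exact sub_eq_zero.1 hδ0

/-- Complex tangent vectors of a subset of `M` are of the form `(c, conj (Θ_ζ (conj c)))`. -/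
theorem snd_of_complexTangent {S : Set (CSpace m d)} (hS : S ⊆ M.carrier) {q v : CSpace m d}
    (hq : q ∈ S) (hv : v ∈ complexTangentVectors S q) : v.2 = M.Bc q v.1 := by
  have h1 := M.conj_snd_of_tangent hS hq hv.1
  have h2 := M.conj_snd_of_tangent hS hq hv.2
  rw [jetL_apply, M.dΘ_apply] at h1 h2
  simp only [Prod.smul_fst, Prod.smul_snd, conjL_I_smul, map_neg, map_smul] at h2
  have h3 : conjL d v.2 = M.Θζ q (conjL m v.1) := by
    ext j
    have e1 := congrFun h1 j
    have e2 := congrFun h2 j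
    simp only [Pi.add_apply, Pi.neg_apply, Pi.smul_apply, smul_eq_mul] at e1 e2 ⊢
    have hI : Complex.I * Complex.I = -1 := Complex.I_mul_I
    have e3 : Complex.I * _ = Complex.I * _ := congrArg (fun x => Complex.I * x) e2
    linear_combination (1 / 2) * e1 + (1 / 2) * e3 + (1 / 2) *
      (conjL d v.2 j - M.Θζ q (conjL m v.1) j + M.Θz q v.1 j + M.Θw q v.2 j) * hI
  rw [Bc, ← h3, conjL_conjL]

theorem mem_complexTangentVectors {O : Set (RSpace m d)} (hO : IsOpen O)
    (hOM : O ⊆ M.paramDomain) {S : Set (CSpace m d)} (hS : Set.MapsTo M.param O S)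
    {s : RSpace m d} (hs : s ∈ O) (c : Fin m → ℂ) :
    (c, M.Bc (M.param s) c) ∈ complexTangentVectors S (M.param s) := by
  refine ⟨?_, ?_⟩
  · rw [← M.dparam_X (hOM hs)]
    exact M.dparam_mem_tangentVectors hO hOM hS hs _
  · have : Complex.I • (c, M.Bc (M.param s) c)
        = (Complex.I • c, M.Bc (M.param s) (Complex.I • c)) := by
      rw [M.Bc_I_smul]; rfl
    rw [this, ← M.dparam_X (hOM hs)]
    exact M.dparam_mem_tangentVectors hO hOM hS hs _

theorem dΘ_param_analyticAt {s : RSpace m d} (hs : s ∈ M.paramDomain) :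
    AnalyticAt ℝ (fun s => (M.dΘ (M.param s)).restrictScalars ℝ) s := by
  have h1 : AnalyticAt ℂ (fderiv ℂ M.Θ) (jetL m d (M.param s)) :=
    (M.Θ_analytic _ (M.jetL_mem_ball hs.2)).fderiv
  have h2 : AnalyticAt ℝ (fun s => jetL m d (M.param s)) s :=
    ((jetL m d).analyticAt _).comp (M.param_analyticAt hs.1)
  have h3 : AnalyticAt ℝ (fun s => M.dΘ (M.param s)) s :=
    AnalyticAt.comp (g := fderiv ℂ M.Θ) (f := fun s => jetL m d (M.param s))
      h1.restrictScalars h2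
  exact ((ContinuousLinearMap.restrictScalarsL ℂ (TSpace m d) (Fin d → ℂ) ℝ ℝ).analyticAt _).comp
    h3

theorem X_analyticAt {s : RSpace m d} (hs : s ∈ M.paramDomain) : AnalyticAt ℝ M.X s := by
  let pre : (Fin m → ℂ) →L[ℝ] TSpace m d := (ContinuousLinearMap.inl ℝ _ _).comp (conjL m)
  let post : (Fin d → ℂ) →L[ℝ] RSpace m d :=
    ((ContinuousLinearMap.inr ℝ (Fin m → ℝ) _).comp
      (ContinuousLinearMap.inr ℝ (Fin m → ℝ) _)).comp (reL d)
  let C : (Fin m → ℂ) →L[ℝ] RSpace m d := (reL m).prod ((imL m).prod 0)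
  have hX : M.X = fun s => C + post.comp (((M.dΘ (M.param s)).restrictScalars ℝ).comp pre) := by
    funext s
    refine ContinuousLinearMap.ext fun c => ?_
    change _ = (reL m c, imL m c, 0)
      + ((0, 0, reL d (M.dΘ (M.param s) (conjL m c, 0))) : RSpace m d)
    rw [M.X_apply]
    simp [Θζ]
  rw [hX]
  refine analyticAt_const.add ?_
  have h1 := M.dΘ_param_analyticAt hs
  have h2 := (((ContinuousLinearMap.compL ℝ (Fin m → ℂ) (TSpace m d) (Fin d → ℂ)).flip
    pre).analyticAt _).comp h1
  exact ((ContinuousLinearMap.compL ℝ (Fin m → ℂ) (Fin d → ℂ) (RSpace m d) post).analyticAt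
    _).comp h2

end LocalGeneric

/-! ### Existence of orbit pieces -/

namespace LocalGeneric

variable {m d : ℕ} (M : LocalGeneric m d)

theorem realCoordsL_dparam (s V : RSpace m d) : realCoordsL m d (M.dparam s V) = V :=
  Prod.ext (reL_zL V) (Prod.ext (imL_zL V) (M.reL_dparam_snd s V))

theorem Bc_continuousAt {s : RSpace m d} (hs : s ∈ M.paramDomain) (c : Fin m → ℂ) :
    ContinuousAt (fun s => (c, M.Bc (M.param s) c)) s := by
  have h1 : ContinuousAt (fun s => (M.dΘ (M.param s)).restrictScalars ℝ (conjL m c, 0)) s :=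
    (M.dΘ_param_analyticAt hs).continuousAt.clm_apply continuousAt_const
  exact continuousAt_const.prodMk ((conjL d).continuous.continuousAt.comp h1)

/-- Integral curves of the fields `X(c)` are curves in `M` with complex tangent velocity. -/
theorem crJoined_of_curveJoined {O : Set (RSpace m d)} (hO : IsOpen O) (hOM : O ⊆ M.paramDomain)
    {S : Set (CSpace m d)} (hS : Set.MapsTo M.param O S) {a b : RSpace m d}
    (h : CurveJoined M.X O a b) : CRJoined S (M.param a) (M.param b) := by
  obtain ⟨c, β, h0, h1, hβ⟩ := h
  refine ⟨fun s => M.param (β s), fun s => (c, M.Bc (M.param (β s)) c), by simp [h0],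
    by simp [h1], ?_, ?_⟩
  · intro s hs
    exact (M.Bc_continuousAt (hOM (hβ s hs).1) c).comp_continuousWithinAt
      (hβ s hs).2.continuousWithinAt
  · intro s hs
    refine ⟨hS (hβ s hs).1, ?_, M.mem_complexTangentVectors hO hOM hS (hβ s hs).1 c⟩
    have := (M.hasFDerivAt_param (hOM (hβ s hs).1).1).comp_hasDerivWithinAt s (hβ s hs).2
    rw [M.dparam_X (hOM (hβ s hs).1)] at this
    exact this

theorem exists_orbitPiece {U : Set (CSpace m d)} (hU : U ∈ 𝓝 0) :
    ∃ (D : ℕ) (N : Set (CSpace m d)), IsCROrbitPiece (M.carrier ∩ U) 0 D N := by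
  obtain ⟨U', hU'U, hU'o, hU'0⟩ := mem_nhds_iff.1 hU
  have hpc : ∀ s ∈ M.paramDomain, ContinuousAt M.param s := fun s hs =>
    (M.param_analyticAt hs.1).continuousAt
  let O : Set (RSpace m d) := M.paramDomain ∩ M.param ⁻¹' U'
  have hO : IsOpen O := by
    have : ContinuousOn M.param M.paramDomain := fun s hs => (hpc s hs).continuousWithinAt
    exact this.isOpen_inter_preimage M.isOpen_paramDomain hU'o
  have hO0 : (0 : RSpace m d) ∈ O := ⟨M.zero_mem_paramDomain, by
    rw [Set.mem_preimage, M.param_zero]; exact hU'0⟩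
  have hOM : O ⊆ M.paramDomain := Set.inter_subset_left
  have hS : Set.MapsTo M.param O (M.carrier ∩ U) := fun s hs =>
    ⟨M.param_mem_carrier hs.1, hU'U hs.2⟩
  obtain ⟨D, γ, hγa, hγ0, hγi, hγr, hγX⟩ :=
    exists_orbit_disc (M.X_analyticAt M.zero_mem_paramDomain) (hO.mem_nhds hO0)
  have hγO : ∀ᶠ t in 𝓝 0, γ t ∈ O := by
    refine hγa.continuousAt.eventually_mem ?_
    rw [hγ0]; exact hO.mem_nhds hO0
  let Γ : (Fin D → ℝ) → CSpace m d := fun t => M.param (γ t)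
  have hΓa : ∀ t, AnalyticAt ℝ γ t → γ t ∈ O → AnalyticAt ℝ Γ t := fun t ht htO =>
    (M.param_analyticAt (hOM htO).1).comp ht
  have hΓd : ∀ t, AnalyticAt ℝ γ t → γ t ∈ O →
      HasFDerivAt Γ ((M.dparam (γ t)).comp (fderiv ℝ γ t)) t := fun t ht htO =>
    (M.hasFDerivAt_param (hOM htO).1).comp t ht.differentiableAt.hasFDerivAt
  have hΓi : ∀ t, AnalyticAt ℝ γ t → γ t ∈ O → Function.Injective (fderiv ℝ γ t) →
      Function.Injective (fderiv ℝ Γ t) := by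
    intro t ht htO hi a b hab
    rw [(hΓd t ht htO).fderiv] at hab
    have := congrArg (realCoordsL m d) hab
    simp only [ContinuousLinearMap.comp_apply, M.realCoordsL_dparam] at this
    exact hi this
  have hγ0O : γ 0 ∈ O := hγO.self_of_nhds
  obtain ⟨A, e, he0, he, -⟩ := exists_retraction (hΓa 0 hγa hγ0O) (hΓi 0 hγa hγ0O hγi)
  have hinj : ∀ᶠ t in 𝓝 0, Function.Injective (fderiv ℝ γ t) :=
    hγa.fderiv.continuousAt.eventually (ContinuousLinearMap.isOpen_injective.mem_nhds hγi)
  obtain ⟨B, hB, hBo, hB0⟩ := mem_nhds_iff.1 ((((hγO.and hγa.eventually_analyticAt).and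
    (hγr.and hγX)).and hinj).and (e.open_source.mem_nhds he0))
  have hmap : ∀ t ∈ B, Filter.map Γ (𝓝 t) = 𝓝[Γ '' B] (Γ t) := fun t ht =>
    map_nhds_of_retraction he hBo (fun x hx => (hB hx).2) ht
      (hΓa t (hB ht).1.1.1.2 (hB ht).1.1.1.1).continuousAt
  refine ⟨D, Γ '' B, ⟨0, hB0, ?_⟩, ?_, ?_, ?_⟩
  · simp only [Γ, hγ0, M.param_zero]
  · rintro _ ⟨t, ht, rfl⟩
    obtain ⟨⟨⟨⟨htO, hta⟩, -⟩, hti⟩, -⟩ := hB ht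
    have hshift : Tendsto (fun x : Fin D → ℝ => t + x) (𝓝 0) (𝓝 (t + 0)) :=
      (continuous_const.add continuous_id).tendsto 0
    have hd : HasFDerivAt (fun x => Γ (t + x)) (fderiv ℝ Γ t) 0 := by
      have h1 : HasFDerivAt Γ (fderiv ℝ Γ t) (t + 0) := by
        rw [add_zero]; exact (hΓa t hta htO).differentiableAt.hasFDerivAt
      exact (h1.comp (0 : Fin D → ℝ) ((hasFDerivAt_id (0 : Fin D → ℝ)).const_add t)).congr_fderiv
        (ContinuousLinearMap.ext fun v => rfl)
    refine ⟨fun x => Γ (t + x), ?_, by simp, ?_, ?_⟩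
    · refine AnalyticAt.comp (g := Γ) (f := fun x => t + x) ?_ (analyticAt_const.add analyticAt_id)
      rw [add_zero]; exact hΓa t hta htO
    · rw [hd.fderiv]; exact hΓi t hta htO hti
    · rw [← hmap t ht]
      have : Filter.map (fun x => t + x) (𝓝 (0 : Fin D → ℝ)) = 𝓝 t := by
        rw [map_add_left_nhds_zero]
      rw [← this, Filter.map_map]
      rfl
  · rintro _ ⟨t, ht, rfl⟩
    have h1 : Reach M.X O 0 (γ t) := (hB ht).1.1.2.1
    have h2 : Relation.ReflTransGen (CRJoined (M.carrier ∩ U)) (M.param 0) (M.param (γ t)) :=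
      Relation.ReflTransGen.lift M.param
        (fun a b h => M.crJoined_of_curveJoined hO hOM hS h) _ _ h1
    rwa [M.param_zero] at h2
  · rintro _ ⟨t, ht, rfl⟩ v hv
    obtain ⟨⟨⟨⟨htO, hta⟩, -, hX⟩, -⟩, -⟩ := hB ht
    have h1 := M.snd_of_complexTangent (Set.inter_subset_left) (hS htO) hv
    obtain ⟨w, hw⟩ := hX v.1
    have h2 : v = M.dparam (γ t) (fderiv ℝ γ t w) := by
      have : fderiv ℝ γ t w = M.X (γ t) v.1 := hw
      rw [this, M.dparam_X (hOM htO)]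
      exact Prod.ext rfl h1
    rw [h2]
    refine range_subset_tangentVectors (hΓd t hta htO) ?_ w
    filter_upwards [hBo.mem_nhds ht] with x hx using ⟨x, hx, rfl⟩

theorem crOrbit_subset {S : Set (CSpace m d)} (h0 : (0 : CSpace m d) ∈ S) :
    CROrbit S 0 ⊆ S := by
  intro q hq
  induction hq with
  | refl => exact h0
  | tail _ h _ =>
    obtain ⟨γ, γ', -, h1, -, h⟩ := h
    rw [← h1]; exact (h 1 (by simp)).1

theorem zero_mem_carrier : (0 : CSpace m d) ∈ M.carrier := by
  have := M.param_mem_carrier M.zero_mem_paramDomain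
  rwa [M.param_zero] at this

theorem map_param_nhds : Filter.map M.param (𝓝 0) = 𝓝[M.carrier] 0 := by
  have h0 := M.zero_mem_paramDomain
  apply le_antisymm
  · refine tendsto_nhdsWithin_iff.2 ⟨?_, ?_⟩
    · have := (M.param_analyticAt h0.1).continuousAt.tendsto
      rwa [M.param_zero] at this
    · filter_upwards [M.isOpen_paramDomain.mem_nhds h0] with s hs using M.param_mem_carrier hs
  · intro S hS
    have h1 : Tendsto (realCoordsL m d) (𝓝 0) (𝓝 0) := by
      have := (realCoordsL m d).continuous.tendsto 0
      rwa [map_zero] at this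
    rw [mem_nhdsWithin_iff_eventually]
    filter_upwards [h1 hS] with y hy hyM
    have := M.param_realCoords hyM.2
    rw [← this]; exact hy

/-- A submanifold of `M` of full dimension is a neighbourhood in `M`. -/
theorem mem_nhdsWithin_of_dim {D : ℕ} {N : Set (CSpace m d)} (hN : IsAnalyticSubmanifold D N)
    (h0 : (0 : CSpace m d) ∈ N) (hNM : N ⊆ M.carrier) (hD : D = 2 * m + d) :
    N ∈ 𝓝[M.carrier] 0 := by
  obtain ⟨γ, hγa, hγ0, hγi, hγm⟩ := hN 0 h0
  have hd := hγa.differentiableAt.hasFDerivAt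
  have hmem : ∀ᶠ t in 𝓝 0, γ t ∈ N := by
    have : ∀ᶠ y in 𝓝[N] (0 : CSpace m d), y ∈ N := eventually_mem_nhdsWithin
    rw [← hγm] at this
    exact this
  let ψ : (Fin D → ℝ) → RSpace m d := fun t => realCoordsL m d (γ t)
  have hψ0 : ψ 0 = 0 := by simp [ψ, hγ0]
  have hψa : AnalyticAt ℝ ψ 0 := ((realCoordsL m d).analyticAt _).comp hγa
  have hψd : HasFDerivAt ψ ((realCoordsL m d).comp (fderiv ℝ γ 0)) 0 :=
    (realCoordsL m d).hasFDerivAt.comp 0 hd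
  have hγψ : (fun t => M.param (ψ t)) =ᶠ[𝓝 0] γ :=
    hmem.mono fun t ht => M.param_realCoords (hNM ht).2
  have hψi : Function.Injective ((realCoordsL m d).comp (fderiv ℝ γ 0)) := by
    have h1 : HasFDerivAt M.param (M.dparam 0) (ψ 0) := by
      rw [hψ0]; exact M.hasFDerivAt_param M.zero_mem_paramDomain.1
    have h2 := (h1.comp 0 hψd).congr_of_eventuallyEq hγψ.symm
    have h3 := h2.unique hd
    intro a b hab
    apply hγi
    rw [← h3]
    exact congrArg (M.dparam 0) hab
  have hdim : Module.finrank ℝ (Fin D → ℝ) = Module.finrank ℝ (RSpace m d) := by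
    simp [hD]; ring
  let i : (Fin D → ℝ) ≃L[ℝ] RSpace m d := (LinearEquiv.ofInjectiveOfFinrankEq
    ((realCoordsL m d).comp (fderiv ℝ γ 0)).toLinearMap hψi hdim).toContinuousLinearEquiv
  have hi : HasFDerivAt ψ (i : (Fin D → ℝ) →L[ℝ] RSpace m d) 0 :=
    hψd.congr_fderiv (ContinuousLinearMap.ext fun v => rfl)
  have hs : HasStrictFDerivAt ψ (i : (Fin D → ℝ) →L[ℝ] RSpace m d) 0 := by
    rw [← hi.fderiv]; exact hψa.hasStrictFDerivAt
  have hmap := hs.map_nhds_eq_of_equiv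
  rw [hψ0] at hmap
  rw [← M.map_param_nhds, ← hmap, Filter.map_map]
  have h4 : N ∈ Filter.map γ (𝓝 0) := hmem
  rw [← Filter.map_congr hγψ] at h4
  exact h4

end LocalGeneric

/-! ### Complexification of real analytic maps -/

/-- A real analytic germ extends holomorphically to a complexification `E'` of its domain `E`.
The coordinates `ℓ i` of `E'` restrict to the coordinates `r i` of `E` with respect to a basis
`b`. The extension is obtained by expanding the power series in these coordinates. -/
theorem exists_holomorphic_extension {ι E E' F : Type*} [Fintype ι]
    [NormedAddCommGroup E] [NormedSpace ℝ E] [NormedAddCommGroup E'] [NormedSpace ℂ E']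
    [NormedAddCommGroup F] [NormedSpace ℂ F] [CompleteSpace F]
    (b : ι → E) (ℓ : ι → E' →L[ℂ] ℂ) (j : E → E') (r : ι → E → ℝ)
    (hb : ∀ x, ∑ i, r i x • b i = x) (hℓ : ∀ i x, ℓ i (j x) = r i x)
    (hj : Tendsto j (𝓝 0) (𝓝 0)) {f : E → F} (hf : AnalyticAt ℝ f 0) :
    ∃ g : E' → F, AnalyticAt ℂ g 0 ∧ ∀ᶠ x in 𝓝 0, g (j x) = f x := by
  obtain ⟨p, R, hp⟩ := hf
  let q : FormalMultilinearSeries ℂ E' F := fun n => ∑ i : Fin n → ι,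
    ((ContinuousMultilinearMap.mkPiAlgebra ℂ (Fin n) ℂ).compContinuousLinearMap
      (fun k => ℓ (i k))).smulRight (p n fun k => b (i k))
  have hq : ∀ n (v : Fin n → E'), q n v = ∑ i : Fin n → ι,
      (∏ k, ℓ (i k) (v k)) • (p n fun k => b (i k)) := by
    intro n v
    simp [q]
  set K : ℝ := ∑ i, ‖ℓ i‖ * ‖b i‖ with hK
  have hK0 : 0 ≤ K := Finset.sum_nonneg fun i _ => by positivity
  have hnorm : ∀ n, ‖q n‖ ≤ ‖p n‖ * K ^ n := by
    intro n
    refine ContinuousMultilinearMap.opNorm_le_bound (by positivity) fun v => ?_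
    rw [hq]
    refine (norm_sum_le _ _).trans ?_
    rw [hK, Fintype.sum_pow, Finset.mul_sum, Finset.sum_mul]
    refine Finset.sum_le_sum fun i _ => ?_
    rw [norm_smul, norm_prod]
    have h1 : ∏ k, ‖ℓ (i k) (v k)‖ ≤ ∏ k, (‖ℓ (i k)‖ * ‖v k‖) :=
      Finset.prod_le_prod (fun _ _ => norm_nonneg _) fun k _ => (ℓ (i k)).le_opNorm _
    have h2 : ‖p n fun k => b (i k)‖ ≤ ‖p n‖ * ∏ k, ‖b (i k)‖ := (p n).le_opNorm _
    calc _ ≤ (∏ k, (‖ℓ (i k)‖ * ‖v k‖)) * (‖p n‖ * ∏ k, ‖b (i k)‖) :=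
          mul_le_mul h1 h2 (norm_nonneg _) (Finset.prod_nonneg fun _ _ => by positivity)
      _ = _ := by
          simp only [Finset.prod_mul_distrib]; ring
  obtain ⟨ρ, hρ0, hρ⟩ : ∃ ρ : NNReal, 0 < ρ ∧ (ρ : ENNReal) < p.radius := by
    obtain ⟨x, hx0, hx⟩ := ENNReal.lt_iff_exists_nnreal_btwn.1 (hp.r_pos.trans_le hp.r_le)
    exact ⟨x, by exact_mod_cast hx0, hx⟩
  obtain ⟨C, -, hC⟩ := p.norm_mul_pow_le_of_lt_radius hρ
  let σ : NNReal := ρ / (⟨K, hK0⟩ + 1)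
  have hσ0 : 0 < σ := div_pos hρ0 (by positivity)
  have hσ : K * σ ≤ ρ := by
    have h1 : (σ : ℝ) = ρ / (K + 1) := rfl
    rw [h1, mul_div_assoc', div_le_iff₀ (by positivity)]
    nlinarith [ρ.2]
  have hrad : (σ : ENNReal) ≤ q.radius := by
    refine q.le_radius_of_bound C fun n => ?_
    calc ‖q n‖ * (σ : ℝ) ^ n ≤ ‖p n‖ * K ^ n * (σ : ℝ) ^ n := by gcongr; exact hnorm n
      _ = ‖p n‖ * (K * σ) ^ n := by rw [mul_pow, mul_assoc]
      _ ≤ ‖p n‖ * (ρ : ℝ) ^ n := by gcongr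
      _ ≤ C := hC n
  have hpos : 0 < q.radius := lt_of_lt_of_le (by exact_mod_cast hσ0) hrad
  have hg := q.hasFPowerSeriesOnBall hpos
  refine ⟨q.sum, hg.analyticAt, ?_⟩
  filter_upwards [hj (Metric.eball_mem_nhds 0 hpos), Metric.eball_mem_nhds 0 hp.r_pos] with x h1 h2
  have e1 := hg.hasSum h1
  have e2 := hp.hasSum h2
  have e3 : ∀ n, (q n fun _ => j x) = p n fun _ => x := by
    classical
    intro n
    rw [hq]
    conv_rhs => rw [← hb x]
    rw [(p n).map_sum]
    refine Finset.sum_congr rfl fun i _ => ?_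
    rw [(p n).map_smul_univ]
    simp only [hℓ]
    rw [← Complex.ofReal_prod, Complex.coe_smul]
  simp only [e3, zero_add] at e1 e2
  exact e1.unique e2

section TotallyReal

variable {m d : ℕ} {F : Type*} [NormedAddCommGroup F] [NormedSpace ℂ F] [CompleteSpace F]

/-- A real analytic germ on `RSpace m d` extends to a holomorphic germ in the variables
`(ζ, z, u)`, where the real points are those with `ζ = conj z` and `u` real. -/
theorem exists_complexification {f : RSpace m d → F} (hf : AnalyticAt ℝ f 0) :
    ∃ g : TSpace m d → F, AnalyticAt ℂ g 0 ∧ ∀ᶠ s in 𝓝 0, g (totRealL m d s) = f s := by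
  let prζ : Fin m → TSpace m d →L[ℂ] ℂ := fun k =>
    (ContinuousLinearMap.proj k).comp (ContinuousLinearMap.fst ℂ (Fin m → ℂ) (CSpace m d))
  let prz : Fin m → TSpace m d →L[ℂ] ℂ := fun k =>
    (ContinuousLinearMap.proj k).comp ((ContinuousLinearMap.fst ℂ (Fin m → ℂ) (Fin d → ℂ)).comp
      (ContinuousLinearMap.snd ℂ (Fin m → ℂ) (CSpace m d)))
  let pru : Fin d → TSpace m d →L[ℂ] ℂ := fun k =>
    (ContinuousLinearMap.proj k).comp ((ContinuousLinearMap.snd ℂ (Fin m → ℂ) (Fin d → ℂ)).comp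
      (ContinuousLinearMap.snd ℂ (Fin m → ℂ) (CSpace m d)))
  refine exists_holomorphic_extension (ι := Fin m ⊕ Fin m ⊕ Fin d)
    (Sum.elim (fun k => (Pi.single k 1, 0, 0))
      (Sum.elim (fun k => (0, Pi.single k 1, 0)) fun k => (0, 0, Pi.single k 1)))
    (Sum.elim (fun k => (2 : ℂ)⁻¹ • (prz k + prζ k))
      (Sum.elim (fun k => (-(Complex.I / 2)) • (prz k - prζ k)) pru))
    (totRealL m d)
    (Sum.elim (fun k s => s.1 k) (Sum.elim (fun k s => s.2.1 k) fun k s => s.2.2 k))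
    ?_ ?_ ?_ hf
  · intro s
    have h : ∀ {n : ℕ} (v : Fin n → ℝ), ∑ k, v k • (Pi.single k 1 : Fin n → ℝ) = v := by
      intro n v
      ext i
      simp [Finset.sum_apply, Pi.single_apply]
    simp only [Fintype.sum_sum_type, Sum.elim_inl, Sum.elim_inr]
    refine Prod.ext ?_ (Prod.ext ?_ ?_) <;>
      simp [Prod.fst_sum, Prod.snd_sum, h]
  · rintro (k | k | k) s
    · simp [prz, prζ, totRealL_apply, zL_apply]
      ring
    · simp only [Sum.elim_inr, Sum.elim_inl]
      have h1 : prz k (totRealL m d s) = s.1 k + Complex.I * s.2.1 k := by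
        simp [prz, totRealL_apply, zL_apply]
      have h2 : prζ k (totRealL m d s) = s.1 k - Complex.I * s.2.1 k := by
        simp [prζ, totRealL_apply, zL_apply, sub_eq_add_neg]
      rw [smul_apply, sub_apply, h1, h2, smul_eq_mul]
      linear_combination (-(s.2.1 k : ℂ)) * Complex.I_mul_I
    · simp [pru, totRealL_apply]
  · have := (totRealL m d).continuous.tendsto 0
    rwa [map_zero] at this

/-- The first component of the decomposition of `(ζ, z, w)` as `A + iB` with `A`, `B` in the
totally real subspace. -/
def totRe (m d : ℕ) (x : TSpace m d) : RSpace m d :=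
  (reL m ((2 : ℂ)⁻¹ • (x.2.1 + conjL m x.1)), imL m ((2 : ℂ)⁻¹ • (x.2.1 + conjL m x.1)),
    reL d x.2.2)

/-- The second component of the decomposition of `(ζ, z, w)` as `A + iB` with `A`, `B` in the
totally real subspace. -/
def totIm (m d : ℕ) (x : TSpace m d) : RSpace m d :=
  (reL m ((-(Complex.I / 2)) • (x.2.1 - conjL m x.1)),
    imL m ((-(Complex.I / 2)) • (x.2.1 - conjL m x.1)), imL d x.2.2)

theorem totRe_add_totIm (x : TSpace m d) :
    totRealL m d (totRe m d x) + Complex.I • totRealL m d (totIm m d x) = x := by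
  rw [totRealL_apply, totRealL_apply, totRe, totIm, zL_reL_imL, zL_reL_imL]
  refine Prod.ext ?_ (Prod.ext ?_ (ofRealL_reL_add x.2.2))
  · ext k
    simp only [Prod.fst_add, Prod.smul_fst, Pi.add_apply, Pi.smul_apply, smul_eq_mul,
      conjL_apply, map_mul, map_add, map_sub, Complex.conj_conj, map_neg, map_div₀,
      Complex.conj_I, map_inv₀, Pi.sub_apply, map_ofNat]
    linear_combination ((1 / 2) * conj (x.2.1 k) - (1 / 2) * x.1 k) * Complex.I_mul_I
  · ext k
    simp only [Prod.fst_add, Prod.smul_fst, Prod.snd_add, Prod.smul_snd, Pi.add_apply,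
      Pi.smul_apply, smul_eq_mul, conjL_apply, Pi.sub_apply]
    linear_combination (-(1 / 2) * x.2.1 k + (1 / 2) * conj (x.1 k)) * Complex.I_mul_I

/-- A holomorphic function vanishing on the totally real subspace `{(conj z, z, u)}` near `0`
vanishes near `0`: restrict it to the complex lines joining two real points. -/
theorem eventually_eq_zero_of_totReal {k : TSpace m d → F}
    (hk : ∀ᶠ x in 𝓝 0, DifferentiableAt ℂ k x)
    (h : ∀ᶠ s in 𝓝 (0 : RSpace m d), k (totRealL m d s) = 0) : ∀ᶠ x in 𝓝 0, k x = 0 := by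
  obtain ⟨r, hr, hkr⟩ := Metric.eventually_nhds_iff_ball.1 hk
  obtain ⟨δ, hδ, hkδ⟩ := Metric.eventually_nhds_iff_ball.1 h
  have cRe : Continuous (totRe m d) := by unfold totRe; fun_prop
  have cIm : Continuous (totIm m d) := by unfold totIm; fun_prop
  have zRe : totRe m d 0 = 0 := by simp [totRe]
  have zIm : totIm m d 0 = 0 := by simp [totIm]
  have e1 : ∀ᶠ x in 𝓝 (0 : TSpace m d),
      ‖totRealL m d (totRe m d x)‖ + 2 * ‖totRealL m d (totIm m d x)‖ < r := by
    have : Continuous fun x : TSpace m d =>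
      ‖totRealL m d (totRe m d x)‖ + 2 * ‖totRealL m d (totIm m d x)‖ := by fun_prop
    refine (this.tendsto 0).eventually_lt_const ?_
    simpa [zRe, zIm] using hr
  have e2 : ∀ᶠ x in 𝓝 (0 : TSpace m d), ‖totRe m d x‖ + 2 * ‖totIm m d x‖ < δ := by
    have : Continuous fun x : TSpace m d => ‖totRe m d x‖ + 2 * ‖totIm m d x‖ := by fun_prop
    refine (this.tendsto 0).eventually_lt_const ?_
    simpa [zRe, zIm] using hδ
  filter_upwards [e1, e2] with x h1 h2
  let u : ℂ → F := fun c => k (totRealL m d (totRe m d x) + c • totRealL m d (totIm m d x))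
  have hu : DifferentiableOn ℂ u (Metric.ball 0 2) := by
    intro c hc
    rw [mem_ball_zero_iff] at hc
    have hin : totRealL m d (totRe m d x) + c • totRealL m d (totIm m d x) ∈ Metric.ball 0 r := by
      rw [mem_ball_zero_iff]
      refine (norm_add_le _ _).trans_lt ?_
      rw [norm_smul]
      nlinarith [norm_nonneg (totRealL m d (totIm m d x))]
    refine (DifferentiableAt.comp c (f := fun c : ℂ => totRealL m d (totRe m d x) +
      c • totRealL m d (totIm m d x)) (hkr _ hin) ?_).differentiableWithinAt
    fun_prop
  have hua : AnalyticOnNhd ℂ u (Metric.ball 0 2) := hu.analyticOnNhd Metric.isOpen_ball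
  have hreal : ∀ c : ℝ, |c| < 2 → u c = 0 := by
    intro c hc
    have e3 : totRealL m d (totRe m d x) + (c : ℂ) • totRealL m d (totIm m d x)
        = totRealL m d (totRe m d x + c • totIm m d x) := by
      rw [map_add, map_smul, Complex.coe_smul]
    change k _ = 0
    rw [e3]
    apply hkδ
    rw [mem_ball_zero_iff]
    refine (norm_add_le _ _).trans_lt ?_
    rw [norm_smul, Real.norm_eq_abs]
    nlinarith [norm_nonneg (totIm m d x)]
  have hfreq : ∃ᶠ c in 𝓝[≠] (0 : ℂ), u c = 0 := by
    have ht : Tendsto (fun c : ℝ => (c : ℂ)) (𝓝[≠] 0) (𝓝[≠] 0) := by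
      refine tendsto_nhdsWithin_iff.2 ⟨?_, ?_⟩
      · exact (Complex.continuous_ofReal.tendsto' 0 0 (by simp)).mono_left nhdsWithin_le_nhds
      · filter_upwards [self_mem_nhdsWithin] with c hc
        simpa using hc
    refine ht.frequently (Eventually.frequently ?_)
    filter_upwards [nhdsWithin_le_nhds (Metric.ball_mem_nhds (0 : ℝ) two_pos)] with c hc
    exact hreal c (by simpa using hc)
  have h3 := hua.eqOn_zero_of_preconnected_of_frequently_eq_zero
    (convex_ball _ _).isPreconnected (Metric.mem_ball_self two_pos) hfreq
  have h4 : u Complex.I = 0 := h3 (by simp)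
  simp only [u, totRe_add_totIm] at h4
  exact h4

end TotallyReal

/-! ### Criteria for complex differentiability -/

theorem differentiableAt_complex_of_real {E F : Type*} [NormedAddCommGroup E] [NormedSpace ℂ E]
    [NormedAddCommGroup F] [NormedSpace ℂ F] {f : E → F} {x : E} (hf : DifferentiableAt ℝ f x)
    (h : ∀ v, fderiv ℝ f x (Complex.I • v) = Complex.I • fderiv ℝ f x v) :
    DifferentiableAt ℂ f x := by
  refine (differentiableAt_iff_restrictScalars ℝ hf).2
    ⟨{ toFun := fderiv ℝ f x
       map_add' := map_add _
       map_smul' := ?_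
       cont := (fderiv ℝ f x).cont }, ?_⟩
  · intro c v
    simp only [RingHom.id_apply]
    conv_lhs => rw [← Complex.re_add_im c, add_smul, mul_comm, mul_smul, map_add, h]
    rw [Complex.coe_smul, Complex.coe_smul, map_smul, map_smul]
    conv_rhs => rw [← Complex.re_add_im c, add_smul, mul_comm, mul_smul]
    rw [Complex.coe_smul, Complex.coe_smul]
  · ext v; rfl

/-- Componentwise conjugation of `(z, w)`. -/
def conjC (m d : ℕ) : CSpace m d →L[ℝ] CSpace m d := (conjL m).prodMap (conjL d)

theorem conjC_apply {m d : ℕ} (t : CSpace m d) : conjC m d t = (conjL m t.1, conjL d t.2) := rfl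

theorem differentiableAt_conj_comp_conj {m d n : ℕ} {g : CSpace m d → (Fin n → ℂ)}
    {t : CSpace m d} (hg : DifferentiableAt ℂ g (conjC m d t)) :
    DifferentiableAt ℂ (fun t => conjL n (g (conjC m d t))) t := by
  have h1 := (conjL n).hasFDerivAt.comp t
    ((hg.hasFDerivAt.restrictScalars ℝ).comp t (conjC m d).hasFDerivAt)
  refine differentiableAt_complex_of_real h1.differentiableAt fun v => ?_
  have h2 : fderiv ℝ (fun t => conjL n (g (conjC m d t))) t = _ := h1.fderiv
  rw [h2]
  have h3 : conjC m d (Complex.I • v) = -(Complex.I • conjC m d v) := by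
    rw [conjC_apply, conjC_apply]; simp
  simp [h3]

/-! ### Vanishing of iterated derivatives -/

section DirDeriv

variable {E : Type*} [NormedAddCommGroup E] [NormedSpace ℂ E]

/-- The derivative of a holomorphic function in the direction `v`. -/
def dirDeriv (v : E) (K : E → ℂ) : E → ℂ := fun x => fderiv ℂ K x v

theorem analyticOnNhd_dirDeriv {K : E → ℂ} {Ω : Set E} (hK : AnalyticOnNhd ℂ K Ω) (v : E) :
    AnalyticOnNhd ℂ (dirDeriv v K) Ω := fun x hx =>
  ((ContinuousLinearMap.apply ℂ ℂ v).analyticAt _).comp (hK x hx).fderiv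

theorem analyticOnNhd_dirDeriv_iterate {K : E → ℂ} {Ω : Set E} (hK : AnalyticOnNhd ℂ K Ω) (v : E)
    (n : ℕ) : AnalyticOnNhd ℂ ((dirDeriv v)^[n] K) Ω := by
  induction n with
  | zero => exact hK
  | succ n ih => rw [Function.iterate_succ_apply']; exact analyticOnNhd_dirDeriv ih v

/-- The iterated derivative `∂^β` along a list of directions. -/
def dirPow {κ : Type*} (v : κ → E) (l : List κ) (β : κ → ℕ) (K : E → ℂ) : E → ℂ :=
  l.foldr (fun k G => (dirDeriv (v k))^[β k] G) K

theorem analyticOnNhd_dirPow {κ : Type*} (v : κ → E) (l : List κ) (β : κ → ℕ) {K : E → ℂ}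
    {Ω : Set E} (hK : AnalyticOnNhd ℂ K Ω) : AnalyticOnNhd ℂ (dirPow v l β K) Ω := by
  induction l with
  | nil => exact hK
  | cons k l ih => exact analyticOnNhd_dirDeriv_iterate ih (v k) (β k)

theorem eq_zero_of_dirDeriv_iterate {K : E → ℂ} {Ω : Set E} (hΩ : IsOpen Ω) (hΩc : Convex ℝ Ω)
    (hK : AnalyticOnNhd ℂ K Ω) {p v : E} (hp : p ∈ Ω) (h : ∀ n, (dirDeriv v)^[n] K p = 0) {c : ℂ}
    (hc : p + c • v ∈ Ω) : K (p + c • v) = 0 := by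
  let a : ℂ → E := fun c => p + c • v
  let Λ : Set ℂ := a ⁻¹' Ω
  have hac : Continuous a := by fun_prop
  have hΛ : IsOpen Λ := hΩ.preimage hac
  have hΛc : Convex ℝ Λ := by
    intro x hx y hy s t hs ht hst
    have : a (s • x + t • y) = s • a x + t • a y := by
      simp only [a, smul_add, add_smul, smul_assoc]
      have : p = s • p + t • p := by rw [← add_smul, hst, one_smul]
      nth_rewrite 1 [this]
      abel
    change a _ ∈ Ω
    rw [this]
    exact hΩc hx hy hs ht hst
  have haa : ∀ c, HasDerivAt a v c := fun c => by
    have := ((hasDerivAt_id c).smul_const v).const_add p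
    rwa [one_smul] at this
  have h0 : (0 : ℂ) ∈ Λ := by simpa [Λ, a] using hp
  have hit : ∀ n, ∀ c ∈ Λ, iteratedDeriv n (fun c => K (a c)) c = (dirDeriv v)^[n] K (a c) := by
    intro n
    induction n with
    | zero => intro c _; simp
    | succ n ih =>
      intro c hc
      have h1 : iteratedDeriv n (fun c => K (a c)) =ᶠ[𝓝 c] fun c => (dirDeriv v)^[n] K (a c) := by
        filter_upwards [hΛ.mem_nhds hc] with x hx using ih x hx
      rw [iteratedDeriv_succ, h1.deriv_eq, Function.iterate_succ_apply']
      have h2 := (analyticOnNhd_dirDeriv_iterate hK v n _ hc).differentiableAt.hasFDerivAt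
      exact (h2.comp_hasDerivAt c (haa c)).deriv
  have hua : AnalyticOnNhd ℂ (fun c => K (a c)) Λ := by
    refine DifferentiableOn.analyticOnNhd (fun c hc => ?_) hΛ
    exact ((hK _ hc).differentiableAt.comp c (haa c).differentiableAt).differentiableWithinAt
  have hps := (hua 0 h0).hasFPowerSeriesAt
  have hz : (FormalMultilinearSeries.ofScalars ℂ
      fun n => iteratedDeriv n (fun c => K (a c)) 0 / (n.factorial : ℂ)) = 0 := by
    ext n
    have : (dirDeriv v)^[n] K (a 0) = 0 := by simpa [a] using h n
    simp [FormalMultilinearSeries.ofScalars, hit n 0 h0, this]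
  rw [hz] at hps
  exact hua.eqOn_zero_of_preconnected_of_eventuallyEq_zero hΛc.isPreconnected h0
    hps.eventually_eq_zero hc

/-- If all derivatives `∂^β K` vanish at `p`, then `K` vanishes on the affine span of the
directions through `p`, as far as the ball of analyticity reaches. -/
theorem eq_zero_of_dirPow {κ : Type*} [DecidableEq κ] (v : κ → E) {K : E → ℂ} {r : ℝ}
    (hK : AnalyticOnNhd ℂ K (Metric.ball 0 r)) (c : κ → ℂ) (l : List κ) (hl : l.Nodup) :
    ∀ p : E, (∀ β, dirPow v l β K p = 0) →
      ‖p‖ + (l.map fun k => ‖c k • v k‖).sum < r → K (p + (l.map fun k => c k • v k).sum) = 0 := by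
  induction l with
  | nil => intro p h _; simpa [dirPow] using h 0
  | cons k l ih =>
    intro p h hr
    simp only [List.map_cons, List.sum_cons] at hr ⊢
    rw [List.nodup_cons] at hl
    have hs : 0 ≤ (l.map fun k => ‖c k • v k‖).sum :=
      List.sum_nonneg (by simp only [List.mem_map]; rintro _ ⟨k, -, rfl⟩; exact norm_nonneg _)
    rw [← add_assoc]
    refine ih hl.2 (p + c k • v k) (fun β => ?_) ?_
    · have hpr : p ∈ Metric.ball (0 : E) r := by
        rw [mem_ball_zero_iff]; linarith [norm_nonneg (c k • v k)]
      refine eq_zero_of_dirDeriv_iterate Metric.isOpen_ball (convex_ball _ _)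
        (analyticOnNhd_dirPow v l β hK) hpr (fun n => ?_) ?_
      · have h1 := h (Function.update β k n)
        have h2 : dirPow v l (Function.update β k n) K = dirPow v l β K := by
          have : ∀ l : List κ, k ∉ l →
              dirPow v l (Function.update β k n) K = dirPow v l β K := by
            intro l hkl
            induction l with
            | nil => rfl
            | cons i l ih' =>
              rw [List.mem_cons, not_or] at hkl
              change (dirDeriv (v i))^[Function.update β k n i] _ = (dirDeriv (v i))^[β i] _
              rw [Function.update_of_ne (Ne.symm hkl.1)]
              exact congrArg _ (ih' hkl.2)
          exact this l hl.1
        change (dirDeriv (v k))^[Function.update β k n k] (dirPow v l _ K) p = 0 at h1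
        rwa [h2, Function.update_self] at h1
      · rw [mem_ball_zero_iff]
        linarith [norm_add_le p (c k • v k)]
    · linarith [norm_add_le p (c k • v k)]

end DirDeriv

/-! ### Normal form of submanifolds tangent to the complex tangent spaces -/

section LinearAlgebra

variable {m d : ℕ}

/-- Linear coordinates adapted to a real subspace `T` of `ℂᵐ × ℂᵈ` which projects onto `ℂᵐ` and
whose fibre over `0` is totally real: a `ℂ`-linear `π` sending the fibre isomorphically onto real
vectors. Scaling `π` makes the imaginary part of `π` small on `T`. -/
theorem exists_adapted_projection (T : Submodule ℝ (CSpace m d))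
    (B : (Fin m → ℂ) →L[ℝ] (Fin d → ℂ)) (hB : ∀ c, (c, B c) ∈ T)
    (htr : ∀ η : Fin d → ℂ, ((0, η) : CSpace m d) ∈ T → ((0, Complex.I • η) : CSpace m d) ∈ T →
      η = 0) :
    ∃ (d₁ : ℕ) (π : (Fin d → ℂ) →L[ℂ] (Fin d₁ → ℂ)),
      (∀ v ∈ T, ‖imL d₁ (π v.2)‖ ≤ 1 / 4 * ‖v.1‖) ∧
      (∀ v ∈ T, v.1 = 0 → reL d₁ (π v.2) = 0 → v = 0) ∧
      ∀ u, ∃ v ∈ T, v.1 = 0 ∧ reL d₁ (π v.2) = u := by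
  let K : Submodule ℝ (Fin d → ℂ) := T.comap (LinearMap.inr ℝ (Fin m → ℂ) (Fin d → ℂ))
  have hK : ∀ η, η ∈ K ↔ ((0, η) : CSpace m d) ∈ T := fun η => Iff.rfl
  let b := Module.finBasis ℝ K
  set d₁ := Module.finrank ℝ K
  let ιC : (Fin d₁ → ℂ) →ₗ[ℂ] (Fin d → ℂ) := Fintype.linearCombination ℂ fun j => (b j : Fin d → ℂ)
  have hι : ∀ a : Fin d₁ → ℝ, ιC (ofRealL d₁ a) = ((∑ j, a j • b j : K) : Fin d → ℂ) := by
    intro a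
    simp only [ιC, Fintype.linearCombination_apply, ofRealL_apply, Submodule.coe_sum,
      Submodule.coe_smul, Complex.coe_smul]
  have hιK : ∀ a : Fin d₁ → ℝ, ιC (ofRealL d₁ a) ∈ K := fun a => by
    rw [hι]; exact Subtype.property _
  have hι0 : ∀ a : Fin d₁ → ℝ, ιC (ofRealL d₁ a) = 0 → a = 0 := by
    intro a h
    rw [hι] at h
    have h1 : ∑ j, a j • b j = 0 := Subtype.ext h
    have h2 := Fintype.linearIndependent_iff.1 b.linearIndependent a h1
    exact funext h2
  have hker : LinearMap.ker ιC = ⊥ := by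
    rw [LinearMap.ker_eq_bot']
    intro c hc
    have h1 : ιC (ofRealL d₁ (reL d₁ c)) + Complex.I • ιC (ofRealL d₁ (imL d₁ c)) = 0 := by
      rw [← map_smul, ← map_add, ofRealL_reL_add, hc]
    have h2 : Complex.I • ιC (ofRealL d₁ (imL d₁ c)) ∈ K := by
      rw [← neg_eq_of_add_eq_zero_right h1]
      exact K.neg_mem (hιK _)
    have h3 := htr _ ((hK _).1 (hιK (imL d₁ c))) ((hK _).1 h2)
    rw [h3, smul_zero, add_zero] at h1
    rw [← ofRealL_reL_add c, hι0 _ h1, hι0 _ h3]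
    simp
  obtain ⟨π₀, hπ₀⟩ := LinearMap.exists_leftInverse_of_injective ιC hker
  have hπ : ∀ c, π₀ (ιC c) = c := fun c => LinearMap.congr_fun hπ₀ c
  let π₁ : (Fin d → ℂ) →L[ℂ] (Fin d₁ → ℂ) := LinearMap.toContinuousLinearMap π₀
  have hreal : ∀ η ∈ K, ∃ a : Fin d₁ → ℝ, η = ιC (ofRealL d₁ a) ∧ π₁ η = ofRealL d₁ a := by
    intro η hη
    have h1 : η = ιC (ofRealL d₁ (b.repr ⟨η, hη⟩)) := by
      rw [hι, b.sum_repr]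
    exact ⟨_, h1, by conv_lhs => rw [h1]
                     exact hπ _⟩
  let C : ℝ := ‖(imL d₁).comp ((π₁.restrictScalars ℝ).comp B)‖
  have hC : 0 ≤ C := norm_nonneg _
  let ε : ℝ := 1 / (4 * (C + 1))
  have hε : 0 < ε := by positivity
  have hre : ∀ x : Fin d₁ → ℂ, reL d₁ ((ε : ℂ) • x) = ε • reL d₁ x := fun x => by
    rw [Complex.coe_smul, map_smul]
  have him : ∀ x : Fin d₁ → ℂ, imL d₁ ((ε : ℂ) • x) = ε • imL d₁ x := fun x => by
    rw [Complex.coe_smul, map_smul]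
  refine ⟨d₁, (ε : ℂ) • π₁, ?_, ?_, ?_⟩
  · intro v hv
    have h1 : v.2 - B v.1 ∈ K := by
      rw [hK]
      have := T.sub_mem hv (hB v.1)
      have e : v - (v.1, B v.1) = (0, v.2 - B v.1) := by ext <;> simp
      rwa [e] at this
    obtain ⟨a, -, ha⟩ := hreal _ h1
    rw [map_sub, sub_eq_iff_eq_add] at ha
    have h2 : imL d₁ (π₁ v.2) = ((imL d₁).comp ((π₁.restrictScalars ℝ).comp B)) v.1 := by
      rw [ha, map_add, imL_ofRealL, zero_add]; rfl
    rw [smul_apply, him, norm_smul, h2, Real.norm_of_nonneg hε.le]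
    have h3 := ((imL d₁).comp ((π₁.restrictScalars ℝ).comp B)).le_opNorm v.1
    calc _ ≤ ε * (C * ‖v.1‖) := by gcongr
      _ = (ε * C) * ‖v.1‖ := by ring
      _ ≤ 1 / 4 * ‖v.1‖ := by
        gcongr
        rw [one_div_mul_eq_div, div_le_div_iff₀ (by positivity) (by norm_num)]
        linarith
  · intro v hv h1 h2
    have h3 : v.2 ∈ K := by
      rw [hK, ← h1]; exact hv
    obtain ⟨a, ha, ha'⟩ := hreal _ h3
    rw [smul_apply, hre, ha', reL_ofRealL, smul_eq_zero] at h2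
    have h4 : a = 0 := h2.resolve_left hε.ne'
    refine Prod.ext h1 ?_
    rw [ha, h4]; simp
  · intro u
    refine ⟨(0, ιC (ofRealL d₁ (ε⁻¹ • u))), (hK _).1 (hιK _), rfl, ?_⟩
    have : π₁ (ιC (ofRealL d₁ (ε⁻¹ • u))) = ofRealL d₁ (ε⁻¹ • u) := hπ _
    rw [smul_apply, hre, this, reL_ofRealL, smul_smul, mul_inv_cancel₀ hε.ne', one_smul]

end LinearAlgebra

theorem tangentVectors_mono {m d : ℕ} {S S' : Set (CSpace m d)} (h : S ⊆ S') (q : CSpace m d) :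
    tangentVectors S q ⊆ tangentVectors S' q := by
  rintro v ⟨γ, h0, hd, hγ⟩
  exact ⟨γ, h0, hd, hγ.mono fun _ hs => h hs⟩

/-- A parametrization of `N` near one point is a parametrization near the neighbouring points. -/
theorem eventually_map_nhds {V E : Type*} [NormedAddCommGroup V] [NormedSpace ℝ V]
    [FiniteDimensional ℝ V] [NormedAddCommGroup E] [NormedSpace ℝ E] [FiniteDimensional ℝ E]
    {γ : V → E} {t : V} {N : Set E} (hγ : AnalyticAt ℝ γ t)
    (hinj : Function.Injective (fderiv ℝ γ t)) (hN : Filter.map γ (𝓝 t) = 𝓝[N] (γ t)) :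
    ∀ᶠ x in 𝓝 t, Filter.map γ (𝓝 x) = 𝓝[N] (γ x) := by
  obtain ⟨A, e, het, he, -⟩ := exists_retraction hγ hinj
  have hmem : ∀ᶠ x in 𝓝 t, γ x ∈ N := by
    have : ∀ᶠ y in 𝓝[N] (γ t), y ∈ N := eventually_mem_nhdsWithin
    rw [← hN] at this
    exact this
  obtain ⟨B, hB, hBo, hBt⟩ := mem_nhds_iff.1
    ((hmem.and hγ.eventually_analyticAt).and (e.open_source.mem_nhds het))
  have h1 : γ '' B ∈ 𝓝[N] (γ t) := by
    rw [← hN]; exact image_mem_map (hBo.mem_nhds hBt)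
  obtain ⟨W, hWo, hWt, hW⟩ := mem_nhdsWithin.1 h1
  filter_upwards [hBo.mem_nhds hBt, hγ.continuousAt (hWo.mem_nhds hWt)] with x hx hxW
  rw [map_nhds_of_retraction he hBo (fun y hy => (hB hy).2) hx (hB hx).1.2.continuousAt]
  apply le_antisymm
  · exact nhdsWithin_mono _ (by rintro _ ⟨y, hy, rfl⟩; exact (hB hy).1.1)
  · refine nhdsWithin_le_iff.2 ?_
    have h2 : W ∩ N ∈ 𝓝[N] (γ x) := inter_mem (nhdsWithin_le_nhds (hWo.mem_nhds hxW))
      self_mem_nhdsWithin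
    exact mem_of_superset h2 hW

namespace LocalGeneric

variable {m d : ℕ} (M : LocalGeneric m d)

/-- The map `c ↦ conj (Θ_ζ (conj c))` as a real linear map. -/
def BcL (t : CSpace m d) : (Fin m → ℂ) →L[ℝ] (Fin d → ℂ) :=
  (conjL d).comp (((M.Θζ t).restrictScalars ℝ).comp (conjL m))

/-- A submanifold `N` of `M` containing the complex tangent directions of `M` can be parametrized
by `(x, y, u)`, with `z = x + iy` and `u = Re (π w)` for a suitable projection `π` of the `w`-space,
such that the imaginary part of `π w` has small derivative at the origin. -/
theorem exists_adapted_param {D : ℕ} {N : Set (CSpace m d)} (hN : IsAnalyticSubmanifold D N)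
    (h0 : (0 : CSpace m d) ∈ N) (hNM : N ⊆ M.carrier)
    (hT : ∀ᶠ q in 𝓝[N] (0 : CSpace m d), ∀ c, (c, M.Bc q c) ∈ tangentVectors N q) :
    ∃ (d₁ : ℕ) (π : (Fin d → ℂ) →L[ℂ] (Fin d₁ → ℂ)) (γ : RSpace m d₁ → CSpace m d),
      D = 2 * m + d₁ ∧ AnalyticAt ℝ γ 0 ∧ γ 0 = 0 ∧ (∀ᶠ s in 𝓝 0, (γ s).1 = zL m d₁ s) ∧
      (∀ᶠ s in 𝓝 0, reL d₁ (π (γ s).2) = s.2.2) ∧ Filter.map γ (𝓝 0) = 𝓝[N] 0 ∧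
      (∀ᶠ s in 𝓝 0, ∀ c, (c, M.Bc (γ s) c) ∈ LinearMap.range (fderiv ℝ γ s).toLinearMap) ∧
      ∀ V, ‖imL d₁ (π (fderiv ℝ γ 0 V).2)‖ ≤ 1 / 4 * ‖zL m d₁ V‖ := by
  obtain ⟨γ₀, hγa, hγ0, hγi, hγm⟩ := hN 0 h0
  have hγm' : Filter.map γ₀ (𝓝 0) = 𝓝[N] (γ₀ 0) := by rw [hγ0]; exact hγm
  have hγN : ∀ᶠ t in 𝓝 0, γ₀ t ∈ N := by
    have : ∀ᶠ y in 𝓝[N] (0 : CSpace m d), y ∈ N := eventually_mem_nhdsWithin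
    rw [← hγm] at this
    exact this
  set T : Submodule ℝ (CSpace m d) := LinearMap.range (fderiv ℝ γ₀ 0).toLinearMap with hTdef
  have hTN : ∀ v ∈ T, v ∈ tangentVectors N 0 := by
    rintro _ ⟨v, rfl⟩
    have := range_subset_tangentVectors hγa.differentiableAt.hasFDerivAt hγN v
    rwa [hγ0] at this
  have hBT : ∀ c, (c, M.BcL 0 c) ∈ T := by
    intro c
    refine tangentVectors_subset_range hγa hγi hγm' ?_
    rw [hγ0]
    exact hT.self_of_nhdsWithin h0 c
  have htr : ∀ η : Fin d → ℂ, ((0, η) : CSpace m d) ∈ T →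
      ((0, Complex.I • η) : CSpace m d) ∈ T → η = 0 := by
    intro η h1 h2
    have h3 : ((0, η) : CSpace m d) ∈ complexTangentVectors M.carrier 0 := by
      refine ⟨tangentVectors_mono hNM _ (hTN _ h1), ?_⟩
      have : Complex.I • ((0, η) : CSpace m d) = (0, Complex.I • η) := by simp
      rw [this]
      exact tangentVectors_mono hNM _ (hTN _ h2)
    have h4 := M.snd_of_complexTangent subset_rfl M.zero_mem_carrier h3
    simpa [Bc] using h4
  obtain ⟨d₁, π, hπ1, hπ2, hπ3⟩ := exists_adapted_projection T (M.BcL 0) hBT htr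
  let p : CSpace m d →L[ℝ] RSpace m d₁ := (realCoordsL m d₁).comp
    ((ContinuousLinearMap.id ℝ (Fin m → ℂ)).prodMap (π.restrictScalars ℝ))
  have hp : ∀ v, p v = (reL m v.1, imL m v.1, reL d₁ (π v.2)) := fun v => rfl
  have hLi : Function.Injective (p.comp (fderiv ℝ γ₀ 0)) := by
    rw [injective_iff_map_eq_zero]
    intro a ha
    have h1 : fderiv ℝ γ₀ 0 a = 0 := by
      rw [ContinuousLinearMap.comp_apply, hp] at ha
      simp only [Prod.mk_eq_zero] at ha
      refine hπ2 _ ⟨a, rfl⟩ ?_ ha.2.2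
      have := ofRealL_reL_add (fderiv ℝ γ₀ 0 a).1
      rw [ha.1, ha.2.1] at this
      simpa using this.symm
    exact hγi (h1.trans (map_zero _).symm)
  have hLs : Function.Surjective (p.comp (fderiv ℝ γ₀ 0)) := by
    intro V
    obtain ⟨v₁, hv₁⟩ := hBT (zL m d₁ V)
    obtain ⟨w, ⟨v₂, hv₂⟩, hw1, hw2⟩ := hπ3 (V.2.2 - reL d₁ (π (M.BcL 0 (zL m d₁ V))))
    have hv₁' : fderiv ℝ γ₀ 0 v₁ = (zL m d₁ V, M.BcL 0 (zL m d₁ V)) := hv₁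
    have hv₂' : fderiv ℝ γ₀ 0 v₂ = w := hv₂
    refine ⟨v₁ + v₂, ?_⟩
    rw [ContinuousLinearMap.comp_apply, map_add, hv₁', hv₂', map_add, hp, hp, hw1, hw2]
    refine Prod.ext ?_ (Prod.ext ?_ ?_)
    · simp [reL_zL]
    · simp [imL_zL]
    · simp
  let i : (Fin D → ℝ) ≃L[ℝ] RSpace m d₁ := (LinearEquiv.ofBijective
    (p.comp (fderiv ℝ γ₀ 0)).toLinearMap ⟨hLi, hLs⟩).toContinuousLinearEquiv
  have hD : D = 2 * m + d₁ := by
    have := i.toLinearEquiv.finrank_eq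
    simp at this
    omega
  obtain ⟨e, he0, he, hes, -⟩ := exists_analytic_localInverse (𝕜 := ℝ) (f := fun t => p (γ₀ t))
    ((p.analyticAt _).comp hγa) i ((p.hasFDerivAt.comp (0 : Fin D → ℝ)
      hγa.differentiableAt.hasFDerivAt).congr_fderiv (ContinuousLinearMap.ext fun v => rfl))
  have hpγ0 : p (γ₀ 0) = 0 := by rw [hγ0, map_zero]
  have he00 : e 0 = 0 := by rw [he, hpγ0]
  rw [hpγ0] at hes
  have hes0 : e.symm 0 = 0 := by rw [← he00, e.left_inv he0]
  have h0t : (0 : RSpace m d₁) ∈ e.target := by rw [← he00]; exact e.map_source he0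
  have hest : Tendsto e.symm (𝓝 0) (𝓝 0) := by
    have := hes.continuousAt.tendsto
    rwa [hes0] at this
  let γ : RSpace m d₁ → CSpace m d := fun s => γ₀ (e.symm s)
  have hγa' : AnalyticAt ℝ γ 0 := by
    refine AnalyticAt.comp (g := γ₀) ?_ hes
    rw [hes0]; exact hγa
  have hγ0' : γ 0 = 0 := by simp only [γ, hes0, hγ0]
  have hpγ : ∀ᶠ s in 𝓝 0, p (γ s) = s := by
    filter_upwards [e.open_target.mem_nhds h0t] with s hs
    have := e.right_inv hs
    rwa [he] at this
  have hmap : Filter.map γ (𝓝 0) = 𝓝[N] 0 := by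
    have h1 : Filter.map e.symm (𝓝 0) = 𝓝 0 := by
      have := e.symm.map_nhds_eq (x := 0) h0t
      rwa [hes0] at this
    rw [← hγm]
    conv_rhs => rw [← h1]
    rw [Filter.map_map]; rfl
  have hγd : HasFDerivAt γ ((fderiv ℝ γ₀ 0).comp (fderiv ℝ e.symm 0)) 0 := by
    refine HasFDerivAt.comp (0 : RSpace m d₁) (g := γ₀) ?_ hes.differentiableAt.hasFDerivAt
    rw [hes0]; exact hγa.differentiableAt.hasFDerivAt
  have hpd : p.comp (fderiv ℝ γ 0) = ContinuousLinearMap.id ℝ _ := by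
    have h1 := p.hasFDerivAt.comp (0 : RSpace m d₁) hγa'.differentiableAt.hasFDerivAt
    have h2 := h1.congr_of_eventuallyEq (f₁ := id) (hpγ.mono fun s hs => hs.symm)
    exact h2.unique (hasFDerivAt_id 0)
  have hpd' : ∀ V, p (fderiv ℝ γ 0 V) = V := fun V => congrArg (fun L => L V) hpd
  have hγi' : Function.Injective (fderiv ℝ γ 0) := fun a b hab => by
    rw [← hpd' a, ← hpd' b, hab]
  have hfst : ∀ s, p (γ s) = s → (γ s).1 = zL m d₁ s := by
    intro s hs
    have h1 := zL_reL_imL (γ s).1 s.2.2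
    rw [hp] at hs
    have e1 : reL m (γ s).1 = s.1 := congrArg Prod.fst hs
    have e2 : imL m (γ s).1 = s.2.1 := congrArg (fun x => x.2.1) hs
    rw [e1, e2] at h1
    exact h1.symm
  refine ⟨d₁, π, γ, hD, hγa', hγ0', hpγ.mono hfst, ?_, hmap, ?_, ?_⟩
  · filter_upwards [hpγ] with s hs
    rw [hp] at hs
    exact congrArg (fun x => x.2.2) hs
  · have hinj : ∀ᶠ s in 𝓝 0, Function.Injective (fderiv ℝ γ s) :=
      hγa'.fderiv.continuousAt.eventually (ContinuousLinearMap.isOpen_injective.mem_nhds hγi')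
    have hmap' : Filter.map γ (𝓝 0) = 𝓝[N] (γ 0) := by rw [hγ0']; exact hmap
    rw [← hmap] at hT
    filter_upwards [eventually_map_nhds hγa' hγi' hmap', hinj, hγa'.eventually_analyticAt,
      eventually_map.1 hT] with s hs hi ha hTs c
    exact tangentVectors_subset_range ha hi hs (hTs c)
  · intro V
    have h1 : fderiv ℝ γ 0 V ∈ T := by
      rw [hγd.fderiv]; exact ⟨_, rfl⟩
    have h2 : (fderiv ℝ γ 0 V).1 = zL m d₁ V := by
      have h3 := hpd' V
      rw [hp] at h3
      have h4 := zL_reL_imL (fderiv ℝ γ 0 V).1 V.2.2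
      have e1 : reL m (fderiv ℝ γ 0 V).1 = V.1 := congrArg Prod.fst h3
      have e2 : imL m (fderiv ℝ γ 0 V).1 = V.2.1 := congrArg (fun x => x.2.1) h3
      rw [e1, e2] at h4
      exact h4.symm
    rw [← h2]
    exact hπ1 _ h1

end LocalGeneric

/-! ### The intrinsic complexification -/

theorem zL_zero_zero {m d : ℕ} (u : Fin d → ℝ) : zL m d (0, 0, u) = 0 := by
  rw [zL_apply]; simp

theorem norm_zL_le {m d : ℕ} (V : RSpace m d) : ‖zL m d V‖ ≤ 2 * ‖V‖ := by
  rw [zL_apply]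
  refine (norm_add_le _ _).trans ?_
  rw [norm_smul, Complex.norm_I, one_mul, norm_ofRealL, norm_ofRealL]
  have h1 : ‖V.1‖ ≤ ‖V‖ := norm_fst_le V
  have h2 : ‖V.2.1‖ ≤ ‖V‖ := (norm_fst_le V.2).trans (norm_snd_le V)
  linarith

theorem totRealL_realCoords {m d : ℕ} (t : CSpace m d) :
    totRealL m d (realCoords t) = (conjL m t.1, t.1, ofRealL d (reL d t.2)) := by
  have h : zL m d (realCoords t) = t.1 := zL_reL_imL t.1 (reL d t.2)
  rw [totRealL_apply, h]; rfl

theorem tendsto_totRealL (m d : ℕ) : Tendsto (totRealL m d) (𝓝 0) (𝓝 0) := by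
  have := (totRealL m d).continuous.tendsto 0
  rwa [map_zero] at this

/-- A function with vanishing partial derivative in `ζ` near the origin does not depend on `ζ`. -/
theorem eventually_indep_of_fderiv_inl {E G F : Type*} [NormedAddCommGroup E] [NormedSpace ℂ E]
    [NormedAddCommGroup G] [NormedSpace ℂ G] [NormedAddCommGroup F] [NormedSpace ℂ F]
    {g : E × G → F} (hd : ∀ᶠ x in 𝓝 0, DifferentiableAt ℂ g x)
    (h : ∀ᶠ x in 𝓝 0, (fderiv ℂ g x).comp (ContinuousLinearMap.inl ℂ E G) = 0) :
    ∀ᶠ x in 𝓝 0, g x = g (0, x.2) := by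
  obtain ⟨r, hr, hgr⟩ := Metric.eventually_nhds_iff_ball.1 (hd.and h)
  filter_upwards [Metric.ball_mem_nhds _ hr] with x hx
  have hx1 : ‖x.1‖ < r := (norm_fst_le x).trans_lt (mem_ball_zero_iff.1 hx)
  have hx2 : ‖x.2‖ < r := (norm_snd_le x).trans_lt (mem_ball_zero_iff.1 hx)
  have hin : ∀ y ∈ Metric.ball (0 : E) r, (y, x.2) ∈ Metric.ball (0 : E × G) r := by
    intro y hy
    rw [mem_ball_zero_iff] at hy ⊢
    exact max_lt hy hx2
  have hder : ∀ y ∈ Metric.ball (0 : E) r, HasFDerivAt (fun y => g (y, x.2)) (0 : E →L[ℂ] F) y := by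
    intro y hy
    have h1 := hgr _ (hin y hy)
    have h2 : HasFDerivAt (fun y : E => (y, x.2)) (ContinuousLinearMap.inl ℂ E G) y :=
      ((hasFDerivAt_id y).prodMk (hasFDerivAt_const x.2 y)).congr_fderiv
        (ContinuousLinearMap.ext fun v => rfl)
    have h3 := h1.1.hasFDerivAt.comp y h2
    rw [h1.2] at h3
    exact h3
  exact Metric.isOpen_ball.is_const_of_fderiv_eq_zero (𝕜 := ℂ) (f := fun y => g (y, x.2))
    (convex_ball (0 : E) r).isPreconnected
    (fun y hy => (hder y hy).differentiableAt.differentiableWithinAt)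
    (fun y hy => (hder y hy).fderiv) (mem_ball_zero_iff.2 hx1)
    (Metric.mem_ball_self hr)

namespace LocalGeneric

variable {m d : ℕ} (M : LocalGeneric m d)

/-- Normal form of a submanifold `N` of `M` containing the complex tangent directions of `M`:
`N` is the image, under a holomorphic graph map `(z, w₁) ↦ (z, g(z, w₁))` onto the intrinsic
complexification of `N`, of a generic submanifold with graphing function `φ` and complex defining
function `Θ`. The last condition expresses `N ⊆ M` in terms of complex defining functions.

The holomorphic extension of a parametrization of `N`, rewritten in the coordinates `(ζ, z, w₁)`,
does not depend on `ζ`: at the points of `N` its `ζ`-derivative is both `ℂ`-linear and antilinear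
in the complex tangent directions. -/
theorem exists_normalForm {D : ℕ} {N : Set (CSpace m d)} (hN : IsAnalyticSubmanifold D N)
    (h0 : (0 : CSpace m d) ∈ N) (hNM : N ⊆ M.carrier)
    (hT : ∀ᶠ q in 𝓝[N] (0 : CSpace m d), ∀ c, (c, M.Bc q c) ∈ tangentVectors N q) :
    ∃ (d₁ : ℕ) (π : (Fin d → ℂ) →L[ℂ] (Fin d₁ → ℂ)) (g : CSpace m d₁ → (Fin d → ℂ))
      (φ : RSpace m d₁ → (Fin d₁ → ℝ)) (Θ : TSpace m d₁ → (Fin d₁ → ℂ)),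
      D = 2 * m + d₁ ∧ AnalyticAt ℂ g 0 ∧ g 0 = 0 ∧ (∀ᶠ t in 𝓝 0, π (g t) = t.2) ∧
      AnalyticAt ℝ φ 0 ∧ φ 0 = 0 ∧ ‖fderiv ℝ φ 0‖ ≤ 1 / 2 ∧ AnalyticAt ℂ Θ 0 ∧
      (∀ᶠ t : CSpace m d₁ in 𝓝 0, (∀ j, (t.2 j).im = φ (realCoords t) j) ↔
        ∀ j, conj (t.2 j) = Θ (jetL m d₁ t) j) ∧
      Filter.map (fun s : RSpace m d₁ => ((zL m d₁ s,
        g (zL m d₁ s, ofRealL d₁ s.2.2 + Complex.I • ofRealL d₁ (φ s))) : CSpace m d))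
          (𝓝 0) = 𝓝[N] 0 ∧
      ∀ᶠ x : TSpace m d₁ in 𝓝 0,
        M.Θ (x.1, x.2.1, g x.2) = conjL d (g (conjC m d₁ (x.1, Θ x))) := by
  obtain ⟨d₁, π, γ, hD, hγa, hγ0, hγz, hγu, hγm, hγT, hγim⟩ :=
    M.exists_adapted_param hN h0 hNM hT
  have hγN : ∀ᶠ s in 𝓝 0, γ s ∈ N := by
    have : ∀ᶠ y in 𝓝[N] (0 : CSpace m d), y ∈ N := eventually_mem_nhdsWithin
    rw [← hγm] at this
    exact this
  let wf : RSpace m d₁ → (Fin d → ℂ) := fun s => (γ s).2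
  have hwfa : AnalyticAt ℝ wf 0 := analyticAt_snd.comp hγa
  have hwf0 : wf 0 = 0 := by simp only [wf, hγ0]; rfl
  let φ : RSpace m d₁ → (Fin d₁ → ℝ) := fun s => imL d₁ (π (wf s))
  let imπ : (Fin d → ℂ) →L[ℝ] (Fin d₁ → ℝ) := (imL d₁).comp (π.restrictScalars ℝ)
  let reπ : (Fin d → ℂ) →L[ℝ] (Fin d₁ → ℝ) := (reL d₁).comp (π.restrictScalars ℝ)
  have hφa : AnalyticAt ℝ φ 0 := (imπ.analyticAt _).comp hwfa
  have hφ0 : φ 0 = 0 := by simp [φ, hwf0]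
  have hwfd : HasFDerivAt wf ((ContinuousLinearMap.snd ℝ _ _).comp (fderiv ℝ γ 0)) 0 :=
    (ContinuousLinearMap.snd ℝ (Fin m → ℂ) (Fin d → ℂ)).hasFDerivAt.comp (0 : RSpace m d₁)
      hγa.differentiableAt.hasFDerivAt
  have hwfd' : ∀ V, fderiv ℝ wf 0 V = (fderiv ℝ γ 0 V).2 := fun V => by rw [hwfd.fderiv]; rfl
  have hφd : ‖fderiv ℝ φ 0‖ ≤ 1 / 2 := by
    refine ContinuousLinearMap.opNorm_le_bound _ (by norm_num) fun V => ?_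
    have h1 : HasFDerivAt φ (imπ.comp (fderiv ℝ wf 0)) 0 :=
      imπ.hasFDerivAt.comp (0 : RSpace m d₁) hwfa.differentiableAt.hasFDerivAt
    rw [h1.fderiv]
    have h2 := hγim V
    rw [← hwfd'] at h2
    have h3 := norm_zL_le V
    exact h2.trans (by linarith)
  have hπwf : ∀ᶠ s in 𝓝 0, π (wf s) = ofRealL d₁ s.2.2 + Complex.I • ofRealL d₁ (φ s) := by
    filter_upwards [hγu] with s hs
    rw [← hs]
    exact (ofRealL_reL_add _).symm
  -- the complexified parametrization and the change of coordinates `u ↦ w₁ = π wf`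
  obtain ⟨wc, hwca, hwc⟩ := exists_complexification hwfa
  have hwc0 : wc 0 = 0 := by
    have := hwc.self_of_nhds
    rwa [map_zero, hwf0] at this
  let κ : TSpace m d₁ → TSpace m d₁ := fun x => (x.1, x.2.1, π (wc x))
  have hκ0 : κ 0 = 0 := by simp only [κ, hwc0, map_zero]; rfl
  have hκa : AnalyticAt ℂ κ 0 :=
    analyticAt_fst.prod ((analyticAt_fst.comp analyticAt_snd).prod ((π.analyticAt _).comp hwca))
  have hπd : ∀ e : Fin d₁ → ℂ, π (fderiv ℂ wc 0 (0, 0, e)) = e := by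
    have h1 : HasFDerivAt (fun s => wc (totRealL m d₁ s))
        (((fderiv ℂ wc 0).restrictScalars ℝ).comp (totRealL m d₁)) 0 := by
      refine HasFDerivAt.comp (0 : RSpace m d₁) (g := wc) ?_ (totRealL m d₁).hasFDerivAt
      rw [map_zero]
      exact hwca.differentiableAt.hasFDerivAt.restrictScalars ℝ
    have h2 : HasFDerivAt wf (((fderiv ℂ wc 0).restrictScalars ℝ).comp (totRealL m d₁)) 0 :=
      h1.congr_of_eventuallyEq (hwc.mono fun s hs => hs.symm)
    have h3 : ∀ e : Fin d₁ → ℝ, π (fderiv ℂ wc 0 (0, 0, ofRealL d₁ e)) = ofRealL d₁ e := by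
      intro e
      have h4 : fderiv ℂ wc 0 (0, 0, ofRealL d₁ e) = fderiv ℝ wf 0 (0, 0, e) := by
        rw [h2.fderiv]
        change _ = fderiv ℂ wc 0 (totRealL m d₁ (0, 0, e))
        rw [totRealL_apply, zL_zero_zero, map_zero]
      have h5 : reL d₁ (π (fderiv ℝ wf 0 (0, 0, e))) = e := by
        have h6 : HasFDerivAt (fun s => reπ (wf s)) (reπ.comp (fderiv ℝ wf 0)) 0 :=
          reπ.hasFDerivAt.comp (0 : RSpace m d₁) hwfa.differentiableAt.hasFDerivAt
        have h7 : HasFDerivAt (fun s => reπ (wf s)) (uL m d₁) 0 :=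
          (uL m d₁).hasFDerivAt.congr_of_eventuallyEq hγu
        exact congrArg (fun L : RSpace m d₁ →L[ℝ] (Fin d₁ → ℝ) => L (0, 0, e)) (h6.unique h7)
      have h6 : imL d₁ (π (fderiv ℝ wf 0 (0, 0, e))) = 0 := by
        have := hγim (0, 0, e)
        rw [zL_zero_zero, norm_zero, mul_zero, ← hwfd'] at this
        exact norm_le_zero_iff.1 this
      rw [h4, ← ofRealL_reL_add (π (fderiv ℝ wf 0 (0, 0, e))), h5, h6]
      simp
    intro e
    have h4 : ((0, 0, e) : TSpace m d₁)
        = (0, 0, ofRealL d₁ (reL d₁ e)) + Complex.I • (0, 0, ofRealL d₁ (imL d₁ e)) := by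
      conv_lhs => rw [← ofRealL_reL_add e]
      simp
    rw [h4, map_add, map_smul, map_add, map_smul, h3, h3, ofRealL_reL_add]
  let A : TSpace m d₁ →L[ℂ] (Fin d₁ → ℂ) := π.comp (fderiv ℂ wc 0)
  have hA : ∀ x : TSpace m d₁, A x = A (x.1, x.2.1, 0) + x.2.2 := by
    intro x
    have : x = (x.1, x.2.1, 0) + (0, 0, x.2.2) := by ext <;> simp
    conv_lhs => rw [this, map_add]
    congr 1
    exact hπd x.2.2
  let prζ := ContinuousLinearMap.fst ℂ (Fin m → ℂ) (CSpace m d₁)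
  let prz := (ContinuousLinearMap.fst ℂ (Fin m → ℂ) (Fin d₁ → ℂ)).comp
    (ContinuousLinearMap.snd ℂ (Fin m → ℂ) (CSpace m d₁))
  let prw := (ContinuousLinearMap.snd ℂ (Fin m → ℂ) (Fin d₁ → ℂ)).comp
    (ContinuousLinearMap.snd ℂ (Fin m → ℂ) (CSpace m d₁))
  let i₁ : TSpace m d₁ →L[ℂ] TSpace m d₁ := prζ.prod (prz.prod A)
  let i₂ : TSpace m d₁ →L[ℂ] TSpace m d₁ :=
    prζ.prod (prz.prod (prw - A.comp (prζ.prod (prz.prod 0))))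
  have hi₁ : ∀ x, i₁ x = (x.1, x.2.1, A x) := fun _ => rfl
  have hi₂ : ∀ x, i₂ x = (x.1, x.2.1, x.2.2 - A (x.1, x.2.1, 0)) := fun _ => rfl
  let i : TSpace m d₁ ≃L[ℂ] TSpace m d₁ := ContinuousLinearEquiv.equivOfInverse i₁ i₂
    (fun x => by rw [hi₂, hi₁, hA x]; simp)
    (fun x => by
      have h := hA (x.1, x.2.1, x.2.2 - A (x.1, x.2.1, 0))
      rw [hi₂, hi₁, h]; simp)
  have hi : HasFDerivAt κ (i : TSpace m d₁ →L[ℂ] TSpace m d₁) 0 :=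
    prζ.hasFDerivAt.prodMk (prz.hasFDerivAt.prodMk
      (π.hasFDerivAt.comp (0 : TSpace m d₁) hwca.differentiableAt.hasFDerivAt))
  obtain ⟨e, he0, he, hes, -⟩ := exists_analytic_localInverse hκa i hi
  rw [hκ0] at hes
  have hes0 : e.symm 0 = 0 := by
    have := e.left_inv he0
    rwa [he, hκ0] at this
  have h0t : (0 : TSpace m d₁) ∈ e.target := by
    have := e.map_source he0
    rwa [he, hκ0] at this
  have hest : Tendsto e.symm (𝓝 0) (𝓝 0) := by
    have := hes.continuousAt.tendsto
    rwa [hes0] at this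
  have hκt : Tendsto κ (𝓝 0) (𝓝 0) := by
    have := hκa.continuousAt.tendsto
    rwa [hκ0] at this
  have hr : ∀ᶠ x in 𝓝 0, κ (e.symm x) = x := by
    filter_upwards [e.open_target.mem_nhds h0t] with x hx
    rw [← he, e.right_inv hx]
  have hl : ∀ᶠ x in 𝓝 0, e.symm (κ x) = x := by
    filter_upwards [e.open_source.mem_nhds he0] with x hx
    rw [← he, e.left_inv hx]
  have htr := tendsto_totRealL m d₁
  -- the real points in the new coordinates
  have hκwf : ∀ᶠ s in 𝓝 0, κ (totRealL m d₁ s) = (conjL m (zL m d₁ s), zL m d₁ s, π (wf s)) := by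
    filter_upwards [hwc] with s hs
    simp only [κ, hs]
    rfl
  let G : TSpace m d₁ → (Fin d → ℂ) := fun x => wc (e.symm x)
  have hGa : AnalyticAt ℂ G 0 := by
    refine AnalyticAt.comp (g := wc) ?_ hes
    rw [hes0]; exact hwca
  have hG0 : G 0 = 0 := by simp only [G, hes0, hwc0]
  let pt : RSpace m d₁ → TSpace m d₁ := fun s => (conjL m (zL m d₁ s), zL m d₁ s, π (wf s))
  have hptt : Tendsto pt (𝓝 0) (𝓝 0) := by
    refine Tendsto.congr' hκwf (hκt.comp htr)
  have hGwf : ∀ᶠ s in 𝓝 0, G (pt s) = wf s := by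
    filter_upwards [hκwf, htr.eventually hl, hwc] with s h1 h2 h3
    change wc (e.symm (pt s)) = wf s
    rw [show pt s = κ (totRealL m d₁ s) from h1.symm, h2, h3]
  -- the `ζ`-derivative vanishes at the real points
  have hζreal : ∀ᶠ s in 𝓝 0, (fderiv ℂ G (κ (totRealL m d₁ s))).comp
      (ContinuousLinearMap.inl ℂ (Fin m → ℂ) (CSpace m d₁)) = 0 := by
    filter_upwards [hκwf, hGwf.eventually_nhds, hγT, hγz.eventually_nhds,
      hγa.eventually_analyticAt, hptt.eventually hGa.eventually_analyticAt] with s h1 h2 h3 h4 h5 h6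
    have hwfs : HasFDerivAt wf ((ContinuousLinearMap.snd ℝ _ _).comp (fderiv ℝ γ s)) s :=
      (ContinuousLinearMap.snd ℝ (Fin m → ℂ) (Fin d → ℂ)).hasFDerivAt.comp s
        h5.differentiableAt.hasFDerivAt
    have hpts : HasFDerivAt pt (((conjL m).comp (zL m d₁)).prod ((zL m d₁).prod
        ((π.restrictScalars ℝ).comp
          ((ContinuousLinearMap.snd ℝ _ _).comp (fderiv ℝ γ s))))) s :=
      ((conjL m).comp (zL m d₁)).hasFDerivAt.prodMk ((zL m d₁).hasFDerivAt.prodMk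
        ((π.restrictScalars ℝ).hasFDerivAt.comp s hwfs))
    have hcomp := (h6.differentiableAt.hasFDerivAt.restrictScalars ℝ).comp s hpts
    have hwf' := hwfs.unique (hcomp.congr_of_eventuallyEq (h2.mono fun x hx => hx.symm))
    have key : ∀ c, M.Bc (γ s) c
        = fderiv ℂ G (pt s) (conjL m c, c, π (M.Bc (γ s) c)) := by
      intro c
      obtain ⟨V, hV⟩ := h3 c
      have hV' : fderiv ℝ γ s V = (c, M.Bc (γ s) c) := hV
      have hz : zL m d₁ V = c := by
        have h7 : HasFDerivAt (fun s => (γ s).1)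
            ((ContinuousLinearMap.fst ℝ _ _).comp (fderiv ℝ γ s)) s :=
          (ContinuousLinearMap.fst ℝ (Fin m → ℂ) (Fin d → ℂ)).hasFDerivAt.comp s
            h5.differentiableAt.hasFDerivAt
        have h8 := h7.unique ((zL m d₁).hasFDerivAt.congr_of_eventuallyEq h4)
        have h9 := congrArg (fun L : RSpace m d₁ →L[ℝ] (Fin m → ℂ) => L V) h8
        simp only [ContinuousLinearMap.comp_apply, hV'] at h9
        exact h9.symm
      have h9 := congrArg (fun L : RSpace m d₁ →L[ℝ] (Fin d → ℂ) => L V) hwf'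
      simp only [ContinuousLinearMap.comp_apply, hV'] at h9
      have h10 : M.Bc (γ s) c = fderiv ℂ G (pt s)
          (conjL m (zL m d₁ V), zL m d₁ V, π (fderiv ℝ γ s V).2) := h9
      rw [hz, hV'] at h10
      exact h10
    rw [h1]
    refine ContinuousLinearMap.ext fun c' => ?_
    change fderiv ℂ G (pt s) (c', 0) = 0
    obtain ⟨c, rfl⟩ : ∃ c, conjL m c = c' := ⟨conjL m c', conjL_conjL c'⟩
    have split : ∀ (a b : Fin m → ℂ) (f : Fin d₁ → ℂ), fderiv ℂ G (pt s) (a, b, f)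
        = fderiv ℂ G (pt s) (a, 0) + fderiv ℂ G (pt s) (0, b, f) := by
      intro a b f
      rw [← map_add]; simp
    have k1 := key c
    have k2 := key (Complex.I • c)
    rw [split] at k1 k2
    have k3 : fderiv ℂ G (pt s) (conjL m (Complex.I • c), 0)
        = -(Complex.I • fderiv ℂ G (pt s) (conjL m c, 0)) := by
      rw [conjL_I_smul, ← (fderiv ℂ G (pt s)).map_smul, ← (fderiv ℂ G (pt s)).map_neg]; simp
    have k4 : fderiv ℂ G (pt s) (0, Complex.I • c, π (Complex.I • M.Bc (γ s) c))
        = Complex.I • fderiv ℂ G (pt s) (0, c, π (M.Bc (γ s) c)) := by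
      rw [← (fderiv ℂ G (pt s)).map_smul, π.map_smul]; simp
    rw [M.Bc_I_smul, k3, k4] at k2
    have k5 := congrArg (fun x => Complex.I • x) k1
    simp only [smul_add] at k5
    rw [k5] at k2
    have k6 := add_right_cancel k2
    have k7 : (2 * Complex.I) • fderiv ℂ G (pt s) (conjL m c, 0) = 0 := by
      rw [mul_smul, two_smul]
      nth_rewrite 1 [k6]
      simp
    exact (smul_eq_zero.1 k7).resolve_left (by simp)
  have hζ : ∀ᶠ x in 𝓝 0, (fderiv ℂ G x).comp
      (ContinuousLinearMap.inl ℂ (Fin m → ℂ) (CSpace m d₁)) = 0 := by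
    have h1 : AnalyticAt ℂ (fun x => (fderiv ℂ G (κ x)).comp
        (ContinuousLinearMap.inl ℂ (Fin m → ℂ) (CSpace m d₁))) 0 := by
      refine ((((ContinuousLinearMap.compL ℂ (Fin m → ℂ) (TSpace m d₁) (Fin d → ℂ)).flip
        (ContinuousLinearMap.inl ℂ (Fin m → ℂ) (CSpace m d₁))).analyticAt _).comp ?_)
      refine AnalyticAt.comp (g := fderiv ℂ G) ?_ hκa
      rw [hκ0]; exact hGa.fderiv
    have h2 := eventually_eq_zero_of_totReal
      (h1.eventually_analyticAt.mono fun x hx => hx.differentiableAt) hζreal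
    filter_upwards [hest.eventually h2, hr] with x h3 h4
    rwa [h4] at h3
  have hindep : ∀ᶠ x in 𝓝 0, G x = G (0, x.2) := eventually_indep_of_fderiv_inl
    (hGa.eventually_analyticAt.mono fun x hx => hx.differentiableAt) hζ
  let g : CSpace m d₁ → (Fin d → ℂ) := fun t => G (0, t)
  let Θ : TSpace m d₁ → (Fin d₁ → ℂ) := fun x => (2 : ℂ) • (e.symm x).2.2 - x.2.2
  have hga : AnalyticAt ℂ g 0 := AnalyticAt.comp (g := G)
    (f := fun t : CSpace m d₁ => ((0 : Fin m → ℂ), t)) hGa (analyticAt_const.prod analyticAt_id)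
  have hΘa : AnalyticAt ℂ Θ 0 := by
    have h1 : AnalyticAt ℂ (fun x => (2 : ℂ) • prw (e.symm x)) 0 :=
      (((2 : ℂ) • prw).analyticAt _).comp hes
    exact h1.sub (prw.analyticAt 0)
  have hgwf : ∀ᶠ s in 𝓝 0, g (zL m d₁ s, π (wf s)) = wf s := by
    filter_upwards [hptt.eventually hindep, hGwf] with s h1 h2
    rw [h2] at h1
    exact h1.symm
  have hjt : Tendsto (jetL m d₁) (𝓝 0) (𝓝 0) := by
    have := (jetL m d₁).continuous.tendsto 0
    rwa [map_zero] at this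
  have hrct : Tendsto (fun t : CSpace m d₁ => realCoords t) (𝓝 0) (𝓝 0) := by
    have := (realCoordsL m d₁).continuous.tendsto 0
    rwa [map_zero] at this
  refine ⟨d₁, π, g, φ, Θ, hD, hga, hG0, ?_, hφa, hφ0, hφd, hΘa, ?_, ?_, ?_⟩
  · have h1 : Tendsto (fun t : CSpace m d₁ => ((0 : Fin m → ℂ), t)) (𝓝 0) (𝓝 0) :=
      (Continuous.prodMk_right (0 : Fin m → ℂ)).tendsto 0
    filter_upwards [h1.eventually hr] with t ht
    exact congrArg (fun x : TSpace m d₁ => x.2.2) ht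
  · filter_upwards [hrct.eventually hκwf, hrct.eventually (htr.eventually hl), hjt.eventually hr,
      hrct.eventually hπwf, hrct.eventually hwc] with t h1 h2 h3 h4 h5
    have hz : zL m d₁ (realCoords t) = t.1 := zL_reL_imL t.1 (reL d₁ t.2)
    have hu : (realCoords t).2.2 = reL d₁ t.2 := rfl
    rw [hz] at h1
    rw [hu] at h4
    constructor
    · intro h
      have h6 : φ (realCoords t) = imL d₁ t.2 := funext fun j => (h j).symm
      rw [h6, ofRealL_reL_add] at h4
      have h7 : e.symm (jetL m d₁ t) = totRealL m d₁ (realCoords t) := by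
        rw [← h2, h1, h4]; rfl
      intro j
      have h8 := congrFun (add_conjL t.2) j
      have h9 : Θ (jetL m d₁ t) = (2 : ℂ) • ofRealL d₁ (reL d₁ t.2) - t.2 := by
        simp only [Θ, h7, totRealL_realCoords]; rfl
      rw [h9, ← add_conjL]; simp
    · intro h
      have h6 : conjL d₁ t.2 = (2 : ℂ) • (e.symm (jetL m d₁ t)).2.2 - t.2 := funext h
      have h7 : (e.symm (jetL m d₁ t)).2.2 = ofRealL d₁ (reL d₁ t.2) := by
        have h8 : (2 : ℂ) • (e.symm (jetL m d₁ t)).2.2 = (2 : ℂ) • ofRealL d₁ (reL d₁ t.2) := by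
          rw [← add_conjL, h6]; abel
        exact smul_right_injective _ (two_ne_zero' ℂ) h8
      have h8 : e.symm (jetL m d₁ t) = totRealL m d₁ (realCoords t) := by
        have e1 := congrArg (fun x : TSpace m d₁ => x.1) h3
        have e2 := congrArg (fun x : TSpace m d₁ => x.2.1) h3
        rw [totRealL_realCoords]
        refine Prod.ext ?_ (Prod.ext ?_ h7)
        · exact e1
        · exact e2
      rw [h8, h1] at h3
      have h9 : π (wf (realCoords t)) = t.2 := congrArg (fun x : TSpace m d₁ => x.2.2) h3
      intro j
      change _ = imL d₁ (π (wf (realCoords t))) j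
      rw [h9]; rfl
  · rw [← hγm]
    refine Filter.map_congr ?_
    filter_upwards [hgwf, hπwf, hγz] with s h1 h2 h3
    rw [← h2, h1, ← h3]
  · have hd1 : AnalyticAt ℂ (fun x : TSpace m d₁ => M.Θ (x.1, x.2.1, g x.2)) 0 := by
      refine AnalyticAt.comp (g := M.Θ) (f := fun x : TSpace m d₁ => (x.1, x.2.1, g x.2)) ?_ ?_
      · have : ((0 : TSpace m d₁).1, (0 : TSpace m d₁).2.1, g (0 : TSpace m d₁).2)
            = (0 : TSpace m d) := by
          have : g (0 : TSpace m d₁).2 = 0 := hG0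
          rw [this]; rfl
        rw [this]
        exact M.Θ_analytic 0 (Metric.mem_ball_self (by linarith [M.ρ₁_pos]))
      · exact analyticAt_fst.prod ((analyticAt_fst.comp analyticAt_snd).prod
          (AnalyticAt.comp (g := g) (f := Prod.snd) hga analyticAt_snd))
    have hd2 : ∀ᶠ x : TSpace m d₁ in 𝓝 0,
        DifferentiableAt ℂ (fun x => conjL d (g (conjC m d₁ (x.1, Θ x)))) x := by
      have h1 : Tendsto (fun x : TSpace m d₁ => conjC m d₁ (x.1, Θ x)) (𝓝 0) (𝓝 0) := by
        have h2 : ContinuousAt (fun x : TSpace m d₁ => conjC m d₁ (x.1, Θ x)) 0 :=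
          (conjC m d₁).continuous.continuousAt.comp
            (continuousAt_fst.prodMk hΘa.continuousAt)
        have h3 : conjC m d₁ ((0 : TSpace m d₁).1, Θ 0) = 0 := by
          have : Θ 0 = 0 := by simp [Θ, hes0]
          rw [this]; simp [conjC_apply]
        have := h2.tendsto
        rwa [h3] at this
      filter_upwards [h1.eventually hga.eventually_analyticAt, hΘa.eventually_analyticAt]
        with x h2 h3
      exact DifferentiableAt.comp x (g := fun t => conjL d (g (conjC m d₁ t)))
        (f := fun x : TSpace m d₁ => (x.1, Θ x))
        (differentiableAt_conj_comp_conj h2.differentiableAt)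
        (differentiableAt_fst.prodMk h3.differentiableAt)
    have hd3 : ∀ᶠ x : TSpace m d₁ in 𝓝 0, DifferentiableAt ℂ (fun x =>
        M.Θ (x.1, x.2.1, g x.2) - conjL d (g (conjC m d₁ (x.1, Θ x)))) x := by
      filter_upwards [hd1.eventually_analyticAt, hd2] with x h1 h2
      exact h1.differentiableAt.sub h2
    have hk := eventually_eq_zero_of_totReal (k := fun x => M.Θ ((κ x).1, (κ x).2.1, g (κ x).2)
        - conjL d (g (conjC m d₁ ((κ x).1, Θ (κ x))))) ?_ ?_
    · filter_upwards [hest.eventually hk, hr] with x h1 h2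
      rw [h2] at h1
      exact sub_eq_zero.1 h1
    · filter_upwards [hκt.eventually hd3, hκa.eventually_analyticAt] with x h1 h2
      exact DifferentiableAt.comp x (g := fun x =>
        M.Θ (x.1, x.2.1, g x.2) - conjL d (g (conjC m d₁ (x.1, Θ x)))) h1 h2.differentiableAt
    · filter_upwards [hκwf, hgwf, hγN, hγz, hπwf, htr.eventually hl] with s h1 h2 h3 h4 h5 h6
      rw [h1, sub_eq_zero]
      change M.Θ (conjL m (zL m d₁ s), zL m d₁ s, g (zL m d₁ s, π (wf s)))
        = conjL d (g (conjC m d₁ (conjL m (zL m d₁ s), Θ (pt s))))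
      have h7 : Θ (pt s) = conjL d₁ (π (wf s)) := by
        change (2 : ℂ) • (e.symm (pt s)).2.2 - π (wf s) = _
        rw [show pt s = κ (totRealL m d₁ s) from h1.symm, h6, totRealL_apply]
        have h8 : ofRealL d₁ s.2.2 = ofRealL d₁ (reL d₁ (π (wf s))) := by
          rw [h5]; congr 1; ext j; simp
        rw [h8, ← add_conjL]; abel
      rw [h7, conjC_apply, conjL_conjL, conjL_conjL, h2]
      have h9 := M.conj_snd_eq (hNM h3)
      rw [jetL_apply, h4] at h9
      exact h9.symm

end LocalGeneric

/-! ### The `(0,1)` vector fields and the characteristic variety -/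

theorem complexDimAt_eq_zero_iff {m d : ℕ} {V : Set (CSpace m d)} {p : CSpace m d} :
    complexDimAt V p = 0 ↔ ∀ᶠ q in 𝓝[≠] p, q ∉ V := by
  constructor
  · intro h
    have h1 : complexDimAt V p < 1 := by rw [h]; exact zero_lt_one
    simp only [complexDimAt, iInf_lt_iff] at h1
    obtain ⟨k, ⟨f, -, -, hf⟩, hk⟩ := h1
    have hk0 : k = 0 := by
      have : k < 1 := by exact_mod_cast hk
      omega
    subst hk0
    exact hf.mono fun q hq hqV => hq ⟨hqV, Subsingleton.elim _ _⟩
  · intro h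
    refine le_antisymm ?_ bot_le
    refine (iInf₂_le (0 : ℕ) ⟨fun _ => 0, analyticAt_const, rfl,
      h.mono fun q hq hqV => hq hqV.1⟩).trans ?_
    simp

namespace LocalGeneric

variable {m d : ℕ} (M : LocalGeneric m d)

/-- `L̄ₖ` in terms of the real vector fields `X(eₖ)` and `X(i eₖ)`. -/
theorem Lbar_eq (k : Fin m) (F : RSpace m d → ℂ) (s : RSpace m d) :
    M.Lbar k F s = (1 / 2 : ℂ) * (fderiv ℝ F s (M.X s (Pi.single k 1))
      + Complex.I * fderiv ℝ F s (M.X s (Complex.I • Pi.single k 1))) := by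
  set a := M.Θζ (M.param s) (Pi.single k 1) with ha
  have hconj : conjL m (Pi.single k (1 : ℂ)) = Pi.single k 1 := by
    ext i
    rcases eq_or_ne i k with rfl | h <;> simp [*]
  have hre : reL m (Pi.single k (1 : ℂ)) = Pi.single k 1 := by
    ext i
    rcases eq_or_ne i k with rfl | h <;> simp [*]
  have him : imL m (Pi.single k (1 : ℂ)) = 0 := by
    ext i
    rcases eq_or_ne i k with rfl | h <;> simp [*]
  have hrI : reL m (Complex.I • Pi.single k (1 : ℂ)) = 0 := by
    ext i
    rcases eq_or_ne i k with rfl | h <;> simp [*]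
  have hiI : imL m (Complex.I • Pi.single k (1 : ℂ)) = Pi.single k 1 := by
    ext i
    rcases eq_or_ne i k with rfl | h <;> simp [*]
  have hX1 : M.X s (Pi.single k 1) = (Pi.single k 1, 0, 0) + (0, 0, reL d a) := by
    rw [M.X_apply, hconj, hre, him]; simp [ha]
  have hX2 : M.X s (Complex.I • Pi.single k 1) = (0, Pi.single k 1, 0) + (0, 0, imL d a) := by
    rw [M.X_apply, conjL_I_smul, hconj, hrI, hiI]
    have : reL d (M.Θζ (M.param s) (-(Complex.I • Pi.single k 1))) = imL d a := by
      rw [map_neg, map_smul]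
      ext j; simp [ha]
    rw [this]; simp
  have hsum : ∀ v : Fin d → ℝ, fderiv ℝ F s (0, 0, v)
      = ∑ j, (v j : ℂ) * fderiv ℝ F s (0, 0, Pi.single j 1) := by
    intro v
    have h1 : ((0, 0, v) : RSpace m d) = ∑ j, v j • ((0, 0, Pi.single j 1) : RSpace m d) := by
      refine Prod.ext ?_ (Prod.ext ?_ ?_)
      · simp [Prod.fst_sum]
      · simp [Prod.fst_sum, Prod.snd_sum]
      · ext i
        simp [Prod.snd_sum, Finset.sum_apply, Pi.single_apply]
    rw [h1, map_sum]
    refine Finset.sum_congr rfl fun j _ => ?_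
    rw [map_smul, Complex.real_smul]
  have hcoeff : ∀ j, M.coeff k j (M.param s) = a j := fun j => rfl
  rw [hX1, hX2, map_add, map_add, hsum (reL d a), hsum (imL d a), Lbar]
  have h2 : ∑ j, (1 / 2 : ℂ) * M.coeff k j (M.param s) * fderiv ℝ F s (0, 0, Pi.single j 1)
      = (1 / 2 : ℂ) * (∑ j, ((reL d a j : ℝ) : ℂ) * fderiv ℝ F s (0, 0, Pi.single j 1)
        + Complex.I * ∑ j, ((imL d a j : ℝ) : ℂ) * fderiv ℝ F s (0, 0, Pi.single j 1)) := by
    rw [Finset.mul_sum, ← Finset.sum_add_distrib, Finset.mul_sum]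
    refine Finset.sum_congr rfl fun j _ => ?_
    rw [hcoeff, reL_apply, imL_apply]
    conv_lhs => rw [← Complex.re_add_im (a j)]
    ring
  rw [h2]
  ring

theorem Lbar_congr {k : Fin m} {F F' : RSpace m d → ℂ} {s : RSpace m d} (h : F =ᶠ[𝓝 s] F') :
    M.Lbar k F s = M.Lbar k F' s := by
  simp only [Lbar, h.fderiv_eq]

/-- On functions of `(conj z, z, w)` that are holomorphic in all variables, `L̄ₖ` is the derivative
in the `k`-th variable `ζₖ = conj zₖ`. -/
theorem Lbar_comp_jet {k : Fin m} {K : TSpace m d → ℂ} {s : RSpace m d} (hs : s ∈ M.paramDomain)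
    (hK : DifferentiableAt ℂ K (jetL m d (M.param s))) :
    M.Lbar k (fun s => K (jetL m d (M.param s))) s
      = dirDeriv (Pi.single k 1, 0, 0) K (jetL m d (M.param s)) := by
  set p := jetL m d (M.param s) with hp
  set e : Fin m → ℂ := Pi.single k 1 with he
  have h1 : HasFDerivAt (fun s => K (jetL m d (M.param s)))
      (((fderiv ℂ K p).restrictScalars ℝ).comp ((jetL m d).comp (M.dparam s))) s :=
    (hK.hasFDerivAt.restrictScalars ℝ).comp s
      ((jetL m d).hasFDerivAt.comp s (M.hasFDerivAt_param hs.1))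
  have h2 : ∀ c, fderiv ℝ (fun s => K (jetL m d (M.param s))) s (M.X s c)
      = fderiv ℂ K p (conjL m c, c, M.Bc (M.param s) c) := by
    intro c
    rw [h1.fderiv]
    change fderiv ℂ K p (jetL m d (M.dparam s (M.X s c))) = _
    rw [M.dparam_X hs]; rfl
  have hconj : conjL m e = e := by
    ext i
    rcases eq_or_ne i k with rfl | h <;> simp [e, *]
  have split : ∀ a b f, fderiv ℂ K p (a, b, f)
      = fderiv ℂ K p (a, 0, 0) + fderiv ℂ K p (0, b, f) := by
    intro a b f
    rw [← map_add]; simp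
  have h3 : fderiv ℂ K p (-(Complex.I • e), 0, 0) = -(Complex.I * fderiv ℂ K p (e, 0, 0)) := by
    rw [← smul_eq_mul, ← map_smul, ← map_neg]; simp
  have h4 : fderiv ℂ K p (0, Complex.I • e, Complex.I • M.Bc (M.param s) e)
      = Complex.I * fderiv ℂ K p (0, e, M.Bc (M.param s) e) := by
    rw [← smul_eq_mul, ← map_smul]; simp
  rw [M.Lbar_eq, ← he, h2, h2, conjL_I_smul, hconj, M.Bc_I_smul, split e,
    split (-(Complex.I • e)), h3, h4, dirDeriv]
  linear_combination (-(1 / 2) * fderiv ℂ K p (e, 0, 0)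
    + (1 / 2) * fderiv ℂ K p (0, e, M.Bc (M.param s) e)) * Complex.I_mul_I

theorem LbarPow_comp_jet {K : TSpace m d → ℂ} {Ω : Set (TSpace m d)}
    (hK : AnalyticOnNhd ℂ K Ω) {O : Set (RSpace m d)} (hO : IsOpen O) (hOM : O ⊆ M.paramDomain)
    (hOΩ : ∀ s ∈ O, jetL m d (M.param s) ∈ Ω) {F : RSpace m d → ℂ}
    (hF : ∀ s ∈ O, F s = K (jetL m d (M.param s))) (β : Fin m → ℕ) :
    ∀ s ∈ O, M.LbarPow β F s = dirPow (fun k => (Pi.single k 1, 0, 0)) (List.finRange m) β K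
      (jetL m d (M.param s)) := by
  have step : ∀ (k : Fin m) (n : ℕ) (F : RSpace m d → ℂ) (K : TSpace m d → ℂ),
      AnalyticOnNhd ℂ K Ω → (∀ s ∈ O, F s = K (jetL m d (M.param s))) →
      ∀ s ∈ O, (M.Lbar k)^[n] F s
        = (dirDeriv (Pi.single k 1, 0, 0))^[n] K (jetL m d (M.param s)) := by
    intro k n F K hK hF
    induction n with
    | zero => exact hF
    | succ n ih =>
      intro s hs
      rw [Function.iterate_succ_apply', Function.iterate_succ_apply',
        M.Lbar_congr (F' := fun s => (dirDeriv (Pi.single k 1, 0, 0))^[n] K (jetL m d (M.param s)))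
          (by filter_upwards [hO.mem_nhds hs] with x hx using ih x hx)]
      exact M.Lbar_comp_jet (hOM hs)
        (analyticOnNhd_dirDeriv_iterate hK _ n _ (hOΩ s hs)).differentiableAt
  unfold LbarPow dirPow
  generalize List.finRange m = l
  induction l with
  | nil => exact hF
  | cons k l ih =>
    exact step k (β k) _ _ (analyticOnNhd_dirPow (fun k => (Pi.single k 1, 0, 0)) l β hK) ih

theorem LbarPow_induction {P : (RSpace m d → ℂ) → Prop} (hP : ∀ k F, P F → P (M.Lbar k F))
    {F : RSpace m d → ℂ} (hF : P F) (β : Fin m → ℕ) : P (M.LbarPow β F) := by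
  unfold LbarPow
  generalize List.finRange m = l
  induction l with
  | nil => exact hF
  | cons k l ih =>
    rw [List.foldr_cons]
    generalize β k = n
    induction n with
    | zero => exact ih
    | succ n ih' => rw [Function.iterate_succ_apply']; exact hP _ _ ih'

theorem sum_smul_single {m d : ℕ} (c : Fin m → ℂ) :
    ((List.finRange m).map fun k => c k • ((Pi.single k 1, 0, 0) : TSpace m d)).sum
      = (c, 0, 0) := by
  rw [← List.ofFn_eq_map, List.sum_ofFn]
  refine Prod.ext ?_ (Prod.ext ?_ ?_)
  · ext i
    simp [Prod.fst_sum, Finset.sum_apply, Pi.single_apply]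
  · simp [Prod.snd_sum]
  · simp [Prod.snd_sum]

/-- The characteristic variety of the identity map consists of the points `t'` for which the
Segre variety germs `Θ(ζ, t')` and `Θ(ζ, 0)` coincide. -/
theorem mem_charVariety_id_iff {t : CSpace m d} : t ∈ charVariety M M id M.ρ₁ ↔
    t ∈ Metric.ball 0 M.ρ₁ ∧ ∀ᶠ ζ in 𝓝 (0 : Fin m → ℂ), M.Θ (ζ, t) = M.Θ (ζ, 0) := by
  refine and_congr_right fun ht => ?_
  rw [mem_ball_zero_iff] at ht
  let K : Fin d → TSpace m d → ℂ := fun j x => M.Θ x j - M.Θ (x.1, t) j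
  have hK : ∀ j, AnalyticOnNhd ℂ (K j) (Metric.ball 0 M.ρ₁) := by
    intro j x hx
    rw [mem_ball_zero_iff] at hx
    have h1 : AnalyticAt ℂ M.Θ x := M.Θ_analytic x (by
      rw [mem_ball_zero_iff]; linarith [M.ρ₁_pos])
    have h2 : AnalyticAt ℂ M.Θ (x.1, t) := M.Θ_analytic _ (by
      rw [mem_ball_zero_iff]
      have := (norm_fst_le x).trans_lt hx
      exact max_lt (by linarith [M.ρ₁_pos]) (by linarith [M.ρ₁_pos]))
    have h3 : AnalyticAt ℂ (fun x : TSpace m d => M.Θ (x.1, t)) x :=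
      AnalyticAt.comp (g := M.Θ) (f := fun x : TSpace m d => (x.1, t)) h2
        (analyticAt_fst.prod analyticAt_const)
    exact (((ContinuousLinearMap.proj (R := ℂ) (φ := fun _ : Fin d => ℂ) j).analyticAt _).comp
      h1).sub (((ContinuousLinearMap.proj (R := ℂ) (φ := fun _ : Fin d => ℂ) j).analyticAt _).comp
      h3)
  have hL : ∀ (j : Fin d) (β : Fin m → ℕ), M.LbarPow β (fun s => M.r j t (id (M.param s))) 0
      = dirPow (fun k => (Pi.single k 1, 0, 0)) (List.finRange m) β (K j) 0 := by
    intro j β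
    have h1 := M.LbarPow_comp_jet (hK j) M.isOpen_paramDomain subset_rfl
      (fun s hs => by
        have := mem_ball_zero_iff.1 hs.2
        rw [mem_ball_zero_iff, norm_jetL]; exact this)
      (F := fun s => M.r j t (id (M.param s)))
      (fun s hs => by
        have h2 := congrFun (M.conj_snd_eq (M.param_mem_carrier hs)) j
        simp only [K, ← h2]; rfl) β 0 M.zero_mem_paramDomain
    rw [h1, M.param_zero, map_zero]
  simp only [hL]
  constructor
  · intro h
    have h1 : ∀ᶠ ζ in 𝓝 (0 : Fin m → ℂ),
        ‖(0 : TSpace m d)‖ + ((List.finRange m).map fun k =>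
          ‖ζ k • ((Pi.single k 1, 0, 0) : TSpace m d)‖).sum < M.ρ₁ := by
      have hc : Continuous fun ζ : Fin m → ℂ => ‖(0 : TSpace m d)‖ + ((List.finRange m).map fun k =>
          ‖ζ k • ((Pi.single k 1, 0, 0) : TSpace m d)‖).sum := by
        simp only [← List.ofFn_eq_map, List.sum_ofFn]
        fun_prop
      refine (hc.tendsto 0).eventually_lt_const ?_
      simpa using M.ρ₁_pos
    filter_upwards [h1] with ζ hζ
    ext j
    have h2 := eq_zero_of_dirPow (fun k => ((Pi.single k 1, 0, 0) : TSpace m d)) (hK j) ζ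
      (List.finRange m) (List.nodup_finRange m) 0 (h j) hζ
    rw [sum_smul_single, zero_add] at h2
    exact (sub_eq_zero.1 h2).symm
  · intro h j β
    have hin : ∀ᶠ ζ in 𝓝 (0 : Fin m → ℂ), ((ζ, 0, 0) : TSpace m d) ∈ Metric.ball 0 M.ρ₁ := by
      have hc : Continuous fun ζ : Fin m → ℂ => ((ζ, 0, 0) : TSpace m d) := by fun_prop
      exact (hc.tendsto 0).eventually (Metric.ball_mem_nhds _ M.ρ₁_pos)
    -- vanishing on `{z = w = 0}` is preserved by differentiation in `ζ`
    have step : ∀ (k : Fin m) (n : ℕ) (K : TSpace m d → ℂ),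
        AnalyticOnNhd ℂ K (Metric.ball 0 M.ρ₁) →
        (∀ᶠ ζ in 𝓝 (0 : Fin m → ℂ), K (ζ, 0, 0) = 0) →
        ∀ᶠ ζ in 𝓝 (0 : Fin m → ℂ), (dirDeriv (Pi.single k 1, 0, 0))^[n] K (ζ, 0, 0) = 0 := by
      intro k n K hK h
      induction n with
      | zero => exact h
      | succ n ih =>
        filter_upwards [ih.eventually_nhds, hin] with ζ h1 h2
        rw [Function.iterate_succ_apply']
        have h3 : HasFDerivAt (fun ζ : Fin m → ℂ => ((ζ, 0, 0) : TSpace m d))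
            (ContinuousLinearMap.inl ℂ (Fin m → ℂ) (CSpace m d)) ζ :=
          (ContinuousLinearMap.inl ℂ (Fin m → ℂ) (CSpace m d)).hasFDerivAt
        have h4 := (analyticOnNhd_dirDeriv_iterate hK (Pi.single k 1, 0, 0) n _
          h2).differentiableAt.hasFDerivAt.comp ζ h3
        have h5 := h4.unique ((hasFDerivAt_const (0 : ℂ) ζ).congr_of_eventuallyEq h1)
        exact congrArg (fun L : (Fin m → ℂ) →L[ℂ] ℂ => L (Pi.single k 1)) h5
    have hall : ∀ l : List (Fin m), ∀ᶠ ζ in 𝓝 (0 : Fin m → ℂ),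
        dirPow (fun k => (Pi.single k 1, 0, 0)) l β (K j) (ζ, 0, 0) = 0 := by
      intro l
      induction l with
      | nil => exact h.mono fun ζ hζ => sub_eq_zero.2 (congrFun hζ.symm j)
      | cons k l ih => exact step k (β k) _ (analyticOnNhd_dirPow _ l β (hK j)) ih
    exact (hall _).self_of_nhds

theorem essFinite_iff : M.EssFinite ↔ ∀ᶠ t : CSpace m d in 𝓝 0,
    (∀ᶠ ζ in 𝓝 (0 : Fin m → ℂ), M.Θ (ζ, t) = M.Θ (ζ, 0)) → t = 0 := by
  rw [EssFinite, complexDimAt_eq_zero_iff, eventually_nhdsWithin_iff]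
  have hb := Metric.ball_mem_nhds (0 : CSpace m d) M.ρ₁_pos
  constructor
  · intro h
    filter_upwards [h, hb] with t h1 h2 h3
    by_contra h4
    exact h1 h4 (M.mem_charVariety_id_iff.2 ⟨h2, h3⟩)
  · intro h
    filter_upwards [h] with t h1 h2 h3
    exact h2 (h1 (M.mem_charVariety_id_iff.1 h3).2)

end LocalGeneric

/-! ### Pieces of CR orbits -/

namespace LocalGeneric

variable {m d : ℕ} (M : LocalGeneric m d)

theorem subset_and_tangent_of_orbitPiece {U : Set (CSpace m d)} (hU : U ∈ 𝓝 0) {D : ℕ}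
    {N : Set (CSpace m d)} (hN : IsCROrbitPiece (M.carrier ∩ U) 0 D N) :
    N ⊆ M.carrier ∧ ∀ᶠ q in 𝓝[N] (0 : CSpace m d), ∀ c, (c, M.Bc q c) ∈ tangentVectors N q := by
  have hNS : N ⊆ M.carrier ∩ U :=
    hN.subset_orbit.trans (crOrbit_subset ⟨M.zero_mem_carrier, mem_of_mem_nhds hU⟩)
  refine ⟨fun q hq => (hNS hq).1, ?_⟩
  have hO : IsOpen (M.paramDomain ∩ M.param ⁻¹' interior U) :=
    ContinuousOn.isOpen_inter_preimage (fun s hs =>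
      (M.param_analyticAt hs.1).continuousAt.continuousWithinAt) M.isOpen_paramDomain
      isOpen_interior
  filter_upwards [self_mem_nhdsWithin, mem_nhdsWithin_of_mem_nhds (interior_mem_nhds.2 hU)]
    with q hq hqU c
  have hqM := (hNS hq).1
  have hp := M.param_realCoords hqM.2
  have h1 := M.mem_complexTangentVectors hO Set.inter_subset_left
    (S := M.carrier ∩ U) (fun s hs => ⟨M.param_mem_carrier hs.1, interior_subset hs.2⟩)
    (s := realCoords q)
    ⟨M.realCoords_mem_paramDomain hqM, by rw [Set.mem_preimage, hp]; exact hqU⟩ c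
  rw [hp] at h1
  exact hN.tangent q hq h1

theorem dim_le_of_subset {D : ℕ} {N : Set (CSpace m d)} (hN : IsAnalyticSubmanifold D N)
    (h0 : (0 : CSpace m d) ∈ N) (hNM : N ⊆ M.carrier)
    (hT : ∀ᶠ q in 𝓝[N] (0 : CSpace m d), ∀ c, (c, M.Bc q c) ∈ tangentVectors N q) :
    D ≤ 2 * m + d := by
  obtain ⟨d₁, π, g, φ, Θ, hD, hg, -, hπ, -⟩ := M.exists_normalForm hN h0 hNM hT
  have h1 : HasFDerivAt (fun t => π (g t)) (π.comp (fderiv ℂ g 0)) 0 :=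
    π.hasFDerivAt.comp (0 : CSpace m d₁) hg.differentiableAt.hasFDerivAt
  have h2 := h1.unique ((ContinuousLinearMap.snd ℂ (Fin m → ℂ)
    (Fin d₁ → ℂ)).hasFDerivAt.congr_of_eventuallyEq hπ)
  have hsurj : Function.Surjective π.toLinearMap := fun e =>
    ⟨fderiv ℂ g 0 (0, e), congrArg (fun L : CSpace m d₁ →L[ℂ] (Fin d₁ → ℂ) => L (0, e)) h2⟩
  have h3 := LinearMap.finrank_le_finrank_of_surjective hsurj
  simp only [Module.finrank_fin_fun] at h3
  omega

/-- A piece of a CR orbit inherits essential finiteness: the holomorphic parametrization of its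
intrinsic complexification maps the characteristic variety of the piece into that of `M`. -/
theorem isEssFiniteCRAt_of_essFinite (hM : M.EssFinite) {D : ℕ} {N : Set (CSpace m d)}
    (hN : IsAnalyticSubmanifold D N) (h0 : (0 : CSpace m d) ∈ N) (hNM : N ⊆ M.carrier)
    (hT : ∀ᶠ q in 𝓝[N] (0 : CSpace m d), ∀ c, (c, M.Bc q c) ∈ tangentVectors N q)
    (hD' : 2 * m + 1 ≤ D) : IsEssFiniteCRAt N 0 := by
  obtain ⟨d₁, π, g, φ, Θ, hD, hg, hg0, hπ, hφ, hφ0, hφd, hΘ, hgr, hmap, hid⟩ :=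
    M.exists_normalForm hN h0 hNM hT
  have hφle : ∀ᶠ s in 𝓝 0, ‖φ s‖ ≤ ‖s‖ := by
    have h1 := hφ.differentiableAt.hasFDerivAt.isLittleO.def (c := 1 / 2) (by norm_num)
    filter_upwards [h1] with s hs
    simp only [hφ0, sub_zero] at hs
    have h2 := (fderiv ℝ φ 0).le_opNorm s
    have h3 : φ s = (φ s - fderiv ℝ φ 0 s) + fderiv ℝ φ 0 s := by abel
    rw [h3]
    have h4 := mul_le_mul_of_nonneg_right hφd (norm_nonneg s)
    linarith [norm_add_le (φ s - fderiv ℝ φ 0 s) (fderiv ℝ φ 0 s)]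
  obtain ⟨r₁, hr₁, h₁⟩ := Metric.eventually_nhds_iff_ball.1 (hφle.and hφ.eventually_analyticAt)
  obtain ⟨r₂, hr₂, h₂⟩ := Metric.eventually_nhds_iff_ball.1 hΘ.eventually_analyticAt
  obtain ⟨r₃, hr₃, h₃⟩ := Metric.eventually_nhds_iff_ball.1 hgr
  have hρ₁ : min (min r₁ r₂) r₃ ≤ r₁ := (min_le_left _ _).trans (min_le_left _ _)
  have hρ₂ : min (min r₁ r₂) r₃ ≤ r₂ := (min_le_left _ _).trans (min_le_right _ _)
  have hρ₃ : min (min r₁ r₂) r₃ ≤ r₃ := min_le_right _ _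
  have hρ : 0 < min (min r₁ r₂) r₃ := lt_min (lt_min hr₁ hr₂) hr₃
  generalize min (min r₁ r₂) r₃ = ρ at hρ₁ hρ₂ hρ₃ hρ
  let G : LocalGeneric m d₁ :=
    { m_pos := M.m_pos
      d_pos := by omega
      ρ₁ := ρ / 2
      ρ₁_pos := half_pos hρ
      φ := φ
      φ_analytic := fun s hs => (h₁ s (Metric.ball_subset_ball (by linarith) hs)).2
      φ_lt := fun δ _ hδ s hs => (h₁ s (by
        rw [mem_ball_zero_iff]; linarith)).1.trans_lt hs
      Θ := Θ
      Θ_analytic := fun x hx => h₂ x (Metric.ball_subset_ball (by linarith) hx)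
      graph_iff := fun t ht => h₃ t (Metric.ball_subset_ball (by linarith) ht) }
  let Ψ : CSpace m d₁ → CSpace m d := fun t => (t.1, g t)
  have hΨ : AnalyticAt ℂ Ψ 0 := analyticAt_fst.prod hg
  have hΨ0 : Ψ 0 = 0 := by simp only [Ψ, hg0]; rfl
  refine ⟨m, d₁, G, Ψ, hΨ, hΨ0, ?_, ?_, ?_⟩
  · have h1 : HasFDerivAt (fun t => π (g t)) (π.comp (fderiv ℂ g 0)) 0 :=
      π.hasFDerivAt.comp (0 : CSpace m d₁) hg.differentiableAt.hasFDerivAt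
    have h2 := h1.unique ((ContinuousLinearMap.snd ℂ (Fin m → ℂ)
      (Fin d₁ → ℂ)).hasFDerivAt.congr_of_eventuallyEq hπ)
    have h3 : HasFDerivAt Ψ ((ContinuousLinearMap.fst ℂ _ _).prod (fderiv ℂ g 0)) 0 :=
      hasFDerivAt_fst.prodMk hg.differentiableAt.hasFDerivAt
    rw [h3.fderiv, injective_iff_map_eq_zero]
    intro v hv
    have hv1 : v.1 = 0 := congrArg Prod.fst hv
    have hv2 : fderiv ℂ g 0 v = 0 := congrArg Prod.snd hv
    have h4 : π (fderiv ℂ g 0 v) = v.2 :=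
      congrArg (fun L : CSpace m d₁ →L[ℂ] (Fin d₁ → ℂ) => L v) h2
    rw [hv2, map_zero] at h4
    exact Prod.ext hv1 h4.symm
  · rw [← G.map_param_nhds, Filter.map_map, ← hmap]
    rfl
  · rw [G.essFinite_iff]
    obtain ⟨r, hr, hidr⟩ := Metric.eventually_nhds_iff_ball.1 hid
    have hΨt : Tendsto Ψ (𝓝 0) (𝓝 0) := by
      have := hΨ.continuousAt.tendsto
      rwa [hΨ0] at this
    filter_upwards [hΨt.eventually (M.essFinite_iff.1 hM), hπ, Metric.ball_mem_nhds _ hr]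
      with t h1 h2 h3 h4
    have h5 : Ψ t = 0 := by
      refine h1 ?_
      filter_upwards [h4, Metric.ball_mem_nhds _ hr] with ζ h6 h7
      rw [mem_ball_zero_iff] at h3 h7
      have h8 := hidr (ζ, t) (mem_ball_zero_iff.2 (max_lt h7 h3))
      have h9 := hidr (ζ, 0) (mem_ball_zero_iff.2 (max_lt h7 (by rwa [norm_zero])))
      have h10 : Θ (ζ, t) = Θ (ζ, 0) := h6
      simp only [h10] at h8
      have h11 := h8.trans h9.symm
      simp only [hg0] at h11
      exact h11
    have h6 : g t = 0 := congrArg Prod.snd h5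
    rw [h6, map_zero] at h2
    have h7 : t.1 = 0 := congrArg Prod.fst h5
    exact Prod.ext h7 h2.symm

end LocalGeneric

/-! ### CR mappings along complex submanifolds -/

/-- A real linear form on `ℂᵐ` is `ℂ`-linear as soon as it is so on the basis vectors. -/
theorem clm_I_smul_of_single {m : ℕ} {L : (Fin m → ℂ) →L[ℝ] ℂ}
    (h : ∀ k, L (Complex.I • Pi.single k 1) = Complex.I * L (Pi.single k 1)) (v : Fin m → ℂ) :
    L (Complex.I • v) = Complex.I * L v := by
  have hL : ∀ v : Fin m → ℂ, L v = ∑ k, v k * L (Pi.single k 1) := by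
    intro v
    have h1 : v = ∑ k, ((v k).re • (Pi.single k 1 : Fin m → ℂ)
        + (v k).im • (Complex.I • (Pi.single k 1 : Fin m → ℂ))) := by
      ext i
      simp only [Finset.sum_apply, Pi.add_apply, Pi.smul_apply, Pi.single_apply, smul_eq_mul,
        Complex.real_smul, mul_ite, mul_one, mul_zero]
      rw [Finset.sum_eq_single i]
      · simp [Complex.re_add_im]
      · intro k _ hk; simp [hk.symm]
      · simp
    conv_lhs => rw [h1]
    rw [map_sum]
    refine Finset.sum_congr rfl fun k _ => ?_
    rw [map_add, map_smul, map_smul, h, Complex.real_smul, Complex.real_smul]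
    conv_rhs => rw [← Complex.re_add_im (v k)]
    ring
  rw [hL, hL v, Finset.mul_sum]
  refine Finset.sum_congr rfl fun k _ => ?_
  rw [Pi.smul_apply, smul_eq_mul, mul_assoc]

namespace LocalGeneric

variable {m d : ℕ} (M : LocalGeneric m d)

/-- Near its central point, `Θ(0, ·)` has zeros different from the origin. -/
theorem frequently_Θ_zero : ∃ᶠ t : CSpace m d in 𝓝 0, t ≠ 0 ∧ M.Θ (0, t) = 0 := by
  have hΘ : HasFDerivAt M.Θ (M.dΘ 0) 0 := by
    have := M.hasFDerivAt_Θ (Metric.mem_ball_self M.ρ₁_pos)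
    rwa [map_zero] at this
  have hΘ0 : M.Θ 0 = 0 := by
    have := M.conj_snd_eq M.zero_mem_carrier
    rw [map_zero] at this
    rw [← this]; simp
  let f : CSpace m d → CSpace m d := fun t => (t.1, M.Θ (0, t))
  have hf0 : f 0 = 0 := Prod.ext rfl hΘ0
  have hfa : AnalyticAt ℂ f 0 := by
    refine analyticAt_fst.prod (AnalyticAt.comp (g := M.Θ)
      (f := fun t : CSpace m d => ((0 : Fin m → ℂ), t)) ?_ (analyticAt_const.prod analyticAt_id))
    exact M.Θ_analytic 0 (Metric.mem_ball_self (by linarith [M.ρ₁_pos]))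
  have hfd : HasFDerivAt f ((ContinuousLinearMap.fst ℂ _ _).prod
      ((M.dΘ 0).comp (ContinuousLinearMap.inr ℂ (Fin m → ℂ) (CSpace m d)))) 0 :=
    hasFDerivAt_fst.prodMk (HasFDerivAt.comp (0 : CSpace m d) (g := M.Θ) hΘ
      (ContinuousLinearMap.inr ℂ (Fin m → ℂ) (CSpace m d)).hasFDerivAt)
  have hfs := hfa.hasStrictFDerivAt
  rw [hfd.fderiv] at hfs
  have hsurj := M.Θw_surjective M.zero_mem_paramDomain
  rw [M.param_zero] at hsurj
  have hmap := hfs.map_nhds_eq_of_surj (by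
    rw [LinearMap.range_eq_top]
    rintro ⟨a, b⟩
    obtain ⟨e, he⟩ := hsurj (b - M.Θz 0 a)
    refine ⟨(a, e), Prod.ext rfl ?_⟩
    change M.dΘ 0 (0, a, e) = b
    rw [M.dΘ_apply, he]; simp)
  rw [hf0] at hmap
  have h1 : ∃ᶠ p : CSpace m d in 𝓝 0, p.1 ≠ 0 ∧ p.2 = 0 := by
    have : Nonempty (Fin m) := ⟨⟨0, M.m_pos⟩⟩
    have ht : Tendsto (fun z : Fin m → ℂ => ((z, 0) : CSpace m d)) (𝓝[≠] 0) (𝓝 0) := by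
      have : Continuous fun z : Fin m → ℂ => ((z, 0) : CSpace m d) := by fun_prop
      exact (this.tendsto 0).mono_left nhdsWithin_le_nhds
    refine ht.frequently (Eventually.frequently ?_)
    filter_upwards [self_mem_nhdsWithin] with z hz using ⟨hz, rfl⟩
  rw [← hmap, frequently_map] at h1
  refine h1.mono fun t ht => ⟨?_, ht.2⟩
  rintro rfl
  exact ht.1 rfl

end LocalGeneric

namespace LocalCRMap

variable {m d m' d' : ℕ} {M : LocalGeneric m d} {M' : LocalGeneric m' d'}

/-- If `M` contains the germ at the origin of a complex submanifold `{w = g(z)}`, whose dimension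
is the CR dimension of `M`, then no CR mapping defined on `M` is essentially finite.

The mapping restricts to a holomorphic map `f` on the complex submanifold. By polarization,
`conj f_w(z) = Θ'(conj f_z(z), f(z₀))` for all `z` and `z₀`; since the vector fields `L̄ₖ` are
tangent to the complex submanifold, all points `f(z₀)` belong to the characteristic variety. If
`f` vanishes identically, then all zeros of `Θ'(0, ·)` belong to it. -/
theorem not_essFinite_of_holomorphic_graph (H : LocalCRMap M M')
    {g : (Fin m → ℂ) → (Fin d → ℂ)} (hg : AnalyticAt ℂ g 0) (hg0 : g 0 = 0)
    (hgM : ∀ᶠ z in 𝓝 0, (z, g z) ∈ M.carrier) : ¬ H.EssFinite := by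
  intro hH
  have hH' : ∀ᶠ q in 𝓝 0, q ∈ charVariety M M' H.h H.ρ₂' → q = 0 := by
    have := complexDimAt_eq_zero_iff.1 hH
    rw [eventually_nhdsWithin_iff] at this
    exact this.mono fun q h1 h2 => by_contra fun h3 => h1 h3 h2
  let σ : (Fin m → ℂ) → CSpace m d := fun z => (z, g z)
  have hσ0 : σ 0 = 0 := Prod.ext rfl hg0
  have hσa : AnalyticAt ℂ σ 0 := analyticAt_id.prod hg
  have hσt : Tendsto σ (𝓝 0) (𝓝 0) := by
    have := hσa.continuousAt.tendsto
    rwa [hσ0] at this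
  let τ : (Fin m → ℂ) → RSpace m d := fun z => realCoords (σ z)
  have hrc0 : realCoords (0 : CSpace m d) = 0 := (realCoordsL m d).map_zero
  have hτ0 : τ 0 = 0 := by simp only [τ, hσ0, hrc0]
  have hτt : Tendsto τ (𝓝 0) (𝓝 0) := by
    have h1 : Tendsto (fun t : CSpace m d => realCoords t) (𝓝 0) (𝓝 0) := by
      have := (realCoordsL m d).continuous.tendsto 0
      rwa [_root_.map_zero] at this
    exact h1.comp hσt
  have hpτ : ∀ᶠ z in 𝓝 0, M.param (τ z) = σ z := by
    filter_upwards [hgM] with z hz using M.param_realCoords hz.2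
  have hτM : ∀ᶠ z in 𝓝 0, τ z ∈ M.paramDomain := by
    filter_upwards [hgM] with z hz using M.realCoords_mem_paramDomain hz
  -- the tangent spaces of the complex submanifold are the complex tangent spaces of `M`
  have hτd : ∀ᶠ z in 𝓝 0, HasFDerivAt τ (M.X (τ z)) z := by
    filter_upwards [hgM.eventually_nhds, hg.eventually_analyticAt, hpτ, hτM] with z h1 h2 h3 h4
    have h5 : HasFDerivAt σ ((ContinuousLinearMap.id ℂ _).prod (fderiv ℂ g z)) z :=
      (hasFDerivAt_id z).prodMk h2.differentiableAt.hasFDerivAt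
    have h6 := h5.restrictScalars ℝ
    have h7 : ∀ c, fderiv ℂ g z c = M.Bc (σ z) c := by
      intro c
      have h8 := range_subset_tangentVectors (N := M.carrier) h6 h1 c
      have h9 := range_subset_tangentVectors (N := M.carrier) h6 h1 (Complex.I • c)
      refine M.snd_of_complexTangent (q := σ z) (v := (c, fderiv ℂ g z c)) subset_rfl
        h1.self_of_nhds ⟨h8, ?_⟩
      have h10 : Complex.I • ((c, fderiv ℂ g z c) : CSpace m d)
          = (Complex.I • c, fderiv ℂ g z (Complex.I • c)) := by
        rw [map_smul]; rfl
      rw [h10]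
      exact h9
    refine ((realCoordsL m d).hasFDerivAt.comp z h6).congr_fderiv ?_
    refine ContinuousLinearMap.ext fun c => ?_
    change realCoordsL m d (c, fderiv ℂ g z c) = M.X (τ z) c
    rw [h7, ← h3, ← M.dparam_X h4, M.realCoordsL_dparam]
  -- the vector fields `L̄ₖ` are tangent to the complex submanifold
  let P : (RSpace m d → ℂ) → Prop := fun F =>
    (∀ᶠ s in 𝓝 0, ContDiffAt ℝ ∞ F s) ∧ ∀ᶠ z in 𝓝 0, F (τ z) = 0
  have hP : ∀ k F, P F → P (M.Lbar k F) := by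
    rintro k F ⟨hF, hF0⟩
    refine ⟨?_, ?_⟩
    · have h1 : M.Lbar k F = fun s => (1 / 2 : ℂ) * (fderiv ℝ F s (M.X s (Pi.single k 1))
          + Complex.I * fderiv ℝ F s (M.X s (Complex.I • Pi.single k 1))) :=
        funext fun s => M.Lbar_eq k F s
      rw [h1]
      filter_upwards [hF, M.isOpen_paramDomain.mem_nhds M.zero_mem_paramDomain] with s h2 h3
      have h4 : ContDiffAt ℝ ∞ (fderiv ℝ F) s := h2.fderiv_right (by simp)
      have h5 : ContDiffAt ℝ ∞ M.X s := (M.X_analyticAt h3).contDiffAt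
      have h6 : ∀ c, ContDiffAt ℝ ∞ (fun s => fderiv ℝ F s (M.X s c)) s := fun c =>
        h4.clm_apply (h5.clm_apply contDiffAt_const)
      exact contDiffAt_const.mul ((h6 _).add (contDiffAt_const.mul (h6 _)))
    · filter_upwards [hF0.eventually_nhds, hτt.eventually hF, hτd] with z h1 h2 h3
      have h4 : HasFDerivAt (fun z => F (τ z)) ((fderiv ℝ F (τ z)).comp (M.X (τ z))) z :=
        (h2.differentiableAt (by simp)).hasFDerivAt.comp z h3
      have h5 := h4.unique ((hasFDerivAt_const (0 : ℂ) z).congr_of_eventuallyEq h1)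
      have h6 : ∀ c, fderiv ℝ F (τ z) (M.X (τ z) c) = 0 := fun c =>
        congrArg (fun L : (Fin m → ℂ) →L[ℝ] ℂ => L c) h5
      rw [M.Lbar_eq, h6, h6]; simp
  -- the restriction of the mapping to the complex submanifold is holomorphic
  let f : (Fin m → ℂ) → CSpace m' d' := fun z => H.h (σ z)
  have hf0 : f 0 = 0 := by simp only [f, hσ0, H.map_zero]
  have hsm : ∀ᶠ s in 𝓝 0, ContDiffAt ℝ ∞ (fun s => H.h (M.param s)) s := by
    filter_upwards [M.isOpen_paramDomain.mem_nhds M.zero_mem_paramDomain] with s hs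
    exact H.smooth.contDiffAt (M.isOpen_paramDomain.mem_nhds hs)
  have hcomp : ∀ F : RSpace m d → ℂ, (∀ᶠ s in 𝓝 0, ContDiffAt ℝ ∞ F s) →
      (∀ s ∈ M.paramDomain, ∀ k, M.Lbar k F s = 0) →
      ∀ᶠ z in 𝓝 0, DifferentiableAt ℂ (fun z => F (τ z)) z := by
    intro F hF hL
    filter_upwards [hτt.eventually hF, hτd, hτM] with z h1 h2 h3
    have h4 : HasFDerivAt (fun z => F (τ z)) ((fderiv ℝ F (τ z)).comp (M.X (τ z))) z :=
      (h1.differentiableAt (by simp)).hasFDerivAt.comp z h2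
    refine differentiableAt_complex_of_real h4.differentiableAt ?_
    rw [h4.fderiv]
    refine clm_I_smul_of_single fun k => ?_
    have h5 := hL _ h3 k
    rw [M.Lbar_eq] at h5
    have h6 := (mul_eq_zero.1 h5).resolve_left (by norm_num)
    simp only [ContinuousLinearMap.comp_apply]
    linear_combination (-Complex.I) * h6 +
      fderiv ℝ F (τ z) (M.X (τ z) (Complex.I • Pi.single k 1)) * Complex.I_mul_I
  have hfd : ∀ᶠ z in 𝓝 0, DifferentiableAt ℂ f z := by
    have h1 : ∀ᶠ z in 𝓝 0, ∀ i, DifferentiableAt ℂ (fun z => (H.h (M.param (τ z))).1 i) z := by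
      rw [eventually_all]
      intro i
      refine hcomp (fun s => (H.h (M.param s)).1 i) (hsm.mono fun s hs => ?_)
        fun s hs k => H.cr_fst s hs k i
      exact contDiffAt_pi.1 (contDiff_fst.contDiffAt.comp s hs) i
    have h2 : ∀ᶠ z in 𝓝 0, ∀ i, DifferentiableAt ℂ (fun z => (H.h (M.param (τ z))).2 i) z := by
      rw [eventually_all]
      intro i
      refine hcomp (fun s => (H.h (M.param s)).2 i) (hsm.mono fun s hs => ?_)
        fun s hs k => H.cr_snd s hs k i
      exact contDiffAt_pi.1 (contDiff_snd.contDiffAt.comp s hs) i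
    filter_upwards [h1, h2, hpτ.eventually_nhds] with z h3 h4 h5
    have h6 : DifferentiableAt ℂ (fun z => H.h (M.param (τ z))) z :=
      (differentiableAt_pi.2 h3).prodMk (differentiableAt_pi.2 h4)
    exact h6.congr_of_eventuallyEq (h5.mono fun x hx => congrArg H.h hx.symm)
  have hft : Tendsto f (𝓝 0) (𝓝 0) := by
    have := hfd.self_of_nhds.continuousAt.tendsto
    rwa [hf0] at this
  have hfM : ∀ᶠ z in 𝓝 0, f z ∈ M'.carrier := by
    filter_upwards [hgM, hσt.eventually (Metric.ball_mem_nhds _ H.ρ₂_pos)] with z h1 h2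
    exact (H.mapsTo ⟨h1, h2⟩).1
  -- a criterion for membership in the characteristic variety
  have hV : ∀ t' ∈ Metric.ball (0 : CSpace m' d') H.ρ₂',
      (∀ᶠ z in 𝓝 0, conjL d' (f z).2 = M'.Θ (conjL m' (f z).1, t')) →
      t' ∈ charVariety M M' H.h H.ρ₂' := by
    intro t' ht' hz
    refine ⟨ht', fun j β => ?_⟩
    have h1 : P fun s => M'.r j t' (H.h (M.param s)) := by
      refine ⟨?_, ?_⟩
      · have hc : Tendsto (fun s => ((conjL m' (H.h (M.param s)).1, t') : TSpace m' d')) (𝓝 0)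
            (𝓝 (0, t')) := by
          have h2 := hsm.self_of_nhds.continuousAt
          have h3 : ContinuousAt
              (fun s => ((conjL m' (H.h (M.param s)).1, t') : TSpace m' d')) 0 :=
            ((conjL m').continuous.continuousAt.comp (continuousAt_fst.comp h2)).prodMk
              continuousAt_const
          have h4 : ((conjL m' (H.h (M.param 0)).1, t') : TSpace m' d') = (0, t') := by
            rw [M.param_zero, H.map_zero]; simp
          rw [← h4]
          exact h3.tendsto
        have hb : ((0, t') : TSpace m' d') ∈ Metric.ball 0 (2 * M'.ρ₁) := by
          rw [mem_ball_zero_iff] at ht' ⊢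
          have := H.ρ₂'_lt
          have := M'.ρ₁_pos
          exact max_lt (by rw [norm_zero]; linarith) (by linarith)
        filter_upwards [hsm, hc.eventually (Metric.isOpen_ball.mem_nhds hb)] with s h2 h3
        have h4 : ContDiffAt ℝ ∞ (fun s => conjL d' (H.h (M.param s)).2) s :=
          (conjL d').contDiff.contDiffAt.comp s (contDiff_snd.contDiffAt.comp s h2)
        have h5 : ContDiffAt ℝ ∞
            (fun s => ((conjL m' (H.h (M.param s)).1, t') : TSpace m' d')) s :=
          ((conjL m').contDiff.contDiffAt.comp s (contDiff_fst.contDiffAt.comp s h2)).prodMk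
            contDiffAt_const
        have h6 : ContDiffAt ℝ ∞ M'.Θ (conjL m' (H.h (M.param s)).1, t') :=
          (M'.Θ_analytic _ h3).restrictScalars.contDiffAt
        have h7 : ContDiffAt ℝ ∞ (fun s => M'.Θ (conjL m' (H.h (M.param s)).1, t')) s :=
          ContDiffAt.comp s h6 h5
        exact (contDiffAt_pi.1 h4 j).sub (contDiffAt_pi.1 h7 j)
      · filter_upwards [hz, hpτ] with z h2 h3
        rw [h3]
        exact sub_eq_zero.2 (congrFun h2 j)
    have h2 := (M.LbarPow_induction hP h1 β).2.self_of_nhds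
    rwa [hτ0] at h2
  have hball := Metric.ball_mem_nhds (0 : CSpace m' d') H.ρ₂'_pos
  -- polarization of the equation `f(z) ∈ M'`
  have hpol : ∀ᶠ x : TSpace m 0 in 𝓝 0,
      conjL d' (f (conjL m x.1)).2 - M'.Θ (conjL m' (f (conjL m x.1)).1, f x.2.1) = 0 := by
    have hcj : Tendsto (fun x : TSpace m 0 => conjL m x.1) (𝓝 0) (𝓝 0) := by
      have : Continuous fun x : TSpace m 0 => conjL m x.1 := by fun_prop
      simpa using this.tendsto 0
    have hz : Tendsto (fun x : TSpace m 0 => x.2.1) (𝓝 0) (𝓝 0) := by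
      have : Continuous fun x : TSpace m 0 => x.2.1 := by fun_prop
      simpa using this.tendsto 0
    refine eventually_eq_zero_of_totReal ?_ ?_
    · have hin : ∀ᶠ x : TSpace m 0 in 𝓝 0,
          ((conjL m' (f (conjL m x.1)).1, f x.2.1) : TSpace m' d')
            ∈ Metric.ball 0 (2 * M'.ρ₁) := by
        filter_upwards [(hft.comp hcj).eventually (Metric.ball_mem_nhds _ M'.ρ₁_pos),
          (hft.comp hz).eventually (Metric.ball_mem_nhds _ M'.ρ₁_pos)] with x h1 h2
        have h3 := M'.ρ₁_pos
        have h4 := norm_jetL (f (conjL m x.1))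
        have h5 : ‖conjL m' (f (conjL m x.1)).1‖ ≤ ‖jetL m' d' (f (conjL m x.1))‖ :=
          norm_fst_le (jetL m' d' _)
        have h6 : ‖f (conjL m x.1)‖ < M'.ρ₁ := mem_ball_zero_iff.1 h1
        have h7 : ‖f x.2.1‖ < M'.ρ₁ := mem_ball_zero_iff.1 h2
        rw [mem_ball_zero_iff]
        exact max_lt (by linarith) (by linarith)
      filter_upwards [hcj.eventually hfd, hz.eventually hfd, hin] with x h1 h2 h3
      let q : TSpace m 0 →L[ℂ] CSpace m 0 := (ContinuousLinearMap.fst ℂ _ _).prod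
        ((ContinuousLinearMap.snd ℂ (Fin m → ℂ) _).comp (ContinuousLinearMap.snd ℂ _ _))
      have hbar : ∀ {n : ℕ} (φ : CSpace m' d' →L[ℂ] (Fin n → ℂ)),
          DifferentiableAt ℂ (fun x : TSpace m 0 => conjL n (φ (f (conjL m x.1)))) x := by
        intro n φ
        have h4 : DifferentiableAt ℂ (fun t : CSpace m 0 => φ (f t.1)) (conjC m 0 (q x)) :=
          φ.differentiableAt.comp _ (DifferentiableAt.comp (g := f) _ h1 differentiableAt_fst)
        exact DifferentiableAt.comp x (g := fun t => conjL n (φ (f (conjC m 0 t).1))) (f := q)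
          (differentiableAt_conj_comp_conj h4) q.differentiableAt
      refine (hbar (ContinuousLinearMap.snd ℂ _ _)).sub ?_
      refine DifferentiableAt.comp x (g := M'.Θ)
        (f := fun x : TSpace m 0 => ((conjL m' (f (conjL m x.1)).1, f x.2.1) : TSpace m' d'))
        (M'.Θ_analytic _ h3).differentiableAt ?_
      exact (hbar (ContinuousLinearMap.fst ℂ _ _)).prodMk
        (DifferentiableAt.comp x (g := f) h2 (differentiableAt_fst.comp x differentiableAt_snd))
    · have hzt : Tendsto (zL m 0) (𝓝 0) (𝓝 0) := by
        have := (zL m 0).continuous.tendsto 0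
        rwa [_root_.map_zero] at this
      filter_upwards [hzt.eventually hfM] with s hs
      rw [totRealL_apply]
      simp only [conjL_conjL]
      exact sub_eq_zero.2 (M'.conj_snd_eq hs)
  obtain ⟨r, hr, hpolr⟩ := Metric.eventually_nhds_iff_ball.1 hpol
  have hf : ∀ᶠ z₀ in 𝓝 0, f z₀ = 0 := by
    filter_upwards [hft.eventually hH', hft.eventually hball, Metric.ball_mem_nhds _ hr]
      with z₀ h1 h2 h3
    refine h1 (hV _ h2 ?_)
    filter_upwards [Metric.ball_mem_nhds _ hr] with z hz
    rw [mem_ball_zero_iff] at h3 hz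
    have h4 : ‖conjL m z‖ < r := by
      have h5 : ‖conjL m z‖ ≤ ‖jetL m 0 (z, 0)‖ := norm_fst_le (jetL m 0 (z, 0))
      rw [norm_jetL] at h5
      exact h5.trans_lt (max_lt hz (by rwa [norm_zero]))
    have h5 := hpolr (conjL m z, z₀, 0) (mem_ball_zero_iff.2
      (max_lt h4 (max_lt h3 (by rwa [norm_zero]))))
    simp only [conjL_conjL] at h5
    exact sub_eq_zero.1 h5
  obtain ⟨t', ⟨ht', hΘt'⟩, h1, h2⟩ :=
    (M'.frequently_Θ_zero.and_eventually (hH'.and hball)).exists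
  refine ht' (h1 (hV t' h2 ?_))
  filter_upwards [hf] with z hz
  rw [hz, Prod.fst_zero, Prod.snd_zero, _root_.map_zero, _root_.map_zero, hΘt']

/-- If an essentially finite CR mapping is defined on `M`, then `M` contains no complex
submanifold of dimension `m`, so the pieces of its CR orbit have dimension greater than `2m`. -/
theorem dim_ge_of_essFinite {H : LocalCRMap M M'} (hH : H.EssFinite) {D : ℕ}
    {N : Set (CSpace m d)} (hN : IsAnalyticSubmanifold D N) (h0 : (0 : CSpace m d) ∈ N)
    (hNM : N ⊆ M.carrier)
    (hT : ∀ᶠ q in 𝓝[N] (0 : CSpace m d), ∀ c, (c, M.Bc q c) ∈ tangentVectors N q) :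
    2 * m + 1 ≤ D := by
  obtain ⟨d₁, π, g, φ, Θ, hD, hg, hg0, -, -, -, -, -, -, hmap, -⟩ :=
    M.exists_normalForm hN h0 hNM hT
  by_contra hlt
  obtain rfl : d₁ = 0 := by omega
  refine H.not_essFinite_of_holomorphic_graph (g := fun z => g (z, 0)) ?_ hg0 ?_ hH
  · exact AnalyticAt.comp (g := g) (f := fun z : Fin m → ℂ => ((z, 0) : CSpace m 0)) hg
      (analyticAt_id.prod analyticAt_const)
  · have h1 : ∀ᶠ y in 𝓝[N] (0 : CSpace m d), y ∈ N := eventually_mem_nhdsWithin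
    rw [← hmap, eventually_map] at h1
    have h2 : Tendsto (fun z : Fin m → ℂ => ((reL m z, imL m z, 0) : RSpace m 0)) (𝓝 0) (𝓝 0) := by
      have : Continuous fun z : Fin m → ℂ => ((reL m z, imL m z, 0) : RSpace m 0) := by fun_prop
      exact this.tendsto' 0 0
        (Prod.ext (_root_.map_zero _) (Prod.ext (_root_.map_zero _) rfl))
    filter_upwards [h2.eventually h1] with z hz
    have h3 := hNM hz
    rw [zL_reL_imL] at h3
    convert h3 using 4

end LocalCRMap

namespace LocalGeneric

variable {m d : ℕ} (M : LocalGeneric m d)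

/-- The identity map of `M`, as a local CR mapping. -/
def idMap : LocalCRMap M M where
  h := id
  map_zero := rfl
  smooth := fun s hs => (M.param_analyticAt hs.1).contDiffAt.contDiffWithinAt
  cr_fst := fun s hs k i => by
    let K : TSpace m d →L[ℂ] ℂ := (ContinuousLinearMap.proj i).comp
      ((ContinuousLinearMap.fst ℂ (Fin m → ℂ) (Fin d → ℂ)).comp (ContinuousLinearMap.snd ℂ _ _))
    have h := M.Lbar_comp_jet (k := k) hs (K := K) K.differentiableAt
    rw [dirDeriv, K.fderiv] at h
    exact h
  cr_snd := fun s hs k i => by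
    let K : TSpace m d →L[ℂ] ℂ := (ContinuousLinearMap.proj i).comp
      ((ContinuousLinearMap.snd ℂ (Fin m → ℂ) (Fin d → ℂ)).comp (ContinuousLinearMap.snd ℂ _ _))
    have h := M.Lbar_comp_jet (k := k) hs (K := K) K.differentiableAt
    rw [dirDeriv, K.fderiv] at h
    exact h
  ρ₂ := M.ρ₁ / 2
  ρ₂' := M.ρ₁ / 2
  ρ₂_pos := half_pos M.ρ₁_pos
  ρ₂_lt := half_lt_self M.ρ₁_pos
  ρ₂'_pos := half_pos M.ρ₁_pos
  ρ₂'_lt := half_lt_self M.ρ₁_pos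
  mapsTo := fun _ h => h

theorem idMap_essFinite (hM : M.EssFinite) : M.idMap.EssFinite := by
  refine complexDimAt_eq_zero_iff.2 ((complexDimAt_eq_zero_iff.1 hM).mono fun q hq hqV => hq ?_)
  exact ⟨Metric.ball_subset_ball (half_le_self M.ρ₁_pos.le) hqV.1, hqV.2⟩

end LocalGeneric

end CRGeom

end

open CRGeom in
theorem lemma2p12 :
    (∀ (m' d' : ℕ) (M' : LocalGeneric m' d'), M'.EssFinite →
      (∃ (D : ℕ) (N : Set (CSpace m' d')), IsCROrbitPiece M'.carrier 0 D N) ∧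
      ∀ (D : ℕ) (N : Set (CSpace m' d')), IsCROrbitPiece M'.carrier 0 D N →
        2 * m' + 1 ≤ D ∧ IsEssFiniteCRAt N 0) ∧
    (∀ (m m' d' : ℕ) (M : LocalGeneric m 1) (M' : LocalGeneric m' d') (H : LocalCRMap M M'),
      H.EssFinite → IsMinimalAt M.carrier 0) := by
  refine ⟨fun m' d' M' hM' => ⟨?_, fun D N hN => ?_⟩, fun m m' d' M M' H hH U hU => ?_⟩
  · have h := M'.exists_orbitPiece univ_mem
    rwa [Set.inter_univ] at h
  · rw [← Set.inter_univ M'.carrier] at hN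
    obtain ⟨hNM, hT⟩ := M'.subset_and_tangent_of_orbitPiece univ_mem hN
    have hD := LocalCRMap.dim_ge_of_essFinite (M'.idMap_essFinite hM') hN.submanifold hN.mem hNM hT
    exact ⟨hD, M'.isEssFiniteCRAt_of_essFinite hM' hN.submanifold hN.mem hNM hT hD⟩
  · obtain ⟨D, N, hN⟩ := M.exists_orbitPiece hU
    obtain ⟨hNM, hT⟩ := M.subset_and_tangent_of_orbitPiece hU hN
    have h1 := LocalCRMap.dim_ge_of_essFinite hH hN.submanifold hN.mem hNM hT
    have h2 := M.dim_le_of_subset hN.submanifold hN.mem hNM hT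
    exact mem_of_superset
      (M.mem_nhdsWithin_of_dim hN.submanifold hN.mem hNM (le_antisymm h2 h1)) hN.subset_orbit
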